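/- Let $1<\alpha\le 2$, $\delta\in\mathbb{R}$ and $h_*\ge 0$. Consider the Ising model with spins $\sigma\in\{-1,+1\}^{\mathbb{Z}}$, coupling $J(r)=r^{-\alpha}$ for $r\ge 1$ and $J(0)=0$, and external field $h_0=h_*$, $h_x=h_*|x|^{-\delta}$ for $x\neq 0$, that is, with the formal Hamiltonian $$H(\sigma)=\sum_{x<y}J(|x-y|)(1-\sigma_x\sigma_y)+\sum_x h_x(1-\sigma_x).$$ Let $\langle\cdot\rangle^{\pm}_{\beta,L}$ be the Gibbs state in $[-L,L]\cap\mathbb{Z}$ at inverse temperature $\beta$ when all spins outside $[-L,L]$ equal $\pm1$. We say that there is a phase transition if there is $\bar\beta>0$, which may depend on $\alpha,\delta,h_*$, such that for every $\beta\ge\bar\beta$ the limits $\langle\sigma_0\rangle^{\pm}_{\beta}=\lim_{L\to\infty}\langle\sigma_0\rangle^{\pm}_{\beta,L}$ exist, $\langle\sigma_0\rangle^{-}_{\beta}\neq\langle\sigma_0\rangle^{+}_{\beta}$, and the model has at least two infinite-volume Gibbs measures (solutions of the DLR equations) at inverse temperature $\beta$. (i) If $\delta>\alpha-1$, there is a phase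 transition, for every $h_*\ge 0$. (ii) If $\delta=\alpha-1$ and $1<\alpha<2$, there is a phase transition whenever $$h_*<\frac{8-4\alpha}{2^{3-\alpha}+6-3\alpha}.$$ (iii) If $\alpha=2$ and $\delta=1$, there is a phase transition whenever $$h_*<\frac{4}{3+2\log 2}.$$ -/

import Mathlib

/-!
One-dimensional long-range ferromagnetic Ising model with an external field.
-/

namespace LongRangeIsing

open MeasureTheory Filter Topology

/-- Spin configurations on `ℤ`: `true` stands for the spin `+1`, `false` for the spin `-1`.
The space carries the product topology and the product sigma-algebra. -/
abbrev Config : Type := ℤ → Bool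

/-- The value `±1` of a spin. -/
def spin (b : Bool) : ℝ := if b then 1 else -1

/-- The coupling `J(r) = r ^ (-α)` for `r > 0`, and `J(0) = 0`. -/
noncomputable def coupling (α : ℝ) (r : ℕ) : ℝ :=
  if r = 0 then 0 else (r : ℝ) ^ (-α)

/-- The polynomially decaying field `h_0 = hs`, `h_x = hs * |x| ^ (-δ)` for `x ≠ 0`. -/
noncomputable def decayingField (hs δ : ℝ) (x : ℤ) : ℝ :=
  if x = 0 then hs else hs * |(x : ℝ)| ^ (-δ)

/-- The Hamiltonian in the finite volume `Λ`,
`∑ J(|x - y|) (1 - σ_x σ_y) + ∑_{x ∈ Λ} h_x (1 - σ_x)`,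
where the first sum runs over the pairs `x < y` that meet `Λ`. If `σ` is constant outside `Λ`,
all other pairs contribute `0`, so the first sum is then the sum over all pairs `x < y`. -/
noncomputable def hamiltonian (α : ℝ) (h : ℤ → ℝ) (Λ : Finset ℤ) (σ : Config) : ℝ :=
  (∑' p : ℤ × ℤ, if p.1 < p.2 ∧ (p.1 ∈ Λ ∨ p.2 ∈ Λ) then
      coupling α (p.1 - p.2).natAbs * (1 - spin (σ p.1) * spin (σ p.2)) else 0)
    + ∑ x ∈ Λ, h x * (1 - spin (σ x))

/-- The configuration that equals `τ` in `Λ` and `ω` outside `Λ`. -/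
def glue (Λ : Finset ℤ) (τ : Λ → Bool) (ω : Config) : Config :=
  fun x => if hx : x ∈ Λ then τ ⟨x, hx⟩ else ω x

/-- The partition function in `Λ` at inverse temperature `β` with boundary condition `ω`. -/
noncomputable def partitionFunction (α : ℝ) (h : ℤ → ℝ) (β : ℝ) (Λ : Finset ℤ) (ω : Config) : ℝ :=
  ∑ τ : Λ → Bool, Real.exp (-β * hamiltonian α h Λ (glue Λ τ ω))

/-- The finite-volume Gibbs expectation of `f` in `Λ` at inverse temperature `β` with boundary
condition `ω`. -/
noncomputable def gibbsExp (α : ℝ) (h : ℤ → ℝ) (β : ℝ) (Λ : Finset ℤ) (f : Config → ℝ)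
    (ω : Config) : ℝ :=
  (∑ τ : Λ → Bool, f (glue Λ τ ω) * Real.exp (-β * hamiltonian α h Λ (glue Λ τ ω)))
    / partitionFunction α h β Λ ω

/-- The box `[-L, L] ∩ ℤ`. -/
noncomputable def box (L : ℕ) : Finset ℤ := Finset.Icc (-(L : ℤ)) (L : ℤ)

/-- The expectation of the spin at the origin in `[-L, L]`, with all spins outside the box equal
to `b` (`b = true`: plus boundary condition, `b = false`: minus boundary condition). -/
noncomputable def magnetization (α : ℝ) (h : ℤ → ℝ) (β : ℝ) (b : Bool) (L : ℕ) : ℝ :=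
  gibbsExp α h β (box L) (fun σ => spin (σ 0)) (fun _ => b)

/-- Infinite-volume Gibbs measures at inverse temperature `β`, through the
Dobrushin-Lanford-Ruelle equations. -/
def IsGibbsMeasure (α : ℝ) (h : ℤ → ℝ) (β : ℝ) (μ : Measure Config) : Prop :=
  IsProbabilityMeasure μ ∧
    ∀ (Λ : Finset ℤ) (A : Set Config), MeasurableSet A →
      μ A = ∫⁻ ω, ENNReal.ofReal (gibbsExp α h β Λ (A.indicator fun _ => 1) ω) ∂μ

/-- Phase transition at low temperature: for all large `β` the infinite-volume limits of the
plus and of the minus magnetization at the origin exist and differ, and there is more than one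
infinite-volume Gibbs measure. -/
def HasPhaseTransition (α : ℝ) (h : ℤ → ℝ) : Prop :=
  ∃ β₀ : ℝ, 0 < β₀ ∧ ∀ β : ℝ, β₀ ≤ β →
    (∃ mMinus mPlus : ℝ,
      Tendsto (magnetization α h β false) atTop (𝓝 mMinus) ∧
      Tendsto (magnetization α h β true) atTop (𝓝 mPlus) ∧
      mMinus ≠ mPlus) ∧
    ∃ μ ν : Measure Config, IsGibbsMeasure α h β μ ∧ IsGibbsMeasure α h β ν ∧ μ ≠ ν

end LongRangeIsing

/-!
The ferromagnetic model is attractive: by the four functions theorem finite-volume expectations of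
increasing functions are monotone in the boundary condition, so the magnetizations converge, and
compactness of the configuration space yields Gibbs measures with the limiting magnetizations.

The separation of the two magnetizations is a Peierls argument. The boundary points of the spin
clusters are grouped into contours: a maximal partition into sets of even cardinality which are far
apart compared to their diameters. Reversing the spins inside a contour gains the coupling across
it, up to a small fraction lost to the other contours. For a set of `n` sites this coupling is at
least `4 * ∑ k ≤ n, k ^ (1 - α)`, as a comparison with intervals shows, whereas a field with
`|h x| ≤ κ * |x| ^ (1 - α)` costs at most `κ` times as much; hence the condition `κ < 1`. The
coupling also bounds the number of blocks met by the contour on all dyadic scales up to its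
diameter, and this number controls the entropy.

A field which violates the bound on a finite set only is reduced to the previous case: if the
magnetizations for plus and minus boundary conditions had the same limit, then so would the
expectations of all local functions, even after a change of the field on a finite set.
-/

namespace LongRangeIsing

open MeasureTheory Filter Topology
open scoped ENNReal

/-! ### Couplings -/

lemma coupling_nonneg (α : ℝ) (r : ℕ) : 0 ≤ coupling α r := by
  unfold coupling
  split_ifs <;> positivity

lemma coupling_pos (α : ℝ) {r : ℕ} (hr : r ≠ 0) : 0 < coupling α r := by
  rw [coupling, if_neg hr]
  positivity

lemma coupling_anti {α : ℝ} (hα : 0 ≤ α) {r s : ℕ} (hr : 0 < r) (hrs : r ≤ s) :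
    coupling α s ≤ coupling α r := by
  rw [coupling, coupling, if_neg (hr.trans_le hrs).ne', if_neg hr.ne']
  exact Real.rpow_le_rpow_of_nonpos (by exact_mod_cast hr) (by exact_mod_cast hrs) (by linarith)

lemma summable_coupling {α : ℝ} (hα : 1 < α) : Summable (coupling α) := by
  refine .of_nonneg_of_le (coupling_nonneg α) (fun r => ?_)
    (Real.summable_nat_rpow.2 (show -α < -1 by linarith))
  unfold coupling
  split_ifs
  · positivity
  · exact le_rfl

lemma summable_coupling_natAbs_sub {α : ℝ} (hα : 1 < α) (x : ℤ) :
    Summable fun y : ℤ => coupling α (x - y).natAbs := by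
  have hint : Summable fun n : ℤ => coupling α n.natAbs := by
    apply Summable.of_nat_of_neg <;> simpa using summable_coupling hα
  exact hint.comp_injective (i := fun y : ℤ => x - y) sub_right_injective

/-- The coupling between the two sites of a pair. -/
noncomputable def pairCoupling (α : ℝ) (p : ℤ × ℤ) : ℝ := coupling α (p.1 - p.2).natAbs

lemma pairCoupling_nonneg (α : ℝ) (p : ℤ × ℤ) : 0 ≤ pairCoupling α p := coupling_nonneg _ _

lemma pairCoupling_swap (α : ℝ) (p : ℤ × ℤ) : pairCoupling α p.swap = pairCoupling α p := by
  rw [pairCoupling, pairCoupling, ← Int.natAbs_neg, neg_sub, Prod.fst_swap, Prod.snd_swap]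

/-- The measure on pairs of sites that gives each pair its coupling. Pairs are ordered, so the
total coupling across a symmetric set of pairs is counted twice. -/
noncomputable def couplingMeasure (α : ℝ) : Measure (ℤ × ℤ) :=
  Measure.count.withDensity fun p => ENNReal.ofReal (pairCoupling α p)

lemma couplingMeasure_apply (α : ℝ) (S : Set (ℤ × ℤ)) :
    couplingMeasure α S = ∑' p, S.indicator (fun p => ENNReal.ofReal (pairCoupling α p)) p := by
  rw [couplingMeasure, withDensity_apply _ S.to_countable.measurableSet,
    ← lintegral_indicator S.to_countable.measurableSet, lintegral_count]

lemma couplingMeasure_singleton (α : ℝ) (p : ℤ × ℤ) :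
    couplingMeasure α {p} = ENNReal.ofReal (pairCoupling α p) := by
  rw [couplingMeasure_apply, ← tsum_subtype]
  exact tsum_singleton p fun p => ENNReal.ofReal (pairCoupling α p)

lemma toReal_couplingMeasure (α : ℝ) (S : Set (ℤ × ℤ)) :
    (couplingMeasure α S).toReal = ∑' p, S.indicator (pairCoupling α) p := by
  rw [couplingMeasure_apply, ENNReal.tsum_toReal_eq]
  · refine tsum_congr fun p => ?_
    by_cases hp : p ∈ S <;> simp [hp, pairCoupling_nonneg]
  · intro p
    by_cases hp : p ∈ S <;> simp [hp]

lemma summable_indicator_pairCoupling {α : ℝ} {S : Set (ℤ × ℤ)} (hS : couplingMeasure α S ≠ ∞) :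
    Summable (S.indicator (pairCoupling α)) := by
  rw [couplingMeasure_apply] at hS
  refine (ENNReal.summable_toReal hS).congr fun p => ?_
  by_cases hp : p ∈ S <;> simp [hp, pairCoupling_nonneg]

lemma couplingMeasure_le_mul_of_injOn {α c : ℝ} (hc : 0 ≤ c) {S T : Set (ℤ × ℤ)}
    {f : ℤ × ℤ → ℤ × ℤ} (hST : Set.MapsTo f S T) (hf : S.InjOn f)
    (hle : ∀ p ∈ S, pairCoupling α p ≤ c * pairCoupling α (f p)) :
    couplingMeasure α S ≤ ENNReal.ofReal c * couplingMeasure α T := by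
  set g : ℤ × ℤ → ℝ≥0∞ := fun p => ENNReal.ofReal (pairCoupling α p)
  rw [couplingMeasure_apply, couplingMeasure_apply, ← tsum_subtype S g, ← tsum_subtype T g]
  calc ∑' p : S, g p ≤ ∑' p : S, ENNReal.ofReal c * g (f p) := by
        refine ENNReal.tsum_le_tsum fun p => ?_
        rw [← ENNReal.ofReal_mul hc]
        exact ENNReal.ofReal_le_ofReal (hle p p.2)
    _ = ENNReal.ofReal c * ∑' p : S, g (hST.restrict f S T p) := ENNReal.tsum_mul_left
    _ ≤ ENNReal.ofReal c * ∑' p : T, g p :=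
        mul_le_mul_right (ENNReal.tsum_comp_le_tsum_of_injective (hST.restrict_inj.2 hf) _) _

lemma couplingMeasure_preimage_swap (α : ℝ) (S : Set (ℤ × ℤ)) :
    couplingMeasure α (Prod.swap ⁻¹' S) = couplingMeasure α S := by
  rw [couplingMeasure_apply, couplingMeasure_apply, ← (Equiv.prodComm ℤ ℤ).tsum_eq (S.indicator _)]
  refine tsum_congr fun p => ?_
  by_cases hp : p.swap ∈ S <;> simp [hp, pairCoupling_swap]

lemma couplingMeasure_row_ne_top {α : ℝ} (hα : 1 < α) (x : ℤ) :
    couplingMeasure α {p | p.1 = x} ≠ ∞ := by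
  rw [couplingMeasure_apply, ENNReal.tsum_prod', tsum_eq_single x]
  · simpa [pairCoupling] using (summable_coupling_natAbs_sub hα x).tsum_ofReal_ne_top
  · intro y hy
    simp [hy]

/-- The pairs of sites that meet `Λ`, over which the Hamiltonian in `Λ` is summed. -/
def touching (Λ : Finset ℤ) : Set (ℤ × ℤ) := {p | p.1 ∈ Λ ∨ p.2 ∈ Λ}

lemma couplingMeasure_touching_ne_top {α : ℝ} (hα : 1 < α) (Λ : Finset ℤ) :
    couplingMeasure α (touching Λ) ≠ ∞ := by
  have hrows : couplingMeasure α (⋃ x ∈ Λ, {p | p.1 = x}) ≠ ∞ :=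
    ((measure_biUnion_finset_le _ _).trans_lt
      (ENNReal.sum_lt_top.2 fun x _ => (couplingMeasure_row_ne_top hα x).lt_top)).ne
  have hcover : touching Λ ⊆
      (⋃ x ∈ Λ, {p | p.1 = x}) ∪ Prod.swap ⁻¹' (⋃ x ∈ Λ, {p : ℤ × ℤ | p.1 = x}) := by
    rintro p (hp | hp) <;> simp [hp]
  refine ((measure_mono hcover).trans_lt ((measure_union_le _ _).trans_lt ?_)).ne
  rw [couplingMeasure_preimage_swap]
  exact ENNReal.add_lt_top.2 ⟨hrows.lt_top, hrows.lt_top⟩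

/-! ### The Hamiltonian -/

lemma spin_mono : Monotone spin := by
  intro a b hab
  cases a <;> cases b
  · exact le_rfl
  · norm_num [spin]
  · exact absurd hab (by decide)
  · exact le_rfl

lemma abs_spin (b : Bool) : |spin b| = 1 := by cases b <;> simp [spin]

lemma spin_not (b : Bool) : spin (!b) = -spin b := by cases b <;> simp [spin]

lemma spin_mul_spin (a b : Bool) : spin a * spin b = if a = b then 1 else -1 := by
  cases a <;> cases b <;> simp [spin]

/-- The contribution of a pair of sites to the Hamiltonian in `Λ`. -/
noncomputable def pairEnergy (α : ℝ) (Λ : Finset ℤ) (σ : Config) (p : ℤ × ℤ) : ℝ :=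
  if p.1 < p.2 ∧ (p.1 ∈ Λ ∨ p.2 ∈ Λ) then
    coupling α (p.1 - p.2).natAbs * (1 - spin (σ p.1) * spin (σ p.2)) else 0

lemma hamiltonian_eq (α : ℝ) (h : ℤ → ℝ) (Λ : Finset ℤ) (σ : Config) :
    hamiltonian α h Λ σ = (∑' p, pairEnergy α Λ σ p) + ∑ x ∈ Λ, h x * (1 - spin (σ x)) := rfl

lemma norm_pairEnergy_le (α : ℝ) (Λ : Finset ℤ) (σ : Config) (p : ℤ × ℤ) :
    ‖pairEnergy α Λ σ p‖ ≤ 2 * (touching Λ).indicator (pairCoupling α) p := by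
  have hc := coupling_nonneg α (p.1 - p.2).natAbs
  unfold pairEnergy pairCoupling
  by_cases hp : p.1 ∈ Λ ∨ p.2 ∈ Λ
  · rw [Set.indicator_of_mem (show p ∈ touching Λ from hp), spin_mul_spin]
    split_ifs <;> norm_num [abs_of_nonneg hc, mul_comm] <;> exact hc
  · simp [hp, touching]

lemma summable_pairEnergy {α : ℝ} (hα : 1 < α) (Λ : Finset ℤ) (σ : Config) :
    Summable (pairEnergy α Λ σ) :=
  .of_norm_bounded
    ((summable_indicator_pairCoupling (couplingMeasure_touching_ne_top hα Λ)).mul_left 2)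
    (norm_pairEnergy_le α Λ σ)

lemma continuous_spin_apply (x : ℤ) : Continuous fun σ : Config => spin (σ x) :=
  (continuous_of_discreteTopology (f := spin)).comp (continuous_apply x)

lemma continuous_hamiltonian {α : ℝ} (hα : 1 < α) (h : ℤ → ℝ) (Λ : Finset ℤ) :
    Continuous (hamiltonian α h Λ) := by
  have hpair (p : ℤ × ℤ) : Continuous fun σ => pairEnergy α Λ σ p := by
    unfold pairEnergy
    split_ifs
    · exact continuous_const.mul
        (continuous_const.sub ((continuous_spin_apply p.1).mul (continuous_spin_apply p.2)))
    · exact continuous_const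
  refine (continuous_tsum hpair
    ((summable_indicator_pairCoupling (couplingMeasure_touching_ne_top hα Λ)).mul_left 2)
    fun p σ => norm_pairEnergy_le α Λ σ p).add (continuous_finsetSum _ fun x _ => ?_)
  exact continuous_const.mul (continuous_const.sub (continuous_spin_apply x))

/-! ### Finite-volume Gibbs expectations -/

lemma glue_apply_mem {Λ : Finset ℤ} {τ : Λ → Bool} {ω : Config} {x : ℤ} (hx : x ∈ Λ) :
    glue Λ τ ω x = τ ⟨x, hx⟩ := dif_pos hx

lemma glue_apply_notMem {Λ : Finset ℤ} {τ : Λ → Bool} {ω : Config} {x : ℤ} (hx : x ∉ Λ) :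
    glue Λ τ ω x = ω x := dif_neg hx

lemma glue_restrict (Λ : Finset ℤ) {σ ω : Config} (h : ∀ x ∉ Λ, σ x = ω x) :
    glue Λ (fun x => σ x) ω = σ := by
  funext x
  by_cases hx : x ∈ Λ
  · rw [glue_apply_mem hx]
  · rw [glue_apply_notMem hx, h x hx]

lemma glue_glue (Λ : Finset ℤ) (τ τ' : Λ → Bool) (ω : Config) :
    glue Λ τ (glue Λ τ' ω) = glue Λ τ ω := by
  funext x
  by_cases hx : x ∈ Λ
  · simp only [glue_apply_mem hx]
  · simp only [glue_apply_notMem hx]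

lemma glue_mono (Λ : Finset ℤ) {τ τ' : Λ → Bool} (hτ : τ ≤ τ') {ω ω' : Config} (hω : ω ≤ ω') :
    glue Λ τ ω ≤ glue Λ τ' ω' := by
  intro x
  by_cases hx : x ∈ Λ
  · simpa only [glue_apply_mem hx] using hτ _
  · simpa only [glue_apply_notMem hx] using hω x

lemma continuous_glue (Λ : Finset ℤ) (τ : Λ → Bool) : Continuous (glue Λ τ) := by
  refine continuous_pi fun x => ?_
  by_cases hx : x ∈ Λ
  · simpa only [glue_apply_mem hx] using continuous_const
  · simpa only [glue_apply_notMem hx] using continuous_apply x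

lemma sum_sum_glue_comm {Λ Λ' : Finset ℤ} (hΛ : Λ ⊆ Λ') (ω : Config) (F : Config → Config → ℝ) :
    ∑ τ' : Λ' → Bool, ∑ τ : Λ → Bool, F (glue Λ' τ' ω) (glue Λ τ (glue Λ' τ' ω)) =
      ∑ τ' : Λ' → Bool, ∑ τ : Λ → Bool, F (glue Λ τ (glue Λ' τ' ω)) (glue Λ' τ' ω) := by
  simp only [← Fintype.sum_prod_type']
  set exchange : (Λ' → Bool) × (Λ → Bool) → (Λ' → Bool) × (Λ → Bool) := fun q =>
    (fun x => glue Λ q.2 (glue Λ' q.1 ω) x, fun x => glue Λ' q.1 ω x)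
  have hfst (q) : glue Λ' (exchange q).1 ω = glue Λ q.2 (glue Λ' q.1 ω) := by
    refine glue_restrict Λ' (σ := glue Λ q.2 (glue Λ' q.1 ω)) fun x hx => ?_
    rw [glue_apply_notMem fun h => hx (hΛ h), glue_apply_notMem hx]
  have hsnd (q) : glue Λ (exchange q).2 (glue Λ' (exchange q).1 ω) = glue Λ' q.1 ω := by
    rw [hfst, glue_glue]
    exact glue_restrict Λ (σ := glue Λ' q.1 ω) fun x _ => rfl
  have hinv : Function.Involutive exchange := fun q =>
    Prod.ext (funext fun x => (congr_fun (hsnd q) x).trans (glue_apply_mem x.2))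
      (funext fun x => (congr_fun (hfst q) x).trans (glue_apply_mem x.2))
  refine Fintype.sum_equiv hinv.toPerm _ _ fun q => ?_
  rw [Function.Involutive.coe_toPerm, hsnd, hfst]

/-- The Boltzmann weight of a configuration in the volume `Λ`. -/
noncomputable def weight (α : ℝ) (h : ℤ → ℝ) (β : ℝ) (Λ : Finset ℤ) (σ : Config) : ℝ :=
  Real.exp (-β * hamiltonian α h Λ σ)

section GibbsExpectation

variable {α β : ℝ} {h : ℤ → ℝ} {Λ : Finset ℤ}

lemma weight_pos (σ : Config) : 0 < weight α h β Λ σ := Real.exp_pos _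

lemma continuous_weight (hα : 1 < α) : Continuous (weight α h β Λ) :=
  Real.continuous_exp.comp (continuous_const.mul (continuous_hamiltonian hα h Λ))

lemma partitionFunction_eq (ω : Config) :
    partitionFunction α h β Λ ω = ∑ τ : Λ → Bool, weight α h β Λ (glue Λ τ ω) := rfl

lemma partitionFunction_pos (ω : Config) : 0 < partitionFunction α h β Λ ω :=
  Finset.sum_pos (fun _ _ => weight_pos _) Finset.univ_nonempty

lemma partitionFunction_glue (τ : Λ → Bool) (ω : Config) :
    partitionFunction α h β Λ (glue Λ τ ω) = partitionFunction α h β Λ ω := by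
  simp only [partitionFunction_eq, glue_glue]

lemma gibbsExp_eq (f : Config → ℝ) (ω : Config) :
    gibbsExp α h β Λ f ω =
      (∑ τ : Λ → Bool, f (glue Λ τ ω) * weight α h β Λ (glue Λ τ ω)) /
        partitionFunction α h β Λ ω := rfl

lemma gibbsExp_const (c : ℝ) (ω : Config) : gibbsExp α h β Λ (fun _ => c) ω = c := by
  rw [gibbsExp_eq, ← Finset.mul_sum, ← partitionFunction_eq,
    mul_div_cancel_right₀ _ (partitionFunction_pos ω).ne']

lemma gibbsExp_add (f g : Config → ℝ) (ω : Config) :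
    gibbsExp α h β Λ (fun σ => f σ + g σ) ω =
      gibbsExp α h β Λ f ω + gibbsExp α h β Λ g ω := by
  simp only [gibbsExp_eq, add_mul, Finset.sum_add_distrib, add_div]

lemma gibbsExp_const_mul (c : ℝ) (f : Config → ℝ) (ω : Config) :
    gibbsExp α h β Λ (fun σ => c * f σ) ω = c * gibbsExp α h β Λ f ω := by
  simp only [gibbsExp_eq, mul_assoc, ← Finset.mul_sum, mul_div_assoc]

lemma gibbsExp_le_gibbsExp {f g : Config → ℝ} {ω : Config}
    (hfg : ∀ τ, f (glue Λ τ ω) ≤ g (glue Λ τ ω)) :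
    gibbsExp α h β Λ f ω ≤ gibbsExp α h β Λ g ω := by
  rw [gibbsExp_eq, gibbsExp_eq]
  gcongr with τ
  · exact (partitionFunction_pos ω).le
  · exact (weight_pos _).le
  · exact hfg τ

lemma gibbsExp_le_of_forall_le {f : Config → ℝ} {c : ℝ} (hf : ∀ σ, f σ ≤ c) (ω : Config) :
    gibbsExp α h β Λ f ω ≤ c :=
  (gibbsExp_le_gibbsExp fun _ => hf _).trans_eq (gibbsExp_const c ω)

lemma le_gibbsExp_of_forall_le {f : Config → ℝ} {c : ℝ} (hf : ∀ σ, c ≤ f σ) (ω : Config) :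
    c ≤ gibbsExp α h β Λ f ω :=
  (gibbsExp_const c ω).symm.trans_le (gibbsExp_le_gibbsExp fun _ => hf _)

lemma continuous_gibbsExp (hα : 1 < α) {f : Config → ℝ} (hf : Continuous f) :
    Continuous (gibbsExp α h β Λ f) := by
  have hw (τ : Λ → Bool) : Continuous fun ω => weight α h β Λ (glue Λ τ ω) :=
    (continuous_weight hα).comp (continuous_glue Λ τ)
  exact .div (continuous_finsetSum _ fun τ _ => (hf.comp (continuous_glue Λ τ)).mul (hw τ))
    (continuous_finsetSum _ fun τ _ => hw τ) fun ω => (partitionFunction_pos ω).ne'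

end GibbsExpectation

lemma pairEnergy_sub_pairEnergy_eq {α : ℝ} {Λ Λ' : Finset ℤ} (hΛ : Λ ⊆ Λ') {σ σ' : Config}
    (hσ : ∀ x ∉ Λ, σ x = σ' x) (p : ℤ × ℤ) :
    pairEnergy α Λ' σ p - pairEnergy α Λ σ p = pairEnergy α Λ' σ' p - pairEnergy α Λ σ' p := by
  unfold pairEnergy
  by_cases h1 : p.1 ∈ Λ
  · simp [h1, hΛ h1]
  by_cases h2 : p.2 ∈ Λ
  · simp [h2, hΛ h2]
  · simp [h1, h2, hσ _ h1, hσ _ h2]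

lemma hamiltonian_sub_hamiltonian_eq {α : ℝ} (hα : 1 < α) (h : ℤ → ℝ) {Λ Λ' : Finset ℤ}
    (hΛ : Λ ⊆ Λ') {σ σ' : Config} (hσ : ∀ x ∉ Λ, σ x = σ' x) :
    hamiltonian α h Λ' σ - hamiltonian α h Λ σ =
      hamiltonian α h Λ' σ' - hamiltonian α h Λ σ' := by
  have hsub (σ : Config) : hamiltonian α h Λ' σ - hamiltonian α h Λ σ =
      (∑' p, (pairEnergy α Λ' σ p - pairEnergy α Λ σ p)) +
        ∑ x ∈ Λ' \ Λ, h x * (1 - spin (σ x)) := by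
    rw [(summable_pairEnergy hα Λ' σ).tsum_sub (summable_pairEnergy hα Λ σ), hamiltonian_eq,
      hamiltonian_eq, ← Finset.sum_sdiff hΛ]
    ring
  rw [hsub, hsub]
  congr 1
  · exact tsum_congr fun p => pairEnergy_sub_pairEnergy_eq hΛ hσ p
  · exact Finset.sum_congr rfl fun x hx => by rw [hσ x (Finset.mem_sdiff.1 hx).2]

lemma weight_mul_weight_comm {α : ℝ} (hα : 1 < α) (h : ℤ → ℝ) (β : ℝ) {Λ Λ' : Finset ℤ}
    (hΛ : Λ ⊆ Λ') {σ σ' : Config} (hσ : ∀ x ∉ Λ, σ x = σ' x) :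
    weight α h β Λ' σ * weight α h β Λ σ' = weight α h β Λ' σ' * weight α h β Λ σ := by
  unfold weight
  rw [← Real.exp_add, ← Real.exp_add]
  congr 1
  linear_combination (-β) * hamiltonian_sub_hamiltonian_eq hα h hΛ hσ

lemma gibbsExp_gibbsExp {α : ℝ} (hα : 1 < α) (h : ℤ → ℝ) (β : ℝ) {Λ Λ' : Finset ℤ}
    (hΛ : Λ ⊆ Λ') (f : Config → ℝ) (ω : Config) :
    gibbsExp α h β Λ' (gibbsExp α h β Λ f) ω = gibbsExp α h β Λ' f ω := by
  rw [gibbsExp_eq, gibbsExp_eq]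
  congr 1
  set w := weight α h β Λ
  set w' := weight α h β Λ'
  set Z := partitionFunction α h β Λ
  calc ∑ τ' : Λ' → Bool, gibbsExp α h β Λ f (glue Λ' τ' ω) * w' (glue Λ' τ' ω)
      = ∑ τ' : Λ' → Bool, ∑ τ : Λ → Bool, f (glue Λ τ (glue Λ' τ' ω)) *
          w (glue Λ τ (glue Λ' τ' ω)) / Z (glue Λ' τ' ω) * w' (glue Λ' τ' ω) := by
        simp only [gibbsExp_eq, Finset.sum_div, Finset.sum_mul, w, Z]
    _ = ∑ τ' : Λ' → Bool, ∑ τ : Λ → Bool, f (glue Λ' τ' ω) * w (glue Λ' τ' ω) /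
          Z (glue Λ τ (glue Λ' τ' ω)) * w' (glue Λ τ (glue Λ' τ' ω)) :=
        sum_sum_glue_comm hΛ ω fun σ σ' => f σ' * w σ' / Z σ * w' σ
    _ = ∑ τ' : Λ' → Bool, ∑ τ : Λ → Bool, f (glue Λ' τ' ω) * w' (glue Λ' τ' ω) *
          (w (glue Λ τ (glue Λ' τ' ω)) / Z (glue Λ' τ' ω)) := by
        refine Finset.sum_congr rfl fun τ' _ => Finset.sum_congr rfl fun τ _ => ?_
        have hcomm := weight_mul_weight_comm hα h β hΛ (σ := glue Λ τ (glue Λ' τ' ω))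
          (σ' := glue Λ' τ' ω) fun x hx => glue_apply_notMem hx
        rw [show Z (glue Λ τ (glue Λ' τ' ω)) = Z (glue Λ' τ' ω) from partitionFunction_glue τ _]
        linear_combination f (glue Λ' τ' ω) / Z (glue Λ' τ' ω) * hcomm
    _ = ∑ τ' : Λ' → Bool, f (glue Λ' τ' ω) * w' (glue Λ' τ' ω) := by
        refine Finset.sum_congr rfl fun τ' _ => ?_
        rw [← Finset.mul_sum, ← Finset.sum_div, ← partitionFunction_eq,
          div_self (partitionFunction_pos _).ne', mul_one]

/-! ### Attractiveness -/

lemma spin_submodular (a b a' b' : Bool) :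
    spin a * spin b + spin a' * spin b' ≤
      spin (a ⊓ a') * spin (b ⊓ b') + spin (a ⊔ a') * spin (b ⊔ b') := by
  cases a <;> cases b <;> cases a' <;> cases b' <;> norm_num [spin]

lemma spin_inf_add_spin_sup (a b : Bool) : spin (a ⊓ b) + spin (a ⊔ b) = spin a + spin b := by
  cases a <;> cases b <;> simp [spin]

lemma pairEnergy_submodular (α : ℝ) (Λ : Finset ℤ) (σ σ' : Config) (p : ℤ × ℤ) :
    pairEnergy α Λ (σ ⊓ σ') p + pairEnergy α Λ (σ ⊔ σ') p ≤
      pairEnergy α Λ σ p + pairEnergy α Λ σ' p := by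
  unfold pairEnergy
  split_ifs
  · simp only [Pi.inf_apply, Pi.sup_apply]
    linear_combination mul_le_mul_of_nonneg_left
      (spin_submodular (σ p.1) (σ p.2) (σ' p.1) (σ' p.2)) (coupling_nonneg α (p.1 - p.2).natAbs)
  · simp

lemma pairEnergy_submodular_lt (α : ℝ) {Λ : Finset ℤ} {σ σ' : Config} {p : ℤ × ℤ}
    (hp : p.1 < p.2) (hΛ : p.1 ∈ Λ ∨ p.2 ∈ Λ) (hne : σ p.1 ≠ σ p.2) (h₁ : σ' p.1 ≠ σ p.1)
    (h₂ : σ' p.2 ≠ σ p.2) :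
    pairEnergy α Λ (σ ⊓ σ') p + pairEnergy α Λ (σ ⊔ σ') p <
      pairEnergy α Λ σ p + pairEnergy α Λ σ' p := by
  have hc := coupling_pos α (r := (p.1 - p.2).natAbs) (by lia)
  unfold pairEnergy
  simp only [if_pos (And.intro hp hΛ), Pi.inf_apply, Pi.sup_apply]
  revert hne h₁ h₂
  cases σ p.1 <;> cases σ p.2 <;> cases σ' p.1 <;> cases σ' p.2 <;> simp [spin] <;> linarith

lemma sum_field_inf_add_sup (h : ℤ → ℝ) (Λ : Finset ℤ) (σ σ' : Config) :
    ∑ x ∈ Λ, h x * (1 - spin ((σ ⊓ σ') x)) + ∑ x ∈ Λ, h x * (1 - spin ((σ ⊔ σ') x)) =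
      ∑ x ∈ Λ, h x * (1 - spin (σ x)) + ∑ x ∈ Λ, h x * (1 - spin (σ' x)) := by
  rw [← Finset.sum_add_distrib, ← Finset.sum_add_distrib]
  refine Finset.sum_congr rfl fun x _ => ?_
  rw [Pi.inf_apply, Pi.sup_apply]
  linear_combination -h x * spin_inf_add_spin_sup (σ x) (σ' x)

lemma hamiltonian_submodular {α : ℝ} (hα : 1 < α) (h : ℤ → ℝ) (Λ : Finset ℤ) (σ σ' : Config) :
    hamiltonian α h Λ (σ ⊓ σ') + hamiltonian α h Λ (σ ⊔ σ') ≤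
      hamiltonian α h Λ σ + hamiltonian α h Λ σ' := by
  have hs := summable_pairEnergy hα Λ
  have hpairs := ((hs _).add (hs _)).tsum_le_tsum (pairEnergy_submodular α Λ σ σ')
    ((hs _).add (hs _))
  rw [(hs _).tsum_add (hs _), (hs _).tsum_add (hs _)] at hpairs
  simp only [hamiltonian_eq]
  linarith [sum_field_inf_add_sup h Λ σ σ']

lemma hamiltonian_submodular_lt {α : ℝ} (hα : 1 < α) (h : ℤ → ℝ) {Λ : Finset ℤ} {σ σ' : Config}
    {x y : ℤ} (hx : x ∈ Λ) (hxy : σ x ≠ σ y) (hσx : σ' x ≠ σ x) (hσy : σ' y ≠ σ y) :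
    hamiltonian α h Λ (σ ⊓ σ') + hamiltonian α h Λ (σ ⊔ σ') <
      hamiltonian α h Λ σ + hamiltonian α h Λ σ' := by
  have hs := summable_pairEnergy hα Λ
  obtain ⟨p, hp⟩ : ∃ p, pairEnergy α Λ (σ ⊓ σ') p + pairEnergy α Λ (σ ⊔ σ') p <
      pairEnergy α Λ σ p + pairEnergy α Λ σ' p := by
    rcases lt_or_gt_of_ne (ne_of_apply_ne σ hxy) with hlt | hlt
    · exact ⟨(x, y), pairEnergy_submodular_lt α hlt (.inl hx) hxy hσx hσy⟩
    · exact ⟨(y, x), pairEnergy_submodular_lt α hlt (.inr hx) hxy.symm hσy hσx⟩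
  have hpairs := Summable.tsum_lt_tsum (pairEnergy_submodular α Λ σ σ') hp ((hs _).add (hs _))
    ((hs _).add (hs _))
  rw [(hs _).tsum_add (hs _), (hs _).tsum_add (hs _)] at hpairs
  simp only [hamiltonian_eq]
  linarith [sum_field_inf_add_sup h Λ σ σ']

lemma glue_inf_glue {Λ : Finset ℤ} (τ τ' : Λ → Bool) {ω ω' : Config} (hω : ω ≤ ω') :
    glue Λ τ ω ⊓ glue Λ τ' ω' = glue Λ (τ ⊓ τ') ω := by
  funext x
  by_cases hx : x ∈ Λ
  · simp only [Pi.inf_apply, glue_apply_mem hx]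
  · simp only [Pi.inf_apply, glue_apply_notMem hx, inf_eq_left.2 (hω x)]

lemma glue_sup_glue {Λ : Finset ℤ} (τ τ' : Λ → Bool) {ω ω' : Config} (hω : ω ≤ ω') :
    glue Λ τ ω ⊔ glue Λ τ' ω' = glue Λ (τ ⊔ τ') ω' := by
  funext x
  by_cases hx : x ∈ Λ
  · simp only [Pi.sup_apply, glue_apply_mem hx]
  · simp only [Pi.sup_apply, glue_apply_notMem hx, sup_eq_right.2 (hω x)]

lemma monotone_spin_apply (x : ℤ) : Monotone fun σ : Config => spin (σ x) :=
  fun _ _ hσ => spin_mono (hσ x)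

lemma mem_box {L : ℕ} {x : ℤ} : x ∈ box L ↔ -(L : ℤ) ≤ x ∧ x ≤ L := Finset.mem_Icc

lemma box_mono : Monotone box := fun _ _ hL =>
  Finset.Icc_subset_Icc (neg_le_neg (by exact_mod_cast hL)) (by exact_mod_cast hL)

lemma abs_magnetization_le (α : ℝ) (h : ℤ → ℝ) (β : ℝ) (b : Bool) (L : ℕ) :
    |magnetization α h β b L| ≤ 1 :=
  abs_le.2 ⟨le_gibbsExp_of_forall_le (fun _ => (abs_le.1 (abs_spin _).le).1) _,
    gibbsExp_le_of_forall_le (fun _ => (abs_le.1 (abs_spin _).le).2) _⟩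

section Attractive

variable {α β : ℝ} (hα : 1 < α) (h : ℤ → ℝ) (hβ : 0 ≤ β)
include hα hβ

lemma weight_mul_weight_le (Λ : Finset ℤ) (σ σ' : Config) :
    weight α h β Λ σ * weight α h β Λ σ' ≤
      weight α h β Λ (σ ⊓ σ') * weight α h β Λ (σ ⊔ σ') := by
  unfold weight
  rw [← Real.exp_add, ← Real.exp_add, Real.exp_le_exp]
  linear_combination β * hamiltonian_submodular hα h Λ σ σ'

lemma gibbsExp_mono_of_nonneg (Λ : Finset ℤ) {f : Config → ℝ} (hf : Monotone f) {ω ω' : Config}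
    (hω : ω ≤ ω') (hf₀ : ∀ τ, 0 ≤ f (glue Λ τ ω)) :
    gibbsExp α h β Λ f ω ≤ gibbsExp α h β Λ f ω' := by
  have hf₀' (τ) : 0 ≤ f (glue Λ τ ω') := (hf₀ τ).trans (hf (glue_mono Λ le_rfl hω))
  set w := weight α h β Λ
  have hw (σ) : 0 ≤ w σ := (weight_pos σ).le
  have hlattice (τ τ' : Λ → Bool) :
      f (glue Λ τ ω) * w (glue Λ τ ω) * w (glue Λ τ' ω') ≤
        w (glue Λ (τ ⊓ τ') ω) * (f (glue Λ (τ ⊔ τ') ω') * w (glue Λ (τ ⊔ τ') ω')) := by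
    have hfle : f (glue Λ τ ω) ≤ f (glue Λ (τ ⊔ τ') ω') := hf (glue_mono Λ le_sup_left hω)
    have hwle := weight_mul_weight_le hα h hβ Λ (glue Λ τ ω) (glue Λ τ' ω')
    rw [glue_inf_glue τ τ' hω, glue_sup_glue τ τ' hω] at hwle
    linear_combination mul_le_mul hfle hwle (mul_nonneg (hw _) (hw _)) (hf₀' _)
  have hsum := four_functions_theorem_univ (fun τ => f (glue Λ τ ω) * w (glue Λ τ ω))
    (fun τ => w (glue Λ τ ω')) (fun τ => w (glue Λ τ ω))
    (fun τ => f (glue Λ τ ω') * w (glue Λ τ ω')) (fun τ => mul_nonneg (hf₀ τ) (hw _))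
    (fun τ => hw _) (fun τ => hw _) (fun τ => mul_nonneg (hf₀' τ) (hw _)) hlattice
  rw [gibbsExp_eq, gibbsExp_eq,
    div_le_div_iff₀ (partitionFunction_pos ω) (partitionFunction_pos ω')]
  exact hsum.trans_eq (mul_comm _ _)

lemma gibbsExp_mono (Λ : Finset ℤ) {f : Config → ℝ} (hf : Monotone f) :
    Monotone (gibbsExp α h β Λ f) := by
  intro ω ω' hω
  set m := f (glue Λ ⊥ ω)
  have hshift := gibbsExp_mono_of_nonneg hα h hβ Λ (hf.add_const (-m)) hω fun τ => by
    linarith [hf (glue_mono Λ bot_le le_rfl : glue Λ ⊥ ω ≤ glue Λ τ ω)]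
  simpa only [gibbsExp_add, gibbsExp_const, add_le_add_iff_right] using hshift

lemma antitone_magnetization_true : Antitone (magnetization α h β true) := by
  intro L L' hL
  unfold magnetization
  rw [← gibbsExp_gibbsExp hα h β (box_mono hL)]
  exact gibbsExp_le_of_forall_le
    (fun σ => gibbsExp_mono hα h hβ _ (monotone_spin_apply 0) fun x => Bool.le_true _) _

lemma monotone_magnetization_false : Monotone (magnetization α h β false) := by
  intro L L' hL
  unfold magnetization
  rw [← gibbsExp_gibbsExp hα h β (box_mono hL)]
  exact le_gibbsExp_of_forall_le
    (fun σ => gibbsExp_mono hα h hβ _ (monotone_spin_apply 0) fun x => Bool.false_le _) _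

lemma exists_tendsto_magnetization (b : Bool) :
    ∃ m, Tendsto (magnetization α h β b) atTop (𝓝 m) := by
  have hbound := abs_magnetization_le α h β b
  cases b
  · exact ⟨_, tendsto_atTop_ciSup (monotone_magnetization_false hα h hβ)
      ⟨1, Set.forall_mem_range.2 fun L => (abs_le.1 (hbound L)).2⟩⟩
  · exact ⟨_, tendsto_atTop_ciInf (antitone_magnetization_true hα h hβ)
      ⟨-1, Set.forall_mem_range.2 fun L => (abs_le.1 (hbound L)).1⟩⟩

end Attractive

/-! ### Infinite-volume Gibbs measures -/

/-- The Gibbs measure in the volume `Λ`, as a probability kernel in the boundary condition: the law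
behind the expectation `gibbsExp`. -/
noncomputable def gibbsMeasure (α : ℝ) (h : ℤ → ℝ) (β : ℝ) (Λ : Finset ℤ) (ω : Config) :
    Measure Config :=
  ∑ τ : Λ → Bool, ENNReal.ofReal (weight α h β Λ (glue Λ τ ω) / partitionFunction α h β Λ ω) •
    Measure.dirac (glue Λ τ ω)

section GibbsMeasure

variable {α : ℝ} {h : ℤ → ℝ} {β : ℝ} {Λ : Finset ℤ}

lemma weight_div_partitionFunction_nonneg (σ ω : Config) :
    0 ≤ weight α h β Λ σ / partitionFunction α h β Λ ω :=
  div_nonneg (weight_pos _).le (partitionFunction_pos _).le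

instance isProbabilityMeasure_gibbsMeasure (ω : Config) :
    IsProbabilityMeasure (gibbsMeasure α h β Λ ω) := by
  refine ⟨?_⟩
  simp only [gibbsMeasure, Measure.coe_finsetSum, Measure.coe_smul, Finset.sum_apply,
    Pi.smul_apply, measure_univ, smul_eq_mul, mul_one]
  rw [← ENNReal.ofReal_sum_of_nonneg fun τ _ => weight_div_partitionFunction_nonneg _ _,
    ← Finset.sum_div, ← partitionFunction_eq, div_self (partitionFunction_pos _).ne',
    ENNReal.ofReal_one]

lemma integrable_gibbsMeasure (f : Config → ℝ) (ω : Config) :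
    Integrable f (gibbsMeasure α h β Λ ω) :=
  integrable_finsetSum_measure.2 fun _ _ =>
    (integrable_dirac (by simp)).smul_measure ENNReal.ofReal_ne_top

lemma integral_gibbsMeasure (f : Config → ℝ) (ω : Config) :
    ∫ σ, f σ ∂gibbsMeasure α h β Λ ω = gibbsExp α h β Λ f ω := by
  rw [gibbsMeasure, integral_finsetSum_measure fun _ _ =>
    (integrable_dirac (by simp)).smul_measure ENNReal.ofReal_ne_top, gibbsExp_eq, Finset.sum_div]
  refine Finset.sum_congr rfl fun τ _ => ?_
  rw [integral_smul_measure, integral_dirac,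
    ENNReal.toReal_ofReal (weight_div_partitionFunction_nonneg _ _), smul_eq_mul]
  ring

lemma lintegral_gibbsMeasure {f : Config → ℝ} (hf : 0 ≤ f) (ω : Config) :
    ∫⁻ σ, ENNReal.ofReal (f σ) ∂gibbsMeasure α h β Λ ω =
      ENNReal.ofReal (gibbsExp α h β Λ f ω) := by
  rw [← integral_gibbsMeasure,
    ofReal_integral_eq_lintegral_ofReal (integrable_gibbsMeasure f ω) (ae_of_all _ hf)]

lemma gibbsMeasure_apply {A : Set Config} (hA : MeasurableSet A) (ω : Config) :
    gibbsMeasure α h β Λ ω A = ENNReal.ofReal (gibbsExp α h β Λ (A.indicator fun _ => 1) ω) := by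
  rw [← lintegral_gibbsMeasure (Set.indicator_nonneg fun _ _ => zero_le_one),
    ← lintegral_indicator_one hA]
  refine lintegral_congr fun σ => ?_
  by_cases hσ : σ ∈ A <;> simp [hσ]

lemma measurable_gibbsExp (hα : 1 < α) {f : Config → ℝ} (hf : Measurable f) :
    Measurable (gibbsExp α h β Λ f) := by
  have hg (τ : Λ → Bool) : Measurable (glue Λ τ) := (continuous_glue Λ τ).measurable
  have hw : Measurable (weight α h β Λ) := (continuous_weight hα).measurable
  exact .div (Finset.measurable_fun_sum _ fun τ _ => (hf.comp (hg τ)).mul (hw.comp (hg τ)))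
    (Finset.measurable_fun_sum _ fun τ _ => hw.comp (hg τ))

lemma measurable_gibbsMeasure (hα : 1 < α) : Measurable (gibbsMeasure α h β Λ) := by
  refine Measure.measurable_of_measurable_coe _ fun A hA => ?_
  simp only [gibbsMeasure_apply hA]
  exact (measurable_gibbsExp hα (measurable_const.indicator hA)).ennreal_ofReal

lemma isGibbsMeasure_of_bind_gibbsMeasure (hα : 1 < α) (μ : Measure Config)
    [IsProbabilityMeasure μ] (hμ : ∀ Λ, μ.bind (gibbsMeasure α h β Λ) = μ) :
    IsGibbsMeasure α h β μ := by
  refine ⟨inferInstance, fun Λ A hA => ?_⟩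
  simp only [← gibbsMeasure_apply hA]
  rw [← Measure.bind_apply hA (measurable_gibbsMeasure hα).aemeasurable, hμ]

lemma isGibbsMeasure_of_integral_gibbsExp (hα : 1 < α) (μ : Measure Config)
    [IsProbabilityMeasure μ]
    (hμ : ∀ (Λ : Finset ℤ) (f : Config → ℝ), Continuous f →
      ∫ ω, gibbsExp α h β Λ f ω ∂μ = ∫ ω, f ω ∂μ) :
    IsGibbsMeasure α h β μ := by
  have hint {f : Config → ℝ} (hf : Continuous f) : Integrable f μ :=
    hf.integrable_of_hasCompactSupport (HasCompactSupport.of_compactSpace f)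
  refine isGibbsMeasure_of_bind_gibbsMeasure hα μ fun Λ => ?_
  refine (ext_of_forall_lintegral_eq_of_IsFiniteMeasure fun f => ?_).symm
  have hf : Continuous fun σ => (f σ : ℝ) := NNReal.continuous_coe.comp f.continuous
  have hf₀ (σ) : 0 ≤ (f σ : ℝ) := (f σ).2
  simp only [← ENNReal.ofReal_coe_nnreal]
  rw [Measure.lintegral_bind (measurable_gibbsMeasure hα).aemeasurable
    hf.measurable.ennreal_ofReal.aemeasurable]
  simp only [lintegral_gibbsMeasure hf₀]
  rw [← ofReal_integral_eq_lintegral_ofReal (hint hf) (ae_of_all _ hf₀),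
    ← ofReal_integral_eq_lintegral_ofReal (hint (continuous_gibbsExp hα hf))
      (ae_of_all _ (le_gibbsExp_of_forall_le hf₀)), hμ Λ _ hf]

lemma eventually_subset_box (Λ : Finset ℤ) : ∀ᶠ L in atTop, Λ ⊆ box L := by
  refine eventually_atTop.2 ⟨Λ.sup Int.natAbs, fun L hL x hx => ?_⟩
  have hxL := (Finset.le_sup (f := Int.natAbs) hx).trans hL
  rw [mem_box]
  lia

/-- The Gibbs measure is a cluster point of the finite-volume measures, by compactness of the space
of probability measures on `Config`. -/
lemma exists_isGibbsMeasure_integral_spin (hα : 1 < α) {b : Bool} {m : ℝ}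
    (hm : Tendsto (magnetization α h β b) atTop (𝓝 m)) :
    ∃ μ, IsGibbsMeasure α h β μ ∧ ∫ σ, spin (σ 0) ∂μ = m := by
  let u (L : ℕ) : ProbabilityMeasure Config :=
    ⟨gibbsMeasure α h β (box L) fun _ => b, inferInstance⟩
  set U : Ultrafilter ℕ := Ultrafilter.of atTop
  have hU : (U : Filter ℕ) ≤ atTop := Ultrafilter.of_le _
  obtain ⟨μ, -, hμ : Tendsto u U (𝓝 μ)⟩ :=
    (isCompact_univ (X := ProbabilityMeasure Config)).ultrafilter_le_nhds (U.map u) (by simp)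
  have hlim {f : Config → ℝ} (hf : Continuous f) :
      Tendsto (fun L => gibbsExp α h β (box L) f fun _ => b) U
        (𝓝 (∫ ω, f ω ∂(μ : Measure Config))) :=
    (ProbabilityMeasure.tendsto_iff_forall_integral_tendsto.1 hμ
      (BoundedContinuousFunction.mkOfCompact ⟨f, hf⟩)).congr fun L => integral_gibbsMeasure f _
  refine ⟨μ, isGibbsMeasure_of_integral_gibbsExp hα μ fun Λ f hf => ?_,
    tendsto_nhds_unique (hlim (continuous_spin_apply 0)) (hm.mono_left hU)⟩
  refine tendsto_nhds_unique ((hlim (continuous_gibbsExp hα hf)).congr' ?_) (hlim hf)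
  filter_upwards [(eventually_subset_box Λ).filter_mono hU] with L hL
  exact gibbsExp_gibbsExp hα h β hL f _

lemma hasPhaseTransition_of_separated (hα : 1 < α) {β₀ : ℝ} (hβ₀ : 0 < β₀)
    (hsep : ∀ β, β₀ ≤ β → ∃ c > 0, ∀ᶠ L in atTop,
      magnetization α h β false L + c ≤ magnetization α h β true L) :
    HasPhaseTransition α h := by
  refine ⟨β₀, hβ₀, fun β hβ => ?_⟩
  have hβ_nonneg : 0 ≤ β := hβ₀.le.trans hβ
  obtain ⟨mMinus, hMinus⟩ := exists_tendsto_magnetization hα h hβ_nonneg false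
  obtain ⟨mPlus, hPlus⟩ := exists_tendsto_magnetization hα h hβ_nonneg true
  obtain ⟨c, hc, hgap⟩ := hsep β hβ
  have hne : mMinus ≠ mPlus :=
    ((lt_add_of_pos_right _ hc).trans_le
      (le_of_tendsto_of_tendsto (hMinus.add_const c) hPlus hgap)).ne
  obtain ⟨μ, hμ, hμm⟩ := exists_isGibbsMeasure_integral_spin hα hMinus
  obtain ⟨ν, hν, hνm⟩ := exists_isGibbsMeasure_integral_spin hα hPlus
  refine ⟨⟨mMinus, mPlus, hMinus, hPlus, hne⟩, μ, ν, hμ, hν, ?_⟩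
  rintro rfl
  exact hne (hμm.symm.trans hνm)

end GibbsMeasure

/-! ### Finite changes of the field -/

lemma glue_singleton (z : ℤ) (b : Bool) (ω : Config) :
    glue {z} (fun _ => b) ω = Function.update ω z b := by
  funext x
  by_cases hx : x = z
  · subst hx
    rw [glue_apply_mem (Finset.mem_singleton_self x), Function.update_self]
  · rw [glue_apply_notMem (Finset.notMem_singleton.2 hx), Function.update_of_ne hx]

section SingleSite

variable {α β : ℝ} {h : ℤ → ℝ}

lemma gibbsExp_singleton (f : Config → ℝ) (z : ℤ) (ω : Config) :
    gibbsExp α h β {z} f ω =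
      (f (Function.update ω z true) * weight α h β {z} (Function.update ω z true) +
        f (Function.update ω z false) * weight α h β {z} (Function.update ω z false)) /
      (weight α h β {z} (Function.update ω z true) +
        weight α h β {z} (Function.update ω z false)) := by
  have hsum (F : (({z} : Finset ℤ) → Bool) → ℝ) :
      ∑ τ, F τ = F (fun _ => true) + F (fun _ => false) := by
    rw [← (Equiv.funUnique ({z} : Finset ℤ) Bool).symm.sum_comp, Fintype.sum_bool]
    rfl
  rw [gibbsExp_eq, partitionFunction_eq, hsum, hsum]
  simp only [glue_singleton]

lemma gibbsExp_singleton_eq_magnetization (f : Config → ℝ) (z : ℤ) (ω : Config) :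
    gibbsExp α h β {z} f ω =
      (f (Function.update ω z true) + f (Function.update ω z false)) / 2 +
      (f (Function.update ω z true) - f (Function.update ω z false)) / 2 *
        gibbsExp α h β {z} (fun σ => spin (σ z)) ω := by
  have htrue := weight_pos (α := α) (h := h) (β := β) (Λ := {z}) (Function.update ω z true)
  have hfalse := weight_pos (α := α) (h := h) (β := β) (Λ := {z}) (Function.update ω z false)
  rw [gibbsExp_singleton, gibbsExp_singleton]
  simp only [Function.update_self, spin]
  field_simp
  simp
  ring

lemma gibbsExp_singleton_spin_lt (hα : 1 < α) (hβ : 0 < β) {σ σ' : Config} (hσ : σ ≤ σ')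
    {x z : ℤ} (hxz : x ≠ z) (hx : σ x ≠ σ' x) :
    gibbsExp α h β {z} (fun σ => spin (σ z)) σ < gibbsExp α h β {z} (fun σ => spin (σ z)) σ' := by
  obtain ⟨hσx, hσx'⟩ : σ x = false ∧ σ' x = true := Bool.lt_iff.1 (lt_of_le_of_ne (hσ x) hx)
  have hlt := hamiltonian_submodular_lt hα h (Λ := {z}) (σ := Function.update σ z true)
    (σ' := Function.update σ' z false) (x := z) (y := x) (by simp) (by simp [hxz, hσx])
    (by simp) (by simp [hxz, hσx, hσx'])
  rw [← glue_singleton, ← glue_singleton, glue_inf_glue _ _ hσ, glue_sup_glue _ _ hσ,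
    show ((fun _ => true) ⊓ fun _ => false : ({z} : Finset ℤ) → Bool) = fun _ => false from rfl,
    show ((fun _ => true) ⊔ fun _ => false : ({z} : Finset ℤ) → Bool) = fun _ => true from rfl,
    glue_singleton, glue_singleton, glue_singleton, glue_singleton] at hlt
  have hw : weight α h β {z} (Function.update σ z true) *
        weight α h β {z} (Function.update σ' z false) <
      weight α h β {z} (Function.update σ z false) *
        weight α h β {z} (Function.update σ' z true) := by
    simp only [weight]
    rw [← Real.exp_add, ← Real.exp_add, Real.exp_lt_exp]
    linear_combination β * hlt
  have hpos (σ) := weight_pos (α := α) (h := h) (β := β) (Λ := {z}) σ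
  rw [gibbsExp_singleton, gibbsExp_singleton,
    div_lt_div_iff₀ (add_pos (hpos _) (hpos _)) (add_pos (hpos _) (hpos _))]
  simp only [Function.update_self, spin, if_true, Bool.false_eq_true, if_false]
  linear_combination 2 * hw

lemma isClosed_setOf_le_and_exists_ne (D : Finset ℤ) :
    IsClosed {p : Config × Config | p.1 ≤ p.2 ∧ ∃ x ∈ D, p.1 x ≠ p.2 x} := by
  have hcoord (R : Bool → Bool → Prop) (x : ℤ) :
      IsClosed {p : Config × Config | R (p.1 x) (p.2 x)} :=
    (isClosed_discrete {q : Bool × Bool | R q.1 q.2}).preimage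
      (f := fun p : Config × Config => (p.1 x, p.2 x)) (by fun_prop)
  have hle : IsClosed {p : Config × Config | p.1 ≤ p.2} := by
    simp only [Pi.le_def, Set.ofPred_forall]
    exact isClosed_iInter (hcoord (· ≤ ·))
  have hne : IsClosed {p : Config × Config | ∃ x ∈ D, p.1 x ≠ p.2 x} := by
    have hunion : {p : Config × Config | ∃ x ∈ D, p.1 x ≠ p.2 x} =
        ⋃ x ∈ D, {p : Config × Config | p.1 x ≠ p.2 x} := by ext; simp
    exact hunion ▸ isClosed_biUnion_finset fun x _ => hcoord (· ≠ ·) x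
  exact hle.inter hne

lemma exists_forall_gibbsExp_singleton_spin_add_le (hα : 1 < α) (h : ℤ → ℝ) (hβ : 0 < β) (z : ℤ)
    (D : Finset ℤ) :
    ∃ c > 0, ∀ σ σ' : Config, σ ≤ σ' → (∃ x ∈ D.erase z, σ x ≠ σ' x) →
      gibbsExp α h β {z} (fun σ => spin (σ z)) σ + c ≤
        gibbsExp α h β {z} (fun σ => spin (σ z)) σ' := by
  have hcont : Continuous (gibbsExp α h β {z} fun σ => spin (σ z)) :=
    continuous_gibbsExp hα (continuous_spin_apply z)
  obtain ⟨c, hc, hgap⟩ := (isClosed_setOf_le_and_exists_ne (D.erase z)).isCompact.exists_forall_le'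
    ((hcont.comp continuous_snd).sub (hcont.comp continuous_fst)).continuousOn
    (a := 0) fun p ⟨hle, x, hx, hne⟩ => sub_pos.2
      (gibbsExp_singleton_spin_lt hα hβ hle (Finset.ne_of_mem_erase hx) hne)
  exact ⟨c, hc, fun σ σ' hle hne => le_sub_iff_add_le'.1 (hgap (σ, σ') ⟨hle, hne⟩)⟩

lemma gibbsExp_singleton_sub_le_of_eq_update {f : Config → ℝ} {K : ℝ} (hK : ∀ σ, |f σ| ≤ K)
    {z : ℤ} {σ σ' : Config} (hf : ∀ b, f (Function.update σ z b) = f (Function.update σ' z b))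
    (hspin : gibbsExp α h β {z} (fun σ => spin (σ z)) σ ≤
      gibbsExp α h β {z} (fun σ => spin (σ z)) σ') :
    gibbsExp α h β {z} f σ' - gibbsExp α h β {z} f σ ≤
      K * (gibbsExp α h β {z} (fun σ => spin (σ z)) σ' -
        gibbsExp α h β {z} (fun σ => spin (σ z)) σ) := by
  rw [gibbsExp_singleton_eq_magnetization f z σ, gibbsExp_singleton_eq_magnetization f z σ', hf, hf]
  have hslope : (f (Function.update σ' z true) - f (Function.update σ' z false)) / 2 ≤ K := by
    linarith [(abs_le.1 (hK (Function.update σ' z true))).2,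
      (abs_le.1 (hK (Function.update σ' z false))).1]
  linear_combination mul_le_mul_of_nonneg_right hslope (sub_nonneg.2 hspin)

end SingleSite

section FieldChange

variable {α β : ℝ} (hα : 1 < α) (h : ℤ → ℝ) (hβ : 0 < β)
include hα hβ

lemma exists_gibbsExp_singleton_sub_le (z : ℤ) {D : Finset ℤ} {f : Config → ℝ}
    (hD : ∀ σ σ' : Config, (∀ x ∈ D, σ x = σ' x) → f σ = f σ') {K : ℝ} (hK : ∀ σ, |f σ| ≤ K) :
    ∃ C > 0, ∀ σ σ' : Config, σ ≤ σ' →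
      gibbsExp α h β {z} f σ' - gibbsExp α h β {z} f σ ≤
        C * (gibbsExp α h β {z} (fun σ => spin (σ z)) σ' -
          gibbsExp α h β {z} (fun σ => spin (σ z)) σ) := by
  obtain ⟨c, hc, hgap⟩ := exists_forall_gibbsExp_singleton_spin_add_le hα h hβ z D
  have hK₀ : 0 ≤ K := (abs_nonneg _).trans (hK fun _ => true)
  refine ⟨K + 2 * K / c + 1, by positivity, fun σ σ' hσ => ?_⟩
  have hspin := gibbsExp_mono hα h hβ.le {z} (monotone_spin_apply z) hσ
  have hspin₀ := sub_nonneg.2 hspin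
  by_cases hagree : ∀ x ∈ D.erase z, σ x = σ' x
  · have hupdate (b) : f (Function.update σ z b) = f (Function.update σ' z b) := by
      refine hD _ _ fun x hx => ?_
      obtain rfl | hxz := eq_or_ne x z
      · simp only [Function.update_self]
      · simp only [Function.update_of_ne hxz, hagree x (Finset.mem_erase.2 ⟨hxz, hx⟩)]
    refine (gibbsExp_singleton_sub_le_of_eq_update hK hupdate hspin).trans
      (mul_le_mul_of_nonneg_right ?_ hspin₀)
    linarith [div_nonneg (mul_nonneg zero_le_two hK₀) hc.le]
  · have hfar := hgap σ σ' hσ (by simpa only [not_forall, exists_prop] using hagree)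
    calc gibbsExp α h β {z} f σ' - gibbsExp α h β {z} f σ
        ≤ 2 * K / c * c := by
          rw [div_mul_cancel₀ _ hc.ne', two_mul, ← sub_neg_eq_add K K]
          exact sub_le_sub (gibbsExp_le_of_forall_le (fun σ => (abs_le.1 (hK σ)).2) _)
            (le_gibbsExp_of_forall_le (fun σ => (abs_le.1 (hK σ)).1) _)
      _ ≤ _ := mul_le_mul (by linarith) (by linarith) hc.le (by positivity)

/-- Strict monotonicity of the conditional magnetization at the origin makes `C * spin (σ 0) - f`
have an increasing conditional expectation once `C` is large. -/
lemma exists_gibbsExp_sub_le_magnetization_sub {D : Finset ℤ} {f : Config → ℝ}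
    (hD : ∀ σ σ' : Config, (∀ x ∈ D, σ x = σ' x) → f σ = f σ') {K : ℝ} (hK : ∀ σ, |f σ| ≤ K) :
    ∃ C > 0, ∀ L, gibbsExp α h β (box L) f (fun _ => true) -
        gibbsExp α h β (box L) f (fun _ => false) ≤
      C * (magnetization α h β true L - magnetization α h β false L) := by
  obtain ⟨C, hC, hsub⟩ := exists_gibbsExp_singleton_sub_le hα h hβ 0 hD hK
  have hmono : Monotone (gibbsExp α h β {0} fun σ => C * spin (σ 0) + (-1) * f σ) := by
    intro σ σ' hσ
    simp only [gibbsExp_add, gibbsExp_const_mul]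
    linarith [hsub σ σ' hσ]
  refine ⟨C, hC, fun L => ?_⟩
  have hzero : ({0} : Finset ℤ) ⊆ box L := by simp [mem_box]
  have hbox := gibbsExp_mono hα h hβ.le (box L) hmono
    (show (fun _ => false : Config) ≤ fun _ => true from fun _ => Bool.false_le _)
  simp only [gibbsExp_gibbsExp hα h β hzero, gibbsExp_add, gibbsExp_const_mul] at hbox
  unfold magnetization
  linarith

end FieldChange

/-- The density, up to normalisation, of the Gibbs state in the field `h'` with respect to the one
in the field `h`, when the two fields agree off `D`. -/
noncomputable def fieldDensity (h h' : ℤ → ℝ) (β : ℝ) (D : Finset ℤ) (σ : Config) : ℝ :=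
  Real.exp (β * ∑ x ∈ D, (h x - h' x) * (1 - spin (σ x)))

section FieldDensity

variable {h h' : ℤ → ℝ} {D : Finset ℤ}

lemma weight_eq_fieldDensity_mul (α β : ℝ) {Λ : Finset ℤ} (hD : D ⊆ Λ)
    (hh : ∀ x ∉ D, h x = h' x) (σ : Config) :
    weight α h' β Λ σ = fieldDensity h h' β D σ * weight α h β Λ σ := by
  have hsum : ∑ x ∈ D, (h x - h' x) * (1 - spin (σ x)) =
      ∑ x ∈ Λ, (h x - h' x) * (1 - spin (σ x)) :=
    Finset.sum_subset hD fun x _ hx => by rw [hh x hx, sub_self, zero_mul]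
  rw [weight, weight, fieldDensity, ← Real.exp_add, hsum, hamiltonian_eq, hamiltonian_eq]
  congr 1
  simp only [sub_mul, Finset.sum_sub_distrib]
  ring

lemma gibbsExp_mul_fieldDensity (α β : ℝ) {Λ : Finset ℤ} (hD : D ⊆ Λ)
    (hh : ∀ x ∉ D, h x = h' x) (f : Config → ℝ) (ω : Config) :
    gibbsExp α h β Λ (fun σ => f σ * fieldDensity h h' β D σ) ω =
      gibbsExp α h' β Λ f ω * gibbsExp α h β Λ (fieldDensity h h' β D) ω := by
  have hZ : gibbsExp α h β Λ (fieldDensity h h' β D) ω =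
      partitionFunction α h' β Λ ω / partitionFunction α h β Λ ω := by
    simp only [gibbsExp_eq, ← weight_eq_fieldDensity_mul α β hD hh, ← partitionFunction_eq]
  rw [hZ, gibbsExp_eq, gibbsExp_eq,
    div_mul_div_cancel₀ (partitionFunction_pos ω).ne']
  simp only [mul_assoc, ← weight_eq_fieldDensity_mul α β hD hh]

lemma exists_fieldDensity_mem_Icc (h h' : ℤ → ℝ) (β : ℝ) (D : Finset ℤ) :
    ∃ S : ℝ, ∀ σ, fieldDensity h h' β D σ ∈ Set.Icc (Real.exp (-S)) (Real.exp S) := by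
  refine ⟨|β| * ∑ x ∈ D, |h x - h' x| * 2, fun σ => ?_⟩
  have hfield : |∑ x ∈ D, (h x - h' x) * (1 - spin (σ x))| ≤ ∑ x ∈ D, |h x - h' x| * 2 := by
    refine (Finset.abs_sum_le_sum_abs _ _).trans (Finset.sum_le_sum fun x _ => ?_)
    rw [abs_mul]
    gcongr
    cases σ x <;> norm_num [spin]
  have hexponent := mul_le_mul_of_nonneg_left hfield (abs_nonneg β)
  rw [← abs_mul] at hexponent
  exact ⟨Real.exp_le_exp.2 (abs_le.1 hexponent).1, Real.exp_le_exp.2 (abs_le.1 hexponent).2⟩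

lemma exists_separated_of_field_eq_off {α β : ℝ} (hα : 1 < α) (hβ : 0 < β)
    (hh : ∀ x ∉ D, h x = h' x) {m : ℝ} (hm : 0 < m)
    (hminus : ∀ L, magnetization α h' β false L ≤ -m)
    (hplus : ∀ L, m ≤ magnetization α h' β true L) :
    ∃ c > 0, ∀ᶠ L in atTop, magnetization α h β false L + c ≤ magnetization α h β true L := by
  set Φ := fieldDensity h h' β D
  obtain ⟨S, hΦ⟩ := exists_fieldDensity_mem_Icc h h' β D
  have hlocal (σ σ' : Config) (hσ : ∀ x ∈ insert 0 D, σ x = σ' x) :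
      spin (σ 0) * Φ σ = spin (σ' 0) * Φ σ' := by
    have hD : ∀ x ∈ D, σ x = σ' x := fun x hx => hσ x (Finset.mem_insert_of_mem hx)
    simp only [Φ, fieldDensity, hσ 0 (Finset.mem_insert_self _ _)]
    rw [Finset.sum_congr rfl fun x hx => by rw [hD x hx]]
  have hbound (σ : Config) : |spin (σ 0) * Φ σ| ≤ Real.exp S := by
    rw [abs_mul, abs_spin, one_mul, show |Φ σ| = Φ σ from abs_of_pos (Real.exp_pos _)]
    exact (hΦ σ).2
  obtain ⟨C, hC, hsub⟩ := exists_gibbsExp_sub_le_magnetization_sub hα h hβ hlocal hbound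
  refine ⟨2 * m * Real.exp (-S) / C, by positivity, ?_⟩
  filter_upwards [eventually_subset_box D] with L hL
  have hgap := hsub L
  rw [gibbsExp_mul_fieldDensity α β hL hh, gibbsExp_mul_fieldDensity α β hL hh] at hgap
  have hmean (ω) : Real.exp (-S) ≤ gibbsExp α h β (box L) Φ ω :=
    le_gibbsExp_of_forall_le (fun σ => (hΦ σ).1) ω
  have hexp := Real.exp_nonneg (-S)
  rw [← le_sub_iff_add_le', div_le_iff₀' hC]
  refine le_trans ?_ hgap
  have htrue := mul_le_mul (hplus L) (hmean fun _ => true) hexp (hm.le.trans (hplus L))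
  have hfalse := mul_le_mul (le_neg_of_le_neg (hminus L)) (hmean fun _ => false) hexp
    (hm.le.trans (le_neg_of_le_neg (hminus L)))
  unfold magnetization at htrue hfalse
  linarith

end FieldDensity

/-! ### Spin boundaries -/

/-- The sites enclosed by the set of boundary points `γ`, that is, those with an odd number of
points of `γ` at or to the left of them. The boundary point `p` stands for the bond between
`p - 1` and `p`. -/
def inside (γ : Finset ℤ) : Set ℤ := {x | Odd (γ.filter (· ≤ x)).card}

lemma mem_inside {γ : Finset ℤ} {x : ℤ} : x ∈ inside γ ↔ Odd (γ.filter (· ≤ x)).card := Iff.rfl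

lemma mem_inside_iff_iff_even {γ : Finset ℤ} {x y : ℤ} (hxy : x ≤ y) :
    (x ∈ inside γ ↔ y ∈ inside γ) ↔ Even (γ.filter fun p => x < p ∧ p ≤ y).card := by
  have hcard : (γ.filter (· ≤ y)).card =
      (γ.filter (· ≤ x)).card + (γ.filter fun p => x < p ∧ p ≤ y).card := by
    rw [← Finset.card_union_of_disjoint]
    · congr 1
      grind
    · rw [Finset.disjoint_filter]
      lia
  rw [mem_inside, mem_inside, hcard, Nat.odd_add]
  tauto

lemma exists_mem_of_not_mem_inside_iff {γ : Finset ℤ} {x y : ℤ} (hxy : x ≤ y)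
    (hne : ¬(x ∈ inside γ ↔ y ∈ inside γ)) : ∃ p ∈ γ, x < p ∧ p ≤ y := by
  by_contra! hnone
  refine hne ((mem_inside_iff_iff_even hxy).2 ?_)
  have hempty : (γ.filter fun p => x < p ∧ p ≤ y) = ∅ :=
    Finset.filter_eq_empty_iff.2 fun p hp hlt => (hnone p hp hlt.1).not_ge hlt.2
  rw [hempty, Finset.card_empty]
  exact Even.zero

lemma sub_one_mem_inside_iff {γ : Finset ℤ} {p : ℤ} :
    (p - 1 ∈ inside γ ↔ p ∈ inside γ) ↔ p ∉ γ := by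
  have hfilter : (γ.filter fun q => p - 1 < q ∧ q ≤ p) = γ.filter (· = p) :=
    Finset.filter_congr fun q _ => by lia
  rw [mem_inside_iff_iff_even (by lia), hfilter, Finset.filter_eq']
  split_ifs with hp <;> simp [hp]

lemma exists_le_of_mem_inside {γ : Finset ℤ} {x : ℤ} (hx : x ∈ inside γ) : ∃ p ∈ γ, p ≤ x := by
  obtain ⟨p, hp⟩ := Finset.card_pos.1 (mem_inside.1 hx).pos
  exact ⟨p, Finset.mem_filter.1 hp⟩

lemma exists_lt_of_mem_inside {γ : Finset ℤ} (hγ : Even γ.card) {x : ℤ} (hx : x ∈ inside γ) :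
    ∃ p ∈ γ, x < p := by
  by_contra! hle
  rw [mem_inside, Finset.filter_true_of_mem hle] at hx
  exact Nat.not_odd_iff_even.2 hγ hx

lemma finite_inside {γ : Finset ℤ} (hγ : Even γ.card) : (inside γ).Finite := by
  obtain ⟨a, ha⟩ := γ.bddBelow
  obtain ⟨b, hb⟩ := γ.bddAbove
  refine (Set.finite_Icc a b).subset fun x hx => ?_
  obtain ⟨p, hp, hpx⟩ := exists_le_of_mem_inside hx
  obtain ⟨q, hq, hxq⟩ := exists_lt_of_mem_inside hγ hx
  exact ⟨(ha hp).trans hpx, hxq.le.trans (hb hq)⟩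

/-- The boundary points of `A`: the `p` such that exactly one of `p - 1` and `p` lies in `A`. -/
def boundary (A : Finset ℤ) : Finset ℤ := symmDiff A (A.map (addRightEmbedding 1))

lemma mem_boundary {A : Finset ℤ} {p : ℤ} : p ∈ boundary A ↔ ¬(p - 1 ∈ A ↔ p ∈ A) := by
  have hshift : p ∈ A.map (addRightEmbedding 1) ↔ p - 1 ∈ A := by
    simp [← eq_sub_iff_add_eq]
  rw [boundary, Finset.mem_symmDiff, hshift]
  tauto

lemma mem_inside_boundary {A : Finset ℤ} {x : ℤ} : x ∈ inside (boundary A) ↔ x ∈ A := by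
  obtain ⟨a, ha⟩ := (A ∪ boundary A).bddBelow
  have hlow (y : ℤ) (hy : y < a) : y ∈ inside (boundary A) ↔ y ∈ A := by
    refine iff_of_false (fun hmem => ?_) fun hmem =>
      (ha (Finset.mem_union_left _ hmem)).not_gt hy
    obtain ⟨p, hp, hpy⟩ := exists_le_of_mem_inside hmem
    exact (ha (Finset.mem_union_right _ hp)).not_gt (hpy.trans_lt hy)
  obtain hx | hx := lt_or_ge x a
  · exact hlow x hx
  · induction x, (show a - 1 ≤ x by lia) using Int.leInduction with
    | base => exact hlow (a - 1) (by lia)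
    | succ n _ ih =>
      have hstep := sub_one_mem_inside_iff (γ := boundary A) (p := n + 1)
      rw [mem_boundary, not_not, add_sub_cancel_right] at hstep
      obtain hna | hna := lt_or_ge n a
      · have := hlow n hna
        tauto
      · have := ih hna
        tauto

lemma even_card_boundary (A : Finset ℤ) : Even (boundary A).card := by
  obtain ⟨b, hb⟩ := (A ∪ boundary A).bddAbove
  by_contra hodd
  have hmem : b + 1 ∈ inside (boundary A) := by
    rw [mem_inside, Finset.filter_true_of_mem fun p hp =>
      (hb (Finset.mem_union_right A hp)).trans (lt_add_one b).le]
    exact Nat.not_even_iff_odd.1 hodd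
  exact (hb (Finset.mem_union_left _ (mem_inside_boundary.1 hmem))).not_gt (lt_add_one b)

/-! ### Length scales -/

/-- The diameter of a finite set of integers. -/
def diam (γ : Finset ℤ) : ℕ := (γ ×ˢ γ).sup fun p => (p.1 - p.2).natAbs

lemma diam_le_iff {γ : Finset ℤ} {d : ℕ} :
    diam γ ≤ d ↔ ∀ p ∈ γ, ∀ q ∈ γ, (p - q).natAbs ≤ d := by
  simp only [diam, Finset.sup_le_iff, Finset.mem_product, Prod.forall, and_imp]
  exact ⟨fun h p hp q hq => h p q hp hq, fun h p q hp hq => h p hp q hq⟩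

lemma natAbs_sub_le_diam {γ : Finset ℤ} {p q : ℤ} (hp : p ∈ γ) (hq : q ∈ γ) :
    (p - q).natAbs ≤ diam γ := diam_le_iff.1 le_rfl p hp q hq

lemma diam_mono {γ γ' : Finset ℤ} (h : γ ⊆ γ') : diam γ ≤ diam γ' :=
  diam_le_iff.2 fun _ hp _ hq => natAbs_sub_le_diam (h hp) (h hq)

/-- The binary logarithms of the length scales: from one scale to the next they grow by a quarter,
rounded down so that all scales are powers of two. -/
def scaleExp (m : ℕ) : ℕ → ℕ
  | 0 => m
  | i + 1 => scaleExp m i + scaleExp m i / 4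

/-- The length scales, starting at `2 ^ m`. Every scale is roughly the `5 / 4`-th power of the
previous one. -/
def scale (m i : ℕ) : ℕ := 2 ^ scaleExp m i

lemma scaleExp_succ (m i : ℕ) : scaleExp m (i + 1) = scaleExp m i + scaleExp m i / 4 := rfl

lemma monotone_scaleExp (m : ℕ) : Monotone (scaleExp m) :=
  monotone_nat_of_le_succ fun _ => Nat.le_add_right _ _

lemma le_scaleExp (m i : ℕ) : m ≤ scaleExp m i := monotone_scaleExp m (Nat.zero_le i)

lemma add_le_scaleExp {m : ℕ} (hm : 16 ≤ m) (i : ℕ) : m + 4 * i ≤ scaleExp m i := by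
  induction i with
  | zero => simp [scaleExp]
  | succ i ih => rw [scaleExp_succ]; lia

lemma monotone_scale (m : ℕ) : Monotone (scale m) := fun _ _ h =>
  Nat.pow_le_pow_right two_pos (monotone_scaleExp m h)

lemma scale_pos (m i : ℕ) : 0 < scale m i := pow_pos two_pos _

lemma scale_succ (m i : ℕ) : scale m (i + 1) = scale m i * 2 ^ (scaleExp m i / 4) := by
  rw [scale, scaleExp_succ, pow_add, scale]

lemma two_pow_mul_scale_le {m k : ℕ} (hk : 4 * k ≤ m) (i : ℕ) :
    2 ^ k * scale m i ≤ scale m (i + 1) := by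
  rw [scale_succ, mul_comm]
  have := le_scaleExp m i
  gcongr
  exacts [one_le_two, by lia]

lemma exists_le_scale {m : ℕ} (hm : 16 ≤ m) (d : ℕ) : ∃ i, d ≤ 4 * scale m i := by
  have hpow : 2 ^ d ≤ scale m d :=
    Nat.pow_le_pow_right two_pos (by have := add_le_scaleExp hm d; lia)
  have hlt : d < 2 ^ d := Nat.lt_two_pow_self
  exact ⟨d, by lia⟩

/-- The index of the first length scale that is comparable to the diameter of `γ`. -/
noncomputable def scaleIndex (m : ℕ) (γ : Finset ℤ) : ℕ := sInf {i | diam γ ≤ 4 * scale m i}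

lemma scaleIndex_le_iff {m : ℕ} (hm : 16 ≤ m) {γ : Finset ℤ} {i : ℕ} :
    scaleIndex m γ ≤ i ↔ diam γ ≤ 4 * scale m i := by
  refine ⟨fun hle => ?_, fun hle => Nat.sInf_le hle⟩
  have hdiam : diam γ ≤ 4 * scale m (scaleIndex m γ) := Nat.sInf_mem (exists_le_scale hm (diam γ))
  exact hdiam.trans (Nat.mul_le_mul_left 4 (monotone_scale m hle))

lemma scaleIndex_mono {m : ℕ} (hm : 16 ≤ m) {γ γ' : Finset ℤ} (h : γ ⊆ γ') :
    scaleIndex m γ ≤ scaleIndex m γ' :=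
  (scaleIndex_le_iff hm).2 ((diam_mono h).trans ((scaleIndex_le_iff hm).1 le_rfl))

/-! ### Contours -/

/-- Two sets of boundary points are far apart, compared with the smaller of their diameters. -/
def Separated (m : ℕ) (γ₁ γ₂ : Finset ℤ) : Prop :=
  ∀ p ∈ γ₁, ∀ q ∈ γ₂, scale m (min (scaleIndex m γ₁) (scaleIndex m γ₂) + 1) < 4 * (p - q).natAbs

section Separated

variable {m : ℕ} {γ γ₁ γ₂ : Finset ℤ}

lemma Separated.symm (h : Separated m γ₁ γ₂) : Separated m γ₂ γ₁ := by
  intro p hp q hq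
  rw [min_comm, ← Int.natAbs_neg, neg_sub]
  exact h q hq p hp

lemma Separated.mono_left (hm : 16 ≤ m) (h : Separated m γ₁ γ₂) (hγ : γ ⊆ γ₁) :
    Separated m γ γ₂ := fun p hp q hq =>
  (monotone_scale m (Nat.succ_le_succ (min_le_min_right _ (scaleIndex_mono hm hγ)))).trans_lt
    (h p (hγ hp) q hq)

lemma Separated.disjoint (h : Separated m γ₁ γ₂) : Disjoint γ₁ γ₂ :=
  Finset.disjoint_left.2 fun p h₁ h₂ => by simpa using h p h₁ p h₂

/-- A set of boundary points that cannot be split into two separated even pieces. -/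
def Unsplittable (m : ℕ) (γ : Finset ℤ) : Prop :=
  ∀ γ₁ ⊆ γ, γ₁.Nonempty → (γ \ γ₁).Nonempty → Even γ₁.card → ¬Separated m γ₁ (γ \ γ₁)

end Separated

/-- A decomposition of the set of boundary points `S` into pairwise separated even pieces. -/
structure IsContourFamily (m : ℕ) (S : Finset ℤ) (P : Finset (Finset ℤ)) : Prop where
  nonempty : ∀ γ ∈ P, γ.Nonempty
  even : ∀ γ ∈ P, Even γ.card
  biUnion_eq : P.biUnion id = S
  separated : (P : Set (Finset ℤ)).Pairwise (Separated m)

section ContourFamily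

variable {m : ℕ} {S γ : Finset ℤ} {P : Finset (Finset ℤ)}

lemma IsContourFamily.separated_erase_insert (hm : 16 ≤ m) (hP : IsContourFamily m S P)
    (hγ : γ ∈ P) {γ₁ : Finset ℤ} (hsub : γ₁ ⊆ γ) (hsep : Separated m γ₁ (γ \ γ₁)) :
    (insert γ₁ (insert (γ \ γ₁) (P.erase γ)) : Set (Finset ℤ)).Pairwise (Separated m) := by
  have : Std.Symm (Separated m) := ⟨fun _ _ => Separated.symm⟩
  have hrest (δ : Finset ℤ) (hδ : δ ∈ (P.erase γ : Set (Finset ℤ))) : Separated m γ δ := by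
    obtain ⟨hne, hδP⟩ := Finset.mem_erase.1 (Finset.mem_coe.1 hδ)
    exact hP.separated hγ hδP hne.symm
  simp only [Set.pairwise_insert_of_symm]
  refine ⟨⟨hP.separated.mono (by simp), fun δ hδ _ => ?_⟩, fun δ hδ _ => ?_⟩
  · exact (hrest δ hδ).mono_left hm Finset.sdiff_subset
  · obtain rfl | hδ := hδ
    exacts [hsep, (hrest δ hδ).mono_left hm hsub]

lemma IsContourFamily.exists_card_lt (hm : 16 ≤ m) (hP : IsContourFamily m S P) (hγ : γ ∈ P)
    (hsplit : ¬Unsplittable m γ) : ∃ P', IsContourFamily m S P' ∧ P.card < P'.card := by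
  simp only [Unsplittable, not_forall, not_not] at hsplit
  obtain ⟨γ₁, hsub, hne₁, hne₂, heven, hsep⟩ := hsplit
  have hnotMem (δ : Finset ℤ) (hδ : δ ⊆ γ) (hne : δ.Nonempty) : δ ∉ P.erase γ := by
    intro hmem
    obtain ⟨x, hx⟩ := hne
    have hdisj := (hP.separated hγ (Finset.mem_of_mem_erase hmem)
      (Finset.ne_of_mem_erase hmem).symm).disjoint
    exact Finset.disjoint_left.1 hdisj (hδ hx) hx
  have hcard : P.card < (insert γ₁ (insert (γ \ γ₁) (P.erase γ))).card := by
    have hne : γ₁ ≠ γ \ γ₁ := by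
      intro heq
      have hdisj := hsep.disjoint
      rw [← heq, Finset.disjoint_self_iff_empty] at hdisj
      exact hne₁.ne_empty hdisj
    rw [Finset.card_insert_of_notMem (by simp [hne, hnotMem γ₁ hsub hne₁]),
      Finset.card_insert_of_notMem (hnotMem _ Finset.sdiff_subset hne₂),
      Finset.card_erase_of_mem hγ]
    lia
  refine ⟨_, ⟨?_, ?_, ?_, ?_⟩, hcard⟩
  · simp only [Finset.forall_mem_insert]
    exact ⟨hne₁, hne₂, fun δ hδ => hP.nonempty δ (Finset.mem_of_mem_erase hδ)⟩
  · simp only [Finset.forall_mem_insert]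
    refine ⟨heven, ?_, fun δ hδ => hP.even δ (Finset.mem_of_mem_erase hδ)⟩
    have hcard := Finset.card_sdiff_add_card_eq_card hsub
    have hγeven := hP.even γ hγ
    rw [← hcard, Nat.even_add] at hγeven
    exact hγeven.2 heven
  · rw [← hP.biUnion_eq, Finset.biUnion_insert, Finset.biUnion_insert, ← Finset.union_assoc, id, id,
      Finset.union_sdiff_of_subset hsub]
    conv_rhs => rw [← Finset.insert_erase hγ, Finset.biUnion_insert, id]
  · simpa using hP.separated_erase_insert hm hγ hsub hsep

lemma exists_isContourFamily (hm : 16 ≤ m) (hS : S.Nonempty) (heven : Even S.card) :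
    ∃ P, IsContourFamily m S P ∧ ∀ γ ∈ P, Unsplittable m γ := by
  classical
  set F := S.powerset.powerset.filter (IsContourFamily m S)
  have hF (P) (hP : IsContourFamily m S P) : P ∈ F :=
    Finset.mem_filter.2 ⟨Finset.mem_powerset.2 fun γ hγ => Finset.mem_powerset.2
      (hP.biUnion_eq ▸ Finset.subset_biUnion_of_mem id hγ), hP⟩
  have hsingle : IsContourFamily m S {S} := ⟨by simpa, by simpa, by simp, by simp⟩
  obtain ⟨P, hPF, hmax⟩ := F.exists_max_image Finset.card ⟨{S}, hF _ hsingle⟩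
  have hP := (Finset.mem_filter.1 hPF).2
  refine ⟨P, hP, fun γ hγ => not_not.1 fun hsplit => ?_⟩
  obtain ⟨P', hP', hlt⟩ := hP.exists_card_lt hm hγ hsplit
  exact (hmax P' (hF P' hP')).not_gt hlt

lemma IsContourFamily.card_filter (hP : IsContourFamily m S P) (r : ℤ → Prop) [DecidablePred r] :
    (S.filter r).card = ∑ γ ∈ P, (γ.filter r).card := by
  rw [← hP.biUnion_eq, Finset.filter_biUnion, Finset.card_biUnion]
  · rfl
  · exact fun γ₁ h₁ γ₂ h₂ hne => Finset.disjoint_filter_filter (hP.separated h₁ h₂ hne).disjoint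

lemma IsContourFamily.exists_mem_inside (hP : IsContourFamily m S P) {x : ℤ} (hx : x ∈ inside S) :
    ∃ γ ∈ P, x ∈ inside γ := by
  by_contra! hout
  rw [mem_inside, hP.card_filter, ← Nat.not_even_iff_odd] at hx
  exact hx (Finset.even_sum _ fun γ hγ => Nat.not_odd_iff_even.1 (hout γ hγ))

lemma IsContourFamily.exists_ne_not_mem_inside_iff (hP : IsContourFamily m S P) (hγ : γ ∈ P)
    {x y : ℤ} (hS : x ∈ inside S ↔ y ∈ inside S) (hxy : ¬(x ∈ inside γ ↔ y ∈ inside γ)) :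
    ∃ γ' ∈ P, γ' ≠ γ ∧ ¬(x ∈ inside γ' ↔ y ∈ inside γ') := by
  wlog hle : x ≤ y generalizing x y
  · simpa only [iff_comm] using this hS.symm (mt Iff.symm hxy) (by lia)
  by_contra! hagree
  rw [mem_inside_iff_iff_even hle] at hxy hS
  rw [hP.card_filter, ← Finset.add_sum_erase _ _ hγ, Nat.even_add] at hS
  refine hxy (hS.2 (Finset.even_sum _ fun γ' hγ' => ?_))
  rw [← mem_inside_iff_iff_even hle]
  exact hagree γ' (Finset.mem_of_mem_erase hγ') (Finset.ne_of_mem_erase hγ')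

end ContourFamily

/-! ### The entropy of a contour is bounded by its energy -/

/-- The ordered pairs of sites with exactly one site in `B`. -/
def cut (B : Set ℤ) : Set (ℤ × ℤ) := {p | ¬(p.1 ∈ B ↔ p.2 ∈ B)}

lemma mem_cut {B : Set ℤ} {p : ℤ × ℤ} : p ∈ cut B ↔ ¬(p.1 ∈ B ↔ p.2 ∈ B) := Iff.rfl

lemma sum_couplingMeasure_le {ι : Type*} (α : ℝ) {s : Finset ι} {S : ι → Set (ℤ × ℤ)}
    {T : Set (ℤ × ℤ)} (hdisj : (s : Set ι).PairwiseDisjoint S) (hsub : ∀ i ∈ s, S i ⊆ T) :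
    ∑ i ∈ s, couplingMeasure α (S i) ≤ couplingMeasure α T := by
  rw [← measure_biUnion_finset hdisj fun i _ => (S i).to_countable.measurableSet]
  exact measure_mono (Set.iUnion₂_subset hsub)

lemma card_mul_le_couplingMeasure {α c : ℝ} {F : Finset (ℤ × ℤ)}
    (hF : ∀ p ∈ F, c ≤ pairCoupling α p) :
    F.card * ENNReal.ofReal c ≤ couplingMeasure α F := by
  rw [← sum_measure_singleton, ← nsmul_eq_mul]
  refine Finset.card_nsmul_le_sum _ _ _ fun p hp => ?_
  rw [couplingMeasure_singleton]
  exact ENNReal.ofReal_le_ofReal (hF p hp)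

lemma inv_sq_le_pairCoupling {α : ℝ} (hα : α ≤ 2) {p : ℤ × ℤ} (hp : p.1 ≠ p.2) {R : ℕ}
    (hR : (p.1 - p.2).natAbs ≤ R) : ((R : ℝ) ^ 2)⁻¹ ≤ pairCoupling α p := by
  have hne : (p.1 - p.2).natAbs ≠ 0 := by lia
  have hone : (1 : ℝ) ≤ (p.1 - p.2).natAbs := by exact_mod_cast Nat.one_le_iff_ne_zero.2 hne
  rw [pairCoupling, coupling, if_neg hne, Real.rpow_neg (by positivity)]
  refine inv_anti₀ (by positivity) ?_
  calc ((p.1 - p.2).natAbs : ℝ) ^ α ≤ ((p.1 - p.2).natAbs : ℝ) ^ (2 : ℝ) :=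
        Real.rpow_le_rpow_of_exponent_le hone hα
    _ = ((p.1 - p.2).natAbs : ℝ) ^ 2 := Real.rpow_two _
    _ ≤ (R : ℝ) ^ 2 := by gcongr

lemma card_le_couplingMeasure_cut {α : ℝ} (hα : α ≤ 2) (γ : Finset ℤ) :
    (γ.card : ℝ≥0∞) ≤ couplingMeasure α (cut (inside γ)) := by
  set F := γ.image fun p => (p - 1, p)
  have hcard : F.card = γ.card :=
    Finset.card_image_of_injective _ fun a b hab => congrArg Prod.snd hab
  have hF (p) (hp : p ∈ F) : 1 ≤ pairCoupling α p := by
    obtain ⟨q, -, rfl⟩ := Finset.mem_image.1 hp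
    simpa using inv_sq_le_pairCoupling hα (p := (q - 1, q)) (R := 1) (by simp) (by simp)
  calc (γ.card : ℝ≥0∞) = F.card * ENNReal.ofReal 1 := by simp [hcard]
    _ ≤ couplingMeasure α F := card_mul_le_couplingMeasure hF
    _ ≤ _ := by
      refine measure_mono fun p hp => ?_
      obtain ⟨q, hq, rfl⟩ := Finset.mem_image.1 (Finset.mem_coe.1 hp)
      rw [mem_cut, sub_one_mem_inside_iff]
      exact not_not.2 hq

/-- The product of two intervals of `N` sites at distance between `N` and `2 * N` from `x`, to the
left and to the right of `x`. -/
noncomputable def crossing (x : ℤ) (N : ℕ) : Finset (ℤ × ℤ) :=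
  Finset.Ico (x - 2 * N) (x - N) ×ˢ Finset.Ioc (x + N) (x + 2 * N)

lemma mem_crossing {x : ℤ} {N : ℕ} {p : ℤ × ℤ} : p ∈ crossing x N ↔
    (x - 2 * N ≤ p.1 ∧ p.1 < x - N) ∧ x + N < p.2 ∧ p.2 ≤ x + 2 * N := by
  simp [crossing]

lemma one_le_mul_couplingMeasure_crossing {α : ℝ} (hα : α ≤ 2) (x : ℤ) {N : ℕ} (hN : 0 < N) :
    1 ≤ 16 * couplingMeasure α (crossing x N) := by
  have hcard : (crossing x N).card = N * N := by
    rw [crossing, Finset.card_product, Int.card_Ico, Int.card_Ioc]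
    congr 1 <;> lia
  have hle : ∀ p ∈ crossing x N, (((4 * N : ℕ) : ℝ) ^ 2)⁻¹ ≤ pairCoupling α p := fun p hp => by
    rw [mem_crossing] at hp
    exact inv_sq_le_pairCoupling hα (by lia) (by lia)
  refine le_of_eq_of_le ?_ (mul_le_mul_right (card_mul_le_couplingMeasure hle) 16)
  rw [hcard, ← ENNReal.ofReal_natCast, ← ENNReal.ofReal_mul (by positivity),
    ← ENNReal.ofReal_ofNat, ← ENNReal.ofReal_mul (by positivity), ← ENNReal.ofReal_one]
  congr 1
  push_cast
  field_simp
  norm_num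

section Net

lemma exists_net (γ : Finset ℤ) {R : ℕ} (hR : 0 < R) :
    ∃ X ⊆ γ, (X : Set ℤ).Pairwise (fun x y => R ≤ (x - y).natAbs) ∧
      ∀ p ∈ γ, ∃ x ∈ X, (p - x).natAbs < R := by
  classical
  have : Std.Symm fun x y : ℤ => R ≤ (x - y).natAbs := ⟨fun x y => by lia⟩
  set F := γ.powerset.filter fun X : Finset ℤ =>
    (X : Set ℤ).Pairwise fun x y => R ≤ (x - y).natAbs with hF
  obtain ⟨X, hmax⟩ := F.exists_maximal ⟨∅, by simp [hF]⟩
  obtain ⟨hXγ, hX⟩ := Finset.mem_filter.1 hmax.prop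
  rw [Finset.mem_powerset] at hXγ
  refine ⟨X, hXγ, hX, fun p hp => ?_⟩
  by_contra! hfar
  have hinsert : insert p X ∈ F := by
    rw [hF, Finset.mem_filter, Finset.mem_powerset, Finset.coe_insert, Set.pairwise_insert_of_symm]
    exact ⟨Finset.insert_subset hp hXγ, hX, fun x hx _ => hfar x hx⟩
  have hpX := hfar p (hmax.le_of_ge hinsert (Finset.subset_insert p X) (Finset.mem_insert_self p X))
  lia

variable {m i : ℕ} {γ : Finset ℤ} {x : ℤ}

/-- A maximal subset of `γ` whose points are at mutual distance at least `scale m i`. -/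
noncomputable def net (m : ℕ) (γ : Finset ℤ) (i : ℕ) : Finset ℤ :=
  (exists_net γ (scale_pos m i)).choose

lemma net_subset (m : ℕ) (γ : Finset ℤ) (i : ℕ) : net m γ i ⊆ γ :=
  (exists_net γ (scale_pos m i)).choose_spec.1

lemma scale_le_of_mem_net {y : ℤ} (hx : x ∈ net m γ i) (hy : y ∈ net m γ i) (hne : x ≠ y) :
    scale m i ≤ (x - y).natAbs :=
  (exists_net γ (scale_pos m i)).choose_spec.2.1 hx hy hne

lemma exists_mem_net (i : ℕ) {p : ℤ} (hp : p ∈ γ) : ∃ x ∈ net m γ i, (p - x).natAbs < scale m i :=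
  (exists_net γ (scale_pos m i)).choose_spec.2.2 p hp

/-- The points of the finer net around a point `x` of the net at scale `i + 1`. -/
noncomputable def neighbours (m : ℕ) (γ : Finset ℤ) (i : ℕ) (x : ℤ) : Finset ℤ :=
  (net m γ i).filter fun y => 2 * (y - x).natAbs < scale m (i + 1)

/-- The points of the net at scale `i + 1` that have only one neighbour in the finer net. Around
such a point, `γ` looks like a single point between the two scales. -/
noncomputable def lonely (m : ℕ) (γ : Finset ℤ) (i : ℕ) : Finset ℤ :=
  (net m γ (i + 1)).filter fun x => (neighbours m γ i x).card ≤ 1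

lemma sum_card_neighbours_le (m : ℕ) (γ : Finset ℤ) (i : ℕ) :
    ∑ x ∈ net m γ (i + 1), (neighbours m γ i x).card ≤ (net m γ i).card := by
  rw [← Finset.card_biUnion]
  · exact Finset.card_le_card (Finset.biUnion_subset.2 fun x _ => Finset.filter_subset _ _)
  · intro x hx y hy hne
    rw [Function.onFun, Finset.disjoint_left]
    intro z hzx hzy
    have := (Finset.mem_filter.1 hzx).2
    have := (Finset.mem_filter.1 hzy).2
    have := scale_le_of_mem_net hx hy hne
    lia

lemma exists_mem_neighbours (hm : 16 ≤ m) (hx : x ∈ γ) :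
    ∃ y ∈ neighbours m γ i x, (x - y).natAbs < scale m i := by
  have hscale := two_pow_mul_scale_le (k := 4) hm i
  obtain ⟨y, hy, hxy⟩ := exists_mem_net i hx
  exact ⟨y, Finset.mem_filter.2 ⟨hy, by lia⟩, hxy⟩

lemma two_mul_card_net_le (hm : 16 ≤ m) (γ : Finset ℤ) (i : ℕ) :
    2 * (net m γ (i + 1)).card ≤ (net m γ i).card + (lonely m γ i).card := by
  calc 2 * (net m γ (i + 1)).card
      ≤ ∑ x ∈ net m γ (i + 1),
          ((neighbours m γ i x).card + if (neighbours m γ i x).card ≤ 1 then 1 else 0) := by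
        rw [mul_comm, ← smul_eq_mul]
        refine Finset.card_nsmul_le_sum _ _ _ fun x hx => ?_
        obtain ⟨y, hy, -⟩ := exists_mem_neighbours (i := i) hm (net_subset m γ (i + 1) hx)
        have := Finset.card_pos.2 ⟨y, hy⟩
        split_ifs <;> lia
    _ ≤ (net m γ i).card + (lonely m γ i).card := by
        rw [Finset.sum_add_distrib, ← Finset.card_filter]
        exact Nat.add_le_add_right (sum_card_neighbours_le m γ i) _

lemma natAbs_sub_lt_of_mem_lonely (hm : 16 ≤ m) (hx : x ∈ lonely m γ i) {p : ℤ} (hp : p ∈ γ)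
    (hpx : 2 * (p - x).natAbs + 2 * scale m i < scale m (i + 1)) :
    (p - x).natAbs < 2 * scale m i := by
  obtain ⟨hxnet, hcard⟩ := Finset.mem_filter.1 hx
  obtain ⟨y, hy, hyx⟩ := exists_mem_neighbours (i := i) hm (net_subset m γ (i + 1) hxnet)
  obtain ⟨z, hz, hzp⟩ := exists_mem_net i hp
  obtain rfl : y = z :=
    Finset.card_le_one.1 hcard y hy z (Finset.mem_filter.2 ⟨hz, by lia⟩)
  lia

lemma odd_card_of_mem_lonely (hm : 16 ≤ m) (hγ : Unsplittable m γ) (hi : i < scaleIndex m γ)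
    (hx : x ∈ lonely m γ i) : Odd (γ.filter fun p => (p - x).natAbs < 2 * scale m i).card := by
  have hscale := two_pow_mul_scale_le (k := 4) hm i
  have hpos := scale_pos m i
  set γ₁ := γ.filter fun p => (p - x).natAbs < 2 * scale m i
  have hindex : scaleIndex m γ₁ ≤ i := by
    refine (scaleIndex_le_iff hm).2 (diam_le_iff.2 fun p hp q hq => ?_)
    have := (Finset.mem_filter.1 hp).2
    have := (Finset.mem_filter.1 hq).2
    lia
  have hxγ₁ : x ∈ γ₁ := Finset.mem_filter.2
    ⟨net_subset m γ (i + 1) (Finset.mem_filter.1 hx).1, by simpa using hpos⟩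
  have hrest : (γ \ γ₁).Nonempty := Finset.sdiff_nonempty.2 fun hsub =>
    (hi.trans_le (scaleIndex_mono hm hsub)).not_ge hindex
  by_contra heven
  refine hγ γ₁ (Finset.filter_subset _ _) ⟨x, hxγ₁⟩ hrest (Nat.not_odd_iff_even.1 heven)
    fun p hp q hq => ?_
  obtain ⟨hqγ, hqγ₁⟩ := Finset.mem_sdiff.1 hq
  have hpx := (Finset.mem_filter.1 hp).2
  have hqx : ¬(q - x).natAbs < 2 * scale m i := fun hlt => hqγ₁ (Finset.mem_filter.2 ⟨hqγ, hlt⟩)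
  have hfar := mt (natAbs_sub_lt_of_mem_lonely hm hx hqγ) hqx
  have hmin := monotone_scale m
    (show min (scaleIndex m γ₁) (scaleIndex m (γ \ γ₁)) + 1 ≤ i + 1 by lia)
  lia

lemma mem_cut_of_mem_lonely (hm : 16 ≤ m) (hγ : Unsplittable m γ) (hi : i < scaleIndex m γ)
    (hx : x ∈ lonely m γ i) {y z : ℤ}
    (hy : y ≤ x - 2 * scale m i) (hy' : 4 * (x - y) ≤ scale m (i + 1))
    (hz : x + 2 * scale m i ≤ z) (hz' : 4 * (z - x) ≤ scale m (i + 1)) :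
    (y, z) ∈ cut (inside γ) := by
  have hscale := two_pow_mul_scale_le (k := 4) hm i
  have hpos := scale_pos m i
  rw [mem_cut, mem_inside_iff_iff_even (by lia), Nat.not_even_iff_odd]
  convert odd_card_of_mem_lonely hm hγ hi hx using 2
  refine Finset.filter_congr fun p hp => ⟨fun hbetween => ?_, fun hnear => by lia⟩
  exact natAbs_sub_lt_of_mem_lonely hm hx hp (by lia)

/-- The pairs cut by `γ` at distance of order `2 ^ k`. -/
def cutAt (γ : Finset ℤ) (k : ℕ) : Set (ℤ × ℤ) :=
  {p | p ∈ cut (inside γ) ∧ 2 ^ (k + 1) < (p.1 - p.2).natAbs ∧ (p.1 - p.2).natAbs ≤ 2 ^ (k + 2)}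

lemma sum_couplingMeasure_cutAt_le (α : ℝ) (γ : Finset ℤ) (s : Finset ℕ) :
    ∑ k ∈ s, couplingMeasure α (cutAt γ k) ≤ couplingMeasure α (cut (inside γ)) := by
  refine sum_couplingMeasure_le α ?_ fun k _ p hp => hp.1
  have hdisj (k l : ℕ) (hkl : k < l) : Disjoint (cutAt γ k) (cutAt γ l) := by
    refine Set.disjoint_left.2 fun p ⟨_, _, hle⟩ ⟨_, hlt, _⟩ => ?_
    exact (hlt.trans_le hle).not_ge (Nat.pow_le_pow_right two_pos (by lia))
  intro k _ l _ hkl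
  obtain hlt | hlt := hkl.lt_or_gt
  exacts [hdisj k l hlt, (hdisj l k hlt).symm]

lemma card_lonely_le {α : ℝ} (hα : α ≤ 2) (hm : 16 ≤ m) (hγ : Unsplittable m γ)
    (hi : i < scaleIndex m γ) {k : ℕ} (hk : scaleExp m i + 1 ≤ k)
    (hk' : k + 3 ≤ scaleExp m (i + 1)) :
    ((lonely m γ i).card : ℝ≥0∞) ≤ 16 * couplingMeasure α (cutAt γ k) := by
  have hlower : 2 * scale m i ≤ 2 ^ k := by
    rw [scale, ← pow_succ']
    exact Nat.pow_le_pow_right two_pos hk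
  have hupper : 2 ^ k * 2 ^ 3 ≤ scale m (i + 1) := by
    rw [← pow_add]
    exact Nat.pow_le_pow_right two_pos hk'
  have hpos : 0 < 2 ^ k := Nat.two_pow_pos k
  have hsub (x) (hx : x ∈ lonely m γ i) : ↑(crossing x (2 ^ k)) ⊆ cutAt γ k := by
    intro p hp
    rw [Finset.mem_coe, mem_crossing] at hp
    refine ⟨mem_cut_of_mem_lonely hm hγ hi hx ?_ ?_ ?_ ?_, ?_, ?_⟩ <;> lia
  have hdisj : (lonely m γ i : Set ℤ).PairwiseDisjoint
      fun x => (crossing x (2 ^ k) : Set (ℤ × ℤ)) := by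
    intro x hx y hy hne
    refine Set.disjoint_left.2 fun p hpx hpy => ?_
    have := scale_le_of_mem_net (Finset.mem_filter.1 hx).1 (Finset.mem_filter.1 hy).1 hne
    rw [Finset.mem_coe, mem_crossing] at hpx hpy
    lia
  calc ((lonely m γ i).card : ℝ≥0∞) = ∑ _x ∈ lonely m γ i, 1 := by simp
    _ ≤ ∑ x ∈ lonely m γ i, 16 * couplingMeasure α (crossing x (2 ^ k)) :=
        Finset.sum_le_sum fun x _ => one_le_mul_couplingMeasure_crossing hα x hpos
    _ ≤ 16 * couplingMeasure α (cutAt γ k) := by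
        rw [← Finset.mul_sum]
        exact mul_le_mul_right (sum_couplingMeasure_le α hdisj hsub) 16

lemma card_lonely_mul_scaleExp_le {α : ℝ} (hα : α ≤ 2) (hm : 64 ≤ m) (hγ : Unsplittable m γ)
    (hi : i < scaleIndex m γ) :
    (((lonely m γ i).card * scaleExp m i : ℕ) : ℝ≥0∞) ≤
      128 * ∑ k ∈ Finset.Ico (scaleExp m i) (scaleExp m (i + 1)),
        couplingMeasure α (cutAt γ k) := by
  have hle := le_scaleExp m i
  have hsucc := scaleExp_succ m i
  set I := Finset.Ico (scaleExp m i + 1) (scaleExp m (i + 1) - 2) with hI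
  have hIsub : I ⊆ Finset.Ico (scaleExp m i) (scaleExp m (i + 1)) :=
    Finset.Ico_subset_Ico (by lia) (by lia)
  have hIcard : scaleExp m i ≤ 8 * I.card := by rw [hI, Nat.card_Ico]; lia
  calc (((lonely m γ i).card * scaleExp m i : ℕ) : ℝ≥0∞)
      ≤ (((lonely m γ i).card * (8 * I.card) : ℕ) : ℝ≥0∞) := by gcongr
    _ = 8 * ∑ _k ∈ I, ((lonely m γ i).card : ℝ≥0∞) := by
        rw [Finset.sum_const, nsmul_eq_mul]; push_cast; ring
    _ ≤ 8 * ∑ k ∈ I, 16 * couplingMeasure α (cutAt γ k) := by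
        gcongr with k hk
        rw [hI, Finset.mem_Ico] at hk
        exact card_lonely_le hα (by lia) hγ hi hk.1 (by lia)
    _ = 128 * ∑ k ∈ I, couplingMeasure α (cutAt γ k) := by
        rw [← Finset.mul_sum, ← mul_assoc]; norm_num
    _ ≤ _ := by gcongr

lemma sum_card_lonely_mul_le {α : ℝ} (hα : α ≤ 2) (hm : 64 ≤ m) (hγ : Unsplittable m γ) :
    ((∑ i ∈ Finset.range (scaleIndex m γ), (lonely m γ i).card * scaleExp m i : ℕ) : ℝ≥0∞) ≤
      128 * couplingMeasure α (cut (inside γ)) := by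
  have hpartial (n : ℕ) (hn : n ≤ scaleIndex m γ) :
      ((∑ i ∈ Finset.range n, (lonely m γ i).card * scaleExp m i : ℕ) : ℝ≥0∞) ≤
      128 * ∑ k ∈ Finset.Ico (scaleExp m 0) (scaleExp m n), couplingMeasure α (cutAt γ k) := by
    induction n with
    | zero => simp
    | succ n ih =>
      rw [Finset.sum_range_succ, Nat.cast_add,
        ← Finset.sum_Ico_consecutive _ (monotone_scaleExp m (Nat.zero_le n))
          (monotone_scaleExp m (Nat.le_succ n)), mul_add]
      exact add_le_add (ih (by lia)) (card_lonely_mul_scaleExp_le hα hm hγ hn)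
  refine (hpartial _ le_rfl).trans ?_
  gcongr
  exact sum_couplingMeasure_cutAt_le α γ _

lemma eight_mul_card_net_mul_le (hm : 16 ≤ m) (γ : Finset ℤ) (i : ℕ) :
    8 * ((net m γ (i + 1)).card * scaleExp m (i + 1)) ≤
      5 * ((net m γ i).card * scaleExp m i) + 5 * ((lonely m γ i).card * scaleExp m i) := by
  have hexp : 4 * scaleExp m (i + 1) ≤ 5 * scaleExp m i := by rw [scaleExp_succ]; lia
  calc 8 * ((net m γ (i + 1)).card * scaleExp m (i + 1))
      = (2 * (net m γ (i + 1)).card) * (4 * scaleExp m (i + 1)) := by ring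
    _ ≤ ((net m γ i).card + (lonely m γ i).card) * (5 * scaleExp m i) :=
        Nat.mul_le_mul (two_mul_card_net_le hm γ i) hexp
    _ = _ := by ring

/-- Passing to the next scale multiplies the logarithm of the scale by `5 / 4` but, up to lonely
points, halves the net: the sum is of geometric type with ratio `5 / 8`. -/
lemma three_mul_sum_card_net_le (hm : 16 ≤ m) (γ : Finset ℤ) (n : ℕ) :
    3 * ∑ i ∈ Finset.range n, (net m γ i).card * scaleExp m i ≤
      8 * (γ.card * m) + 5 * ∑ i ∈ Finset.range n, (lonely m γ i).card * scaleExp m i := by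
  have hzero : (net m γ 0).card * scaleExp m 0 ≤ γ.card * m :=
    Nat.mul_le_mul_right _ (Finset.card_le_card (net_subset m γ 0))
  have hsucc : 8 * ∑ i ∈ Finset.range n, (net m γ (i + 1)).card * scaleExp m (i + 1) ≤
      5 * ∑ i ∈ Finset.range n, (net m γ i).card * scaleExp m i +
      5 * ∑ i ∈ Finset.range n, (lonely m γ i).card * scaleExp m i := by
    simp only [Finset.mul_sum, ← Finset.sum_add_distrib]
    exact Finset.sum_le_sum fun i _ => eight_mul_card_net_mul_le hm γ i
  have hshift := Finset.sum_range_succ' (fun i => (net m γ i).card * scaleExp m i) n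
  rw [Finset.sum_range_succ] at hshift
  lia

end Net

/-- The number of dyadic blocks that meet `γ`, summed over the block lengths `2 ^ k`, `k < K`. It
measures the entropy of `γ`: a set is determined by its successive refinements into blocks, and
every block has two halves. -/
def blockCount (γ : Finset ℤ) (K : ℕ) : ℕ :=
  ∑ k ∈ Finset.range K, (γ.image fun p => p / 2 ^ k).card

section BlockCount

variable {m : ℕ}

lemma card_image_div_le_three_mul (γ : Finset ℤ) {i k : ℕ} (hk : scaleExp m i ≤ k) :
    (γ.image fun p => p / 2 ^ k).card ≤ 3 * (net m γ i).card := by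
  have hpos : (0 : ℤ) < 2 ^ k := by positivity
  have hdiv (a b : ℤ) (hab : a ≤ b + 2 ^ k) : a / 2 ^ k ≤ b / 2 ^ k + 1 := by
    rw [← Int.ediv_self hpos.ne', ← Int.add_ediv_of_dvd_right dvd_rfl]
    exact Int.ediv_le_ediv hpos hab
  have hsub : (γ.image fun p => p / 2 ^ k) ⊆
      (net m γ i).biUnion fun x => {x / 2 ^ k - 1, x / 2 ^ k, x / 2 ^ k + 1} := by
    intro b hb
    obtain ⟨p, hp, rfl⟩ := Finset.mem_image.1 hb
    obtain ⟨x, hx, hpx⟩ := exists_mem_net i hp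
    have hlt : |p - x| < 2 ^ k := by
      zify at hpx
      exact hpx.trans_le (by exact_mod_cast Nat.pow_le_pow_right two_pos hk)
    have hle := hdiv p x (by linarith [(abs_lt.1 hlt).2])
    have hge := hdiv x p (by linarith [(abs_lt.1 hlt).1])
    refine Finset.mem_biUnion.2 ⟨x, hx, ?_⟩
    simp only [Finset.mem_insert, Finset.mem_singleton]
    lia
  rw [mul_comm]
  exact (Finset.card_le_card hsub).trans
    (Finset.card_biUnion_le_card_mul _ _ 3 fun x _ => Finset.card_le_three)

lemma blockCount_scaleExp_le (γ : Finset ℤ) (n : ℕ) :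
    blockCount γ (scaleExp m n) ≤
      m * γ.card + ∑ i ∈ Finset.range n, (net m γ i).card * scaleExp m i := by
  unfold blockCount
  induction n with
  | zero =>
    refine (Finset.sum_le_card_nsmul _ _ γ.card fun k _ => Finset.card_image_le).trans ?_
    simp [scaleExp]
  | succ n ih =>
    rw [Finset.sum_range_succ _ n, ← Finset.sum_range_add_sum_Ico _
      (monotone_scaleExp m (Nat.le_succ n)), ← add_assoc]
    refine add_le_add ih ((Finset.sum_le_card_nsmul _ _ _ fun k hk =>
      card_image_div_le_three_mul γ (Finset.mem_Ico.1 hk).1).trans ?_)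
    rw [Nat.card_Ico, smul_eq_mul, scaleExp_succ, mul_comm, mul_comm 3, mul_assoc]
    exact Nat.mul_le_mul_left _ (by lia)

lemma blockCount_add_le (γ : Finset ℤ) (K l : ℕ) :
    blockCount γ (K + l) ≤ blockCount γ K + l * γ.card := by
  rw [blockCount, Finset.sum_range_add]
  gcongr
  · exact le_rfl
  · simpa using Finset.sum_le_card_nsmul (Finset.range l) _ γ.card fun _ _ => Finset.card_image_le

lemma blockCount_le_couplingMeasure_cut {α : ℝ} (hα : α ≤ 2) (hm : 64 ≤ m) {γ : Finset ℤ}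
    (hγ : Unsplittable m γ) :
    (blockCount γ (scaleExp m (scaleIndex m γ) + 3) : ℝ≥0∞) ≤
      ((9 * m + 643 : ℕ) : ℝ≥0∞) * couplingMeasure α (cut (inside γ)) := by
  set n := scaleIndex m γ
  set l := ∑ i ∈ Finset.range n, (lonely m γ i).card * scaleExp m i
  have hle : blockCount γ (scaleExp m n + 3) ≤ (9 * m + 3) * γ.card + 5 * l := by
    have hadd := blockCount_add_le γ (scaleExp m n) 3
    have hblock := blockCount_scaleExp_le (m := m) γ n
    have hnet : _ ≤ 8 * (γ.card * m) + 5 * l := three_mul_sum_card_net_le (by lia) γ n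
    linarith
  calc (blockCount γ (scaleExp m n + 3) : ℝ≥0∞)
      ≤ ((9 * m + 3 : ℕ) : ℝ≥0∞) * γ.card + 5 * (l : ℝ≥0∞) := by exact_mod_cast hle
    _ ≤ ((9 * m + 3 : ℕ) : ℝ≥0∞) * couplingMeasure α (cut (inside γ)) +
        5 * (128 * couplingMeasure α (cut (inside γ))) := by
        gcongr
        exacts [card_le_couplingMeasure_cut hα γ, sum_card_lonely_mul_le hα hm hγ]
    _ = _ := by push_cast; ring

end BlockCount

/-! ### Nested contours -/

/-- The ordered pairs cut by the contour `γ` whose first site lies in `U`. -/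
def rows (γ : Finset ℤ) (U : Set ℤ) : Set (ℤ × ℤ) := {p | p ∈ cut (inside γ) ∧ p.1 ∈ U}

lemma mem_or_mem_of_mem_cut {B : Set ℤ} {p : ℤ × ℤ} (hp : p ∈ cut B) : p.1 ∈ B ∨ p.2 ∈ B := by
  rw [mem_cut] at hp
  tauto

lemma rows_mono (γ : Finset ℤ) {U V : Set ℤ} (h : U ⊆ V) : rows γ U ⊆ rows γ V :=
  fun _ hp => ⟨hp.1, h hp.2⟩

lemma rows_subset_cut (γ : Finset ℤ) (U : Set ℤ) : rows γ U ⊆ cut (inside γ) := fun _ hp => hp.1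

lemma pairwiseDisjoint_rows {ι : Type*} (γ : Finset ℤ) {s : Set ι} {U : ι → Set ℤ}
    (hU : s.PairwiseDisjoint U) : s.PairwiseDisjoint fun i => rows γ (U i) :=
  fun _ hi _ hj hne => Set.disjoint_left.2 fun _ hp hq =>
    Set.disjoint_left.1 (hU hi hj hne) hp.2 hq.2

lemma couplingMeasure_rows_coe (α : ℝ) (γ B : Finset ℤ) :
    couplingMeasure α (rows γ B) = ∑ x ∈ B, couplingMeasure α (rows γ {x}) := by
  have hdisj : (B : Set ℤ).PairwiseDisjoint fun x : ℤ => ({x} : Set ℤ) :=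
    fun _ _ _ _ hne => Set.disjoint_singleton.2 hne
  rw [← measure_biUnion_finset (pairwiseDisjoint_rows γ hdisj)
    fun _ _ => (Set.to_countable _).measurableSet]
  congr 1
  ext p
  simp [rows, and_comm]

lemma exists_mem_between {γ : Finset ℤ} {x y : ℤ} (h : ¬(x ∈ inside γ ↔ y ∈ inside γ)) :
    ∃ p ∈ γ, (x < p ∧ p ≤ y) ∨ (y < p ∧ p ≤ x) := by
  obtain hxy | hxy := le_total x y
  · obtain ⟨p, hp, hlt⟩ := exists_mem_of_not_mem_inside_iff hxy h
    exact ⟨p, hp, Or.inl hlt⟩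
  · obtain ⟨p, hp, hlt⟩ := exists_mem_of_not_mem_inside_iff hxy (mt Iff.symm h)
    exact ⟨p, hp, Or.inr hlt⟩

lemma exists_mem_le_lt_of_mem_inside {γ : Finset ℤ} (hγ : Even γ.card) {x : ℤ}
    (hx : x ∈ inside γ) : ∃ p ∈ γ, ∃ q ∈ γ, p ≤ x ∧ x < q ∧ q - p ≤ diam γ := by
  obtain ⟨p, hp, hpx⟩ := exists_le_of_mem_inside hx
  obtain ⟨q, hq, hqx⟩ := exists_lt_of_mem_inside hγ hx
  have := natAbs_sub_le_diam hp hq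
  exact ⟨p, hp, q, hq, hpx, hqx, by lia⟩

lemma ncard_inside_le_diam {γ : Finset ℤ} (hγ : Even γ.card) : (inside γ).ncard ≤ diam γ := by
  obtain rfl | hne := γ.eq_empty_or_nonempty
  · simp [inside]
  have hsub : inside γ ⊆ ↑(Finset.Ico (γ.min' hne) (γ.max' hne)) := by
    intro u hu
    obtain ⟨p, hp, q, hq, hpu, huq, -⟩ := exists_mem_le_lt_of_mem_inside hγ hu
    rw [Finset.mem_coe, Finset.mem_Ico]
    exact ⟨(γ.min'_le p hp).trans hpu, huq.trans_le (γ.le_max' q hq)⟩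
  have hcard := Set.ncard_le_ncard hsub (Finset.finite_toSet _)
  have hdiam := natAbs_sub_le_diam (γ.max'_mem hne) (γ.min'_mem hne)
  rw [Set.ncard_coe_finset, Int.card_Ico] at hcard
  lia

section Row

variable {α : ℝ} {γ : Finset ℤ}

/-- The ordered pairs with first site `x` whose second site is at least `n` to the right of `x`. -/
def halfRow (x : ℤ) (n : ℕ) : Set (ℤ × ℤ) := {p | p.1 = x ∧ x + n ≤ p.2}

lemma coupling_le_rpow_mul_coupling_div (hα : 0 ≤ α) {N r : ℕ} (hN : 0 < N) (hr : N ≤ r) :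
    coupling α r ≤ (N : ℝ) ^ (-α) * coupling α (r / N) := by
  have hdiv : 0 < r / N := Nat.div_pos hr hN
  rw [coupling, coupling, if_neg (by lia), if_neg hdiv.ne', ← Real.mul_rpow (by positivity)
    (by positivity)]
  refine Real.rpow_le_rpow_of_nonpos (by positivity) ?_ (neg_nonpos.2 hα)
  exact_mod_cast Nat.mul_div_le r N

lemma couplingMeasure_halfRow_emod_le (hα : 0 ≤ α) (x : ℤ) {N D : ℕ} (hN : 0 < N) (hD : 0 < D)
    (i : ℤ) :
    couplingMeasure α {p | p ∈ halfRow x (N * D) ∧ (p.2 - x) % N = i} ≤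
      ENNReal.ofReal ((N : ℝ) ^ (-α)) * couplingMeasure α (halfRow x D) := by
  have hNZ : (0 : ℤ) < N := by exact_mod_cast hN
  refine couplingMeasure_le_mul_of_injOn (f := fun p => (x, x + (p.2 - x) / N)) (by positivity)
    ?_ ?_ ?_
  · rintro p ⟨⟨-, hp⟩, -⟩
    push_cast at hp
    have hle : (D : ℤ) ≤ (p.2 - x) / N := (Int.le_ediv_iff_mul_le hNZ).2 (by linarith)
    exact ⟨rfl, by simpa using hle⟩
  · rintro p ⟨⟨hp, -⟩, hpi⟩ q ⟨⟨hq, -⟩, hqi⟩ hpq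
    refine Prod.ext (hp.trans hq.symm) ?_
    have hdiv : (p.2 - x) / N = (q.2 - x) / N := by simpa using hpq
    have hsub := Int.emod_add_mul_ediv (p.2 - x) N
    rw [hpi, hdiv, ← hqi, Int.emod_add_mul_ediv] at hsub
    linarith
  · rintro ⟨y, z⟩ ⟨⟨rfl : y = x, hz : y + ((N * D : ℕ) : ℤ) ≤ z⟩, -⟩
    obtain ⟨r, hr⟩ := Int.eq_ofNat_of_zero_le (show 0 ≤ z - y by lia)
    obtain rfl : z = y + r := by lia
    have hle : N ≤ r := (Nat.le_mul_of_pos_right N hD).trans (by lia)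
    simp only [pairCoupling, sub_add_cancel_left, add_sub_cancel_left, Int.natAbs_neg,
      ← Int.natCast_div, Int.natAbs_natCast]
    exact coupling_le_rpow_mul_coupling_div hα hN hle

/-- The map `r ↦ r / N` is injective on every residue class modulo `N`, and there are `N` of these
classes. -/
lemma couplingMeasure_halfRow_mul_le (hα : 0 ≤ α) (x : ℤ) {N D : ℕ} (hN : 0 < N) (hD : 0 < D) :
    couplingMeasure α (halfRow x (N * D)) ≤
      ENNReal.ofReal ((N : ℝ) ^ (1 - α)) * couplingMeasure α (halfRow x D) := by
  have hNZ : (0 : ℤ) < N := by exact_mod_cast hN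
  set R : ℕ → Set (ℤ × ℤ) := fun i => {p | p ∈ halfRow x (N * D) ∧ (p.2 - x) % N = i}
  have hcover : halfRow x (N * D) ⊆ ⋃ i ∈ Finset.range N, R i := by
    intro p hp
    refine Set.mem_biUnion (x := ((p.2 - x) % N).toNat) ?_ ⟨hp, ?_⟩
    · have := Int.emod_lt_of_pos (p.2 - x) hNZ
      simpa using by lia
    · exact (Int.toNat_of_nonneg (Int.emod_nonneg _ hNZ.ne')).symm
  calc couplingMeasure α (halfRow x (N * D)) ≤ ∑ i ∈ Finset.range N, couplingMeasure α (R i) :=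
        (measure_mono hcover).trans (measure_biUnion_finset_le _ _)
    _ ≤ N * (ENNReal.ofReal ((N : ℝ) ^ (-α)) * couplingMeasure α (halfRow x D)) := by
        simpa using Finset.sum_le_card_nsmul (Finset.range N) _ _ fun i _ =>
          couplingMeasure_halfRow_emod_le hα x hN hD i
    _ = ENNReal.ofReal ((N : ℝ) ^ (1 - α)) * couplingMeasure α (halfRow x D) := by
        rw [← mul_assoc, ← ENNReal.ofReal_natCast, ← ENNReal.ofReal_mul (by positivity),
          sub_eq_add_neg, Real.rpow_add (by positivity), Real.rpow_one]

lemma couplingMeasure_row_far_le (α : ℝ) (x : ℤ) (n : ℕ) :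
    couplingMeasure α {p | p.1 = x ∧ n ≤ (p.1 - p.2).natAbs} ≤
      2 * couplingMeasure α (halfRow x n) := by
  have hcover : {p : ℤ × ℤ | p.1 = x ∧ n ≤ (p.1 - p.2).natAbs} ⊆
      halfRow x n ∪ {p | p.1 = x ∧ p.2 + n ≤ x} := by
    rintro ⟨y, z⟩ ⟨rfl : y = x, hz : n ≤ (y - z).natAbs⟩
    simp only [halfRow, Set.mem_union, Set.mem_ofPred_eq, true_and]
    lia
  have hleft : couplingMeasure α {p | p.1 = x ∧ p.2 + n ≤ x} ≤ couplingMeasure α (halfRow x n) := by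
    simpa using couplingMeasure_le_mul_of_injOn (α := α) zero_le_one
      (S := {p | p.1 = x ∧ p.2 + n ≤ x}) (T := halfRow x n) (f := fun p => (p.1, 2 * p.1 - p.2))
      (fun p hp => ⟨hp.1, by have := hp.1; have := hp.2; simp only; lia⟩)
      (fun p _ q _ hpq => by
        simp only [Prod.mk.injEq] at hpq
        exact Prod.ext hpq.1 (by lia))
      (fun p _ => by rw [one_mul, pairCoupling, pairCoupling, ← Int.natAbs_neg]; ring_nf; rfl)
  rw [two_mul]
  exact (measure_mono hcover).trans ((measure_union_le _ _).trans (by gcongr))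

lemma halfRow_subset_rows (hγ : Even γ.card) {x : ℤ} (hx : x ∈ inside γ) {n : ℕ}
    (hn : diam γ ≤ n) : halfRow x n ⊆ rows γ {x} := by
  rintro ⟨y, z⟩ ⟨rfl : y = x, hz : y + n ≤ z⟩
  refine ⟨fun hiff => ?_, rfl⟩
  obtain ⟨p, hp, -, -, hpy, -, -⟩ := exists_mem_le_lt_of_mem_inside hγ hx
  obtain ⟨-, -, q, hq, -, hzq, -⟩ := exists_mem_le_lt_of_mem_inside hγ (hiff.1 hx)
  have := natAbs_sub_le_diam hp hq
  simp only at hzq hpy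
  lia

lemma couplingMeasure_inside_far_le (hα : 0 ≤ α) (hγ : Even γ.card) {N D : ℕ} (hN : 0 < N)
    (hD : 0 < D) (hdiam : diam γ ≤ D) :
    couplingMeasure α {p | p.1 ∈ inside γ ∧ N * D ≤ (p.1 - p.2).natAbs} ≤
      2 * ENNReal.ofReal ((N : ℝ) ^ (1 - α)) * couplingMeasure α (cut (inside γ)) := by
  set c := ENNReal.ofReal ((N : ℝ) ^ (1 - α))
  obtain ⟨B, hB⟩ := (finite_inside hγ).exists_finset_coe
  set F : ℤ → Set (ℤ × ℤ) := fun x => {p | p.1 = x ∧ N * D ≤ (p.1 - p.2).natAbs}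
  have hcover : {p | p.1 ∈ inside γ ∧ N * D ≤ (p.1 - p.2).natAbs} ⊆ ⋃ x ∈ B, F x := by
    rintro p ⟨hp, hfar⟩
    exact Set.mem_biUnion (hB ▸ hp) ⟨rfl, hfar⟩
  have hF (x) (hx : x ∈ B) : couplingMeasure α (F x) ≤ 2 * c * couplingMeasure α (rows γ {x}) :=
    calc couplingMeasure α (F x) ≤ 2 * couplingMeasure α (halfRow x (N * D)) :=
          couplingMeasure_row_far_le α x _
      _ ≤ 2 * (c * couplingMeasure α (halfRow x D)) := by
          gcongr
          exact couplingMeasure_halfRow_mul_le hα x hN hD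
      _ ≤ 2 * (c * couplingMeasure α (rows γ {x})) := by
          gcongr
          exact halfRow_subset_rows hγ (hB ▸ hx) hdiam
      _ = _ := (mul_assoc _ _ _).symm
  calc _ ≤ ∑ x ∈ B, couplingMeasure α (F x) :=
        (measure_mono hcover).trans (measure_biUnion_finset_le _ _)
    _ ≤ ∑ x ∈ B, 2 * c * couplingMeasure α (rows γ {x}) := Finset.sum_le_sum hF
    _ = 2 * c * couplingMeasure α (rows γ B) := by rw [← Finset.mul_sum, couplingMeasure_rows_coe]
    _ ≤ _ := by
        gcongr
        exact rows_subset_cut γ _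

lemma couplingMeasure_cut_far_le (hα : 0 ≤ α) (hγ : Even γ.card) {N D : ℕ} (hN : 0 < N)
    (hD : 0 < D) (hdiam : diam γ ≤ D) :
    couplingMeasure α {p | p ∈ cut (inside γ) ∧ N * D ≤ (p.1 - p.2).natAbs} ≤
      4 * ENNReal.ofReal ((N : ℝ) ^ (1 - α)) * couplingMeasure α (cut (inside γ)) := by
  set T : Set (ℤ × ℤ) := {p | p.1 ∈ inside γ ∧ N * D ≤ (p.1 - p.2).natAbs}
  have hcover : {p | p ∈ cut (inside γ) ∧ N * D ≤ (p.1 - p.2).natAbs} ⊆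
      T ∪ Prod.swap ⁻¹' T := by
    rintro p ⟨hp, hfar⟩
    obtain h | h := mem_or_mem_of_mem_cut hp
    · exact Or.inl ⟨h, hfar⟩
    · exact Or.inr ⟨h, show _ ≤ (p.2 - p.1).natAbs by lia⟩
  have hT := couplingMeasure_inside_far_le hα hγ hN hD hdiam
  refine (measure_mono hcover).trans ((measure_union_le _ _).trans ?_)
  rw [couplingMeasure_preimage_swap]
  exact (add_le_add hT hT).trans_eq (by ring)

end Row

section Nested

variable {α : ℝ} {m : ℕ} {γ γ' : Finset ℤ}

lemma pairCoupling_le_four_mul (hα : 0 ≤ α) (hα₂ : α ≤ 2) {p q : ℤ × ℤ} (hq : q.1 ≠ q.2)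
    (h : (q.1 - q.2).natAbs ≤ 2 * (p.1 - p.2).natAbs) :
    pairCoupling α p ≤ 4 * pairCoupling α q := by
  rw [pairCoupling, pairCoupling, coupling, coupling, if_neg (by lia), if_neg (by lia)]
  set a := (p.1 - p.2).natAbs
  set b := (q.1 - q.2).natAbs
  have ha : (0 : ℝ) < a := by exact_mod_cast (by lia : 0 < a)
  have hb : (0 : ℝ) < b := by exact_mod_cast (by lia : 0 < b)
  have hpow : (b : ℝ) ^ α ≤ 4 * (a : ℝ) ^ α :=
    calc (b : ℝ) ^ α ≤ (2 * a) ^ α := Real.rpow_le_rpow hb.le (by exact_mod_cast h) hα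
      _ = 2 ^ α * (a : ℝ) ^ α := Real.mul_rpow zero_le_two ha.le
      _ ≤ 2 ^ (2 : ℝ) * (a : ℝ) ^ α := by gcongr; norm_num
      _ = _ := by norm_num
  rw [Real.rpow_neg ha.le, Real.rpow_neg hb.le, ← div_eq_mul_inv,
    inv_le_comm₀ (by positivity) (by positivity), inv_div, div_le_iff₀ (by norm_num)]
  linarith

lemma scale_le_of_mem_cut_of_mem_cut (hm : 64 ≤ m) (hγ : Even γ.card) (hsep : Separated m γ γ')
    (hidx : scaleIndex m γ ≤ scaleIndex m γ') {p : ℤ × ℤ} (hp : p ∈ cut (inside γ))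
    (hp' : p ∈ cut (inside γ')) :
    scale m (scaleIndex m γ + 1) ≤ 8 * (p.1 - p.2).natAbs := by
  have hdiam := (scaleIndex_le_iff (by lia : 16 ≤ m)).1 (le_refl (scaleIndex m γ))
  have hscale := two_pow_mul_scale_le (k := 5) (by lia : 4 * 5 ≤ m) (scaleIndex m γ)
  obtain ⟨q, hq, hpq⟩ := exists_mem_between hp'
  obtain ⟨b, hb, hbp⟩ : ∃ b, b ∈ inside γ ∧ (b = p.1 ∨ b = p.2) := by
    obtain h | h := mem_or_mem_of_mem_cut hp
    exacts [⟨_, h, Or.inl rfl⟩, ⟨_, h, Or.inr rfl⟩]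
  obtain ⟨r, hr, r', -, hrb, hbr, hrr⟩ := exists_mem_le_lt_of_mem_inside hγ hb
  have hdist := hsep r hr q hq
  rw [min_eq_left hidx] at hdist
  lia

/-- Moving the first site within a neighbourhood of the smaller contour `γ'` that `γ` does not
enter changes the length of a pair cut by `γ` at most by a factor of two. -/
lemma couplingMeasure_rows_singleton_le (hα : 0 ≤ α) (hα₂ : α ≤ 2) (hm : 64 ≤ m)
    (hγ' : Even γ'.card) (hsep : Separated m γ γ') (hidx : scaleIndex m γ' < scaleIndex m γ)
    {w : ℕ} (hw : 16 * w = scale m (scaleIndex m γ' + 1)) {u z : ℤ} (hu : u ∈ inside γ')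
    (huz : u ≤ z) (hz : z < u + w) :
    couplingMeasure α (rows γ {u}) ≤ 4 * couplingMeasure α (rows γ {z}) := by
  have hdiam := (scaleIndex_le_iff (by lia : 16 ≤ m)).1 (le_refl (scaleIndex m γ'))
  have hscale := two_pow_mul_scale_le (k := 5) (by lia : 4 * 5 ≤ m) (scaleIndex m γ')
  obtain ⟨r, hr, r', -, hru, hur, hrr⟩ := exists_mem_le_lt_of_mem_inside hγ' hu
  have hfar (q) (hq : q ∈ γ) : ¬(u - w ≤ q ∧ q ≤ u + w) := by
    have hdist := hsep q hq r hr
    rw [min_eq_right hidx.le] at hdist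
    lia
  have hside : u ∈ inside γ ↔ z ∈ inside γ := by
    by_contra hne
    obtain ⟨q, hq, huq, hqz⟩ := exists_mem_of_not_mem_inside_iff huz hne
    exact hfar q hq ⟨by lia, by lia⟩
  rw [← ENNReal.ofReal_ofNat 4]
  refine couplingMeasure_le_mul_of_injOn (f := fun p => (z, p.2)) (by norm_num) ?_ ?_ ?_
  · rintro ⟨a, v⟩ ⟨hcut, rfl : a = u⟩
    exact ⟨mt hside.trans hcut, rfl⟩
  · rintro p ⟨-, hp⟩ q ⟨-, hq⟩ hpq
    exact Prod.ext (hp.trans hq.symm) (Prod.ext_iff.1 hpq).2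
  · rintro ⟨a, v⟩ ⟨hcut, rfl : a = u⟩
    obtain ⟨q, hq, hqv⟩ := exists_mem_between hcut
    have := hfar q hq
    simp only at hqv
    exact pairCoupling_le_four_mul hα hα₂ (by simp only; lia) (by simp only; lia)

/-- The sites at distance less than `n` to the right of a point of `γ`. -/
def rightNeighbourhood (γ : Finset ℤ) (n : ℕ) : Set ℤ := {z | ∃ q ∈ γ, q ≤ z ∧ z < q + n}

lemma mul_couplingMeasure_rows_singleton_le (hα : 0 ≤ α) (hα₂ : α ≤ 2) (hm : 64 ≤ m)
    (hγ' : Even γ'.card) (hsep : Separated m γ γ') (hidx : scaleIndex m γ' < scaleIndex m γ)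
    {w : ℕ} (hw : 16 * w = scale m (scaleIndex m γ' + 1)) {u : ℤ} (hu : u ∈ inside γ') :
    w * couplingMeasure α (rows γ {u}) ≤
      4 * couplingMeasure α (rows γ (rightNeighbourhood γ' (diam γ' + w))) := by
  have hsub : ↑(Finset.Ico u (u + w)) ⊆ rightNeighbourhood γ' (diam γ' + w) := by
    intro z hz
    obtain ⟨p, hp, q, hq, hpu, huq, hqp⟩ := exists_mem_le_lt_of_mem_inside hγ' hu
    rw [Finset.mem_coe, Finset.mem_Ico] at hz
    exact ⟨p, hp, by lia, by push_cast; lia⟩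
  calc w * couplingMeasure α (rows γ {u})
      = ∑ _z ∈ Finset.Ico u (u + w), couplingMeasure α (rows γ {u}) := by simp
    _ ≤ ∑ z ∈ Finset.Ico u (u + w), 4 * couplingMeasure α (rows γ {z}) :=
        Finset.sum_le_sum fun z hz => by
          rw [Finset.mem_Ico] at hz
          exact couplingMeasure_rows_singleton_le hα hα₂ hm hγ' hsep hidx hw hu hz.1 hz.2
    _ = 4 * couplingMeasure α (rows γ ↑(Finset.Ico u (u + w))) := by
        rw [← Finset.mul_sum, couplingMeasure_rows_coe]
    _ ≤ _ := by
        gcongr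
        exact rows_mono γ hsub

lemma mul_couplingMeasure_rows_inside_le (hα : 0 ≤ α) (hα₂ : α ≤ 2) (hm : 64 ≤ m)
    (hγ' : Even γ'.card) (hsep : Separated m γ γ') (hidx : scaleIndex m γ' < scaleIndex m γ)
    {w : ℕ} (hw : 16 * w = scale m (scaleIndex m γ' + 1)) :
    w * couplingMeasure α (rows γ (inside γ')) ≤ (16 * scale m (scaleIndex m γ') : ℕ) *
      couplingMeasure α (rows γ (rightNeighbourhood γ' (diam γ' + w))) := by
  have hdiam := (scaleIndex_le_iff (by lia : 16 ≤ m)).1 (le_refl (scaleIndex m γ'))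
  obtain ⟨B, hB⟩ := (finite_inside hγ').exists_finset_coe
  have hcard : B.card ≤ diam γ' := by
    rw [← Set.ncard_coe_finset, hB]
    exact ncard_inside_le_diam hγ'
  set U := rightNeighbourhood γ' (diam γ' + w)
  calc w * couplingMeasure α (rows γ (inside γ'))
      = ∑ u ∈ B, w * couplingMeasure α (rows γ {u}) := by
        rw [← hB, couplingMeasure_rows_coe, Finset.mul_sum]
    _ ≤ ∑ _u ∈ B, 4 * couplingMeasure α (rows γ U) := Finset.sum_le_sum fun u hu =>
        mul_couplingMeasure_rows_singleton_le hα hα₂ hm hγ' hsep hidx hw (hB ▸ hu)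
    _ = (B.card * 4 : ℕ) * couplingMeasure α (rows γ U) := by
        rw [Finset.sum_const, nsmul_eq_mul, ← mul_assoc]
        push_cast
        rfl
    _ ≤ _ := mul_le_mul_left (Nat.cast_le.2 (by lia)) _

end Nested

section NestedFamily

variable {α : ℝ} {m : ℕ} {S γ : Finset ℤ} {P : Finset (Finset ℤ)}

lemma pairwiseDisjoint_rightNeighbourhood (hm : 64 ≤ m) (hP : IsContourFamily m S P) {j w : ℕ}
    (hw : 16 * w = scale m (j + 1)) :
    (P.filter (scaleIndex m · = j) : Set (Finset ℤ)).PairwiseDisjoint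
      fun γ' => rightNeighbourhood γ' (diam γ' + w) := by
  intro γ₁ h₁ γ₂ h₂ hne
  obtain ⟨hP₁, hj₁⟩ := Finset.mem_filter.1 h₁
  obtain ⟨hP₂, hj₂⟩ := Finset.mem_filter.1 h₂
  have hdiam₁ := (scaleIndex_le_iff (by lia : 16 ≤ m)).1 hj₁.le
  have hdiam₂ := (scaleIndex_le_iff (by lia : 16 ≤ m)).1 hj₂.le
  have hscale := two_pow_mul_scale_le (k := 5) (by lia : 4 * 5 ≤ m) j
  refine Set.disjoint_left.2 ?_
  rintro z ⟨q₁, hq₁, hle₁, hlt₁⟩ ⟨q₂, hq₂, hle₂, hlt₂⟩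
  have hdist := hP.separated hP₁ hP₂ hne q₁ hq₁ q₂ hq₂
  rw [hj₁, hj₂, min_self] at hdist
  push_cast at hlt₁ hlt₂
  lia

lemma exists_sixteen_mul_eq_scale (hm : 64 ≤ m) (j : ℕ) :
    ∃ w, 16 * w = scale m j ∧ 0 < w := by
  have := le_scaleExp m j
  refine ⟨2 ^ (scaleExp m j - 4), ?_, Nat.two_pow_pos _⟩
  rw [scale, show (16 : ℕ) = 2 ^ 4 by norm_num, ← pow_add]
  congr 1
  lia

lemma sixteen_mul_scale_eq {j w : ℕ} (hw : 16 * w = scale m (j + 1)) :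
    ((16 * scale m j : ℕ) : ℝ≥0∞) = w * (256 * 2⁻¹ ^ (scaleExp m j / 4)) := by
  set k := scaleExp m j / 4
  have hnat : 16 * scale m j * 2 ^ k = w * 256 := by
    rw [scale_succ] at hw
    linarith
  have hcast : ((16 * scale m j : ℕ) : ℝ≥0∞) * 2 ^ k = w * 256 := by exact_mod_cast hnat
  calc ((16 * scale m j : ℕ) : ℝ≥0∞) = (16 * scale m j : ℕ) * (2 ^ k * 2⁻¹ ^ k) := by
        rw [← mul_pow, ENNReal.mul_inv_cancel two_ne_zero ENNReal.ofNat_ne_top, one_pow, mul_one]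
    _ = _ := by rw [← mul_assoc, hcast, mul_assoc]

lemma sum_couplingMeasure_rows_inside_le (hα : 0 ≤ α) (hα₂ : α ≤ 2) (hm : 64 ≤ m)
    (hP : IsContourFamily m S P) (hγ : γ ∈ P) {j : ℕ} (hj : j < scaleIndex m γ) :
    ∑ γ' ∈ P.filter (scaleIndex m · = j), couplingMeasure α (rows γ (inside γ')) ≤
      256 * 2⁻¹ ^ (scaleExp m j / 4) * couplingMeasure α (cut (inside γ)) := by
  obtain ⟨w, hw, hw₀⟩ := exists_sixteen_mul_eq_scale hm (j + 1)
  set s := P.filter (scaleIndex m · = j)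
  set U : Finset ℤ → Set ℤ := fun γ' => rightNeighbourhood γ' (diam γ' + w)
  have hmul (γ') (hγ' : γ' ∈ s) : w * couplingMeasure α (rows γ (inside γ')) ≤
      (16 * scale m j : ℕ) * couplingMeasure α (rows γ (U γ')) := by
    obtain ⟨hmem, rfl⟩ := Finset.mem_filter.1 hγ'
    have hne : γ ≠ γ' := by rintro rfl; exact hj.false
    exact mul_couplingMeasure_rows_inside_le hα hα₂ hm (hP.even γ' hmem)
      (hP.separated hγ hmem hne) hj hw
  have hsum : w * ∑ γ' ∈ s, couplingMeasure α (rows γ (inside γ')) ≤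
      w * (256 * 2⁻¹ ^ (scaleExp m j / 4) * couplingMeasure α (cut (inside γ))) :=
    calc w * ∑ γ' ∈ s, couplingMeasure α (rows γ (inside γ'))
        ≤ (16 * scale m j : ℕ) * ∑ γ' ∈ s, couplingMeasure α (rows γ (U γ')) := by
          simp only [Finset.mul_sum]
          exact Finset.sum_le_sum hmul
      _ ≤ (16 * scale m j : ℕ) * couplingMeasure α (cut (inside γ)) := by
          gcongr
          exact sum_couplingMeasure_le α
            (pairwiseDisjoint_rows γ (pairwiseDisjoint_rightNeighbourhood hm hP hw))
            fun γ' _ => rows_subset_cut γ _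
      _ = _ := by rw [sixteen_mul_scale_eq hw, mul_assoc]
  exact (ENNReal.mul_le_mul_iff_right (Nat.cast_ne_zero.2 hw₀.ne') (ENNReal.natCast_ne_top _)).1
    hsum

/-- The pairs cut by `γ` whose first site lies inside a contour of smaller scale. -/
def nestedRows (m : ℕ) (P : Finset (Finset ℤ)) (γ : Finset ℤ) : Set (ℤ × ℤ) :=
  ⋃ γ' ∈ P.filter (scaleIndex m · < scaleIndex m γ), rows γ (inside γ')

lemma couplingMeasure_nestedRows_le (hα : 0 ≤ α) (hα₂ : α ≤ 2) (hm : 64 ≤ m)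
    (hP : IsContourFamily m S P) (hγ : γ ∈ P) :
    couplingMeasure α (nestedRows m P γ) ≤
      512 * 2⁻¹ ^ (m / 4) * couplingMeasure α (cut (inside γ)) := by
  set K := scaleIndex m γ
  set c := 256 * 2⁻¹ ^ (m / 4) * couplingMeasure α (cut (inside γ))
  have hscale (j) (hj : j ∈ Finset.range K) :
      ∑ γ' ∈ P.filter (scaleIndex m · < K) with scaleIndex m γ' = j,
        couplingMeasure α (rows γ (inside γ')) ≤ c * 2⁻¹ ^ j := by
    have hle := add_le_scaleExp (by lia : 16 ≤ m) j
    rw [Finset.mem_range] at hj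
    have hfilter : (P.filter (scaleIndex m · < K)).filter (scaleIndex m · = j) =
        P.filter (scaleIndex m · = j) := by
      rw [Finset.filter_filter]
      exact Finset.filter_congr fun γ' _ => by lia
    rw [hfilter]
    calc _ ≤ 256 * 2⁻¹ ^ (scaleExp m j / 4) * couplingMeasure α (cut (inside γ)) :=
          sum_couplingMeasure_rows_inside_le hα hα₂ hm hP hγ hj
      _ ≤ 256 * 2⁻¹ ^ (m / 4 + j) * couplingMeasure α (cut (inside γ)) := by
          gcongr 256 * ?_ * _
          exact pow_le_pow_right_of_le_one' (by simp) (by lia : m / 4 + j ≤ scaleExp m j / 4)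
      _ = c * 2⁻¹ ^ j := by rw [pow_add]; ring
  have hgeom : ∑ j ∈ Finset.range K, (2⁻¹ : ℝ≥0∞) ^ j ≤ 2 :=
    (ENNReal.sum_le_tsum _).trans_eq
      (by rw [ENNReal.tsum_geometric, ENNReal.one_sub_inv_two, inv_inv])
  calc couplingMeasure α (nestedRows m P γ)
      ≤ ∑ γ' ∈ P.filter (scaleIndex m · < K), couplingMeasure α (rows γ (inside γ')) :=
        measure_biUnion_finset_le _ _
    _ = ∑ j ∈ Finset.range K, ∑ γ' ∈ P.filter (scaleIndex m · < K) with scaleIndex m γ' = j,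
          couplingMeasure α (rows γ (inside γ')) :=
        (Finset.sum_fiberwise_of_maps_to
          (fun γ' hγ' => Finset.mem_range.2 (Finset.mem_filter.1 hγ').2) _).symm
    _ ≤ ∑ j ∈ Finset.range K, c * 2⁻¹ ^ j := Finset.sum_le_sum hscale
    _ ≤ c * 2 := by rw [← Finset.mul_sum]; gcongr
    _ = _ := by ring

/-- The pairs cut by `γ` that lie on the same side of the whole boundary. -/
def sameSide (S γ : Finset ℤ) : Set (ℤ × ℤ) :=
  {p | p ∈ cut (inside γ) ∧ p ∉ cut (inside S)}

/-- A pair on the same side of the whole boundary is cut by a second contour. If that contour is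
larger then the pair is long, otherwise one of its sites lies inside a smaller contour. -/
lemma sameSide_subset (hm : 64 ≤ m) (hP : IsContourFamily m S P) (hγ : γ ∈ P) {R : ℕ}
    (hR : 8 * R ≤ scale m (scaleIndex m γ + 1)) :
    sameSide S γ ⊆ {p | p ∈ cut (inside γ) ∧ R ≤ (p.1 - p.2).natAbs} ∪
      (nestedRows m P γ ∪ Prod.swap ⁻¹' nestedRows m P γ) := by
  rintro p ⟨hp, hpS⟩
  obtain ⟨γ', hγ', hne, hsep⟩ := hP.exists_ne_not_mem_inside_iff hγ (not_not.1 hpS) hp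
  obtain hidx | hidx := le_or_gt (scaleIndex m γ) (scaleIndex m γ')
  · have hlong := scale_le_of_mem_cut_of_mem_cut hm (hP.even γ hγ)
      (hP.separated hγ hγ' hne.symm) hidx hp hsep
    exact Or.inl ⟨hp, by lia⟩
  · have hmem : γ' ∈ P.filter (scaleIndex m · < scaleIndex m γ) :=
      Finset.mem_filter.2 ⟨hγ', hidx⟩
    obtain h | h := mem_or_mem_of_mem_cut hsep
    · exact Or.inr (Or.inl (Set.mem_biUnion hmem ⟨hp, h⟩))
    · exact Or.inr (Or.inr (Set.mem_biUnion hmem ⟨mt Iff.symm hp, h⟩))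

/-- A bound for the proportion of the pairs cut by a contour that other contours cut as well. The
first term accounts for the long pairs, the second one for the contours of smaller scale. -/
noncomputable def nestingLoss (α : ℝ) (m : ℕ) : ℝ≥0∞ :=
  4 * ENNReal.ofReal (((2 ^ (m / 4 - 5) : ℕ) : ℝ) ^ (1 - α)) + 1024 * 2⁻¹ ^ (m / 4)

lemma couplingMeasure_sameSide_le (hα : 0 ≤ α) (hα₂ : α ≤ 2) (hm : 64 ≤ m)
    (hP : IsContourFamily m S P) (hγ : γ ∈ P) :
    couplingMeasure α (sameSide S γ) ≤ nestingLoss α m * couplingMeasure α (cut (inside γ)) := by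
  set D := 4 * scale m (scaleIndex m γ)
  set N := 2 ^ (m / 4 - 5)
  have hD : 0 < D := Nat.mul_pos four_pos (scale_pos m _)
  have hdiam : diam γ ≤ D := (scaleIndex_le_iff (by lia : 16 ≤ m)).1 le_rfl
  have hND : 8 * (N * D) ≤ scale m (scaleIndex m γ + 1) :=
    calc 8 * (N * D) = 2 ^ (m / 4 - 5 + 5) * scale m (scaleIndex m γ) := by rw [pow_add]; ring
      _ = 2 ^ (m / 4) * scale m (scaleIndex m γ) := by congr 2; lia
      _ ≤ _ := two_pow_mul_scale_le (by lia) _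
  have hfar := couplingMeasure_cut_far_le hα (hP.even γ hγ) (Nat.two_pow_pos (m / 4 - 5)) hD hdiam
  have hnested := couplingMeasure_nestedRows_le hα hα₂ hm hP hγ
  calc couplingMeasure α (sameSide S γ)
      ≤ couplingMeasure α {p | p ∈ cut (inside γ) ∧ N * D ≤ (p.1 - p.2).natAbs} +
        (couplingMeasure α (nestedRows m P γ) + couplingMeasure α (nestedRows m P γ)) := by
        refine (measure_mono (sameSide_subset hm hP hγ hND)).trans ((measure_union_le _ _).trans ?_)
        gcongr
        refine (measure_union_le _ _).trans_eq ?_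
        rw [couplingMeasure_preimage_swap]
    _ ≤ _ := (add_le_add hfar (add_le_add hnested hnested)).trans_eq (by rw [nestingLoss]; ring)

end NestedFamily

lemma exists_nestingLoss_le {α ε : ℝ} (hα : 1 < α) (hε : 0 < ε) :
    ∃ m, 64 ≤ m ∧ nestingLoss α m ≤ ENNReal.ofReal ε := by
  have hrpow : Tendsto (fun n : ℕ => ENNReal.ofReal (((2 ^ n : ℕ) : ℝ) ^ (1 - α))) atTop (𝓝 0) := by
    have := (tendsto_rpow_neg_atTop (sub_pos.2 hα)).comp
      (tendsto_pow_atTop_atTop_of_one_lt (one_lt_two (α := ℝ)))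
    simpa [Function.comp_def] using ENNReal.tendsto_ofReal this
  have hpow : Tendsto (fun n : ℕ => (2⁻¹ : ℝ≥0∞) ^ (n + 5)) atTop (𝓝 0) :=
    (ENNReal.tendsto_pow_atTop_nhds_zero_of_lt_one (by simp)).comp (tendsto_add_atTop_nat 5)
  have hlim : Tendsto (fun n => nestingLoss α (4 * (n + 5))) atTop (𝓝 0) := by
    have := (ENNReal.Tendsto.const_mul (a := 4) hrpow (Or.inr (by simp))).add
      (ENNReal.Tendsto.const_mul (a := 1024) hpow (Or.inr (by simp)))
    simp only [mul_zero, add_zero] at this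
    refine this.congr fun n => ?_
    rw [nestingLoss, Nat.mul_div_cancel_left _ four_pos, Nat.add_sub_cancel]
  obtain ⟨n, hn, hn16⟩ :=
    ((hlim.eventually_le_const (ENNReal.ofReal_pos.2 hε)).and (eventually_ge_atTop 16)).exists
  exact ⟨4 * (n + 5), by lia, hn⟩

/-! ### Counting contours -/

section Counting

lemma blockCount_succ (γ : Finset ℤ) (K : ℕ) :
    blockCount γ (K + 1) = γ.card + blockCount (γ.image fun p => p / 2) K := by
  rw [blockCount, Finset.sum_range_succ', add_comm]
  congr 1
  · simp
  · refine Finset.sum_congr rfl fun k _ => ?_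
    rw [Finset.image_image]
    congr 1
    refine Finset.image_congr fun p _ => ?_
    rw [Function.comp_apply, Int.ediv_ediv_of_nonneg zero_le_two, pow_succ']

lemma le_blockCount {γ : Finset ℤ} (hγ : γ.Nonempty) (K : ℕ) : K ≤ blockCount γ K := by
  calc K = ∑ k ∈ Finset.range K, 1 := by simp
    _ ≤ blockCount γ K := Finset.sum_le_sum fun k _ =>
        Finset.card_pos.2 (hγ.image fun p => p / 2 ^ k)

lemma card_filter_image_half_eq_le (s : Finset (Finset ℤ)) (δ : Finset ℤ) :
    (s.filter fun γ => (γ.image fun p => p / 2) = δ).card ≤ 4 ^ δ.card := by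
  set C := δ.image (fun d => 2 * d) ∪ δ.image (fun d => 2 * d + 1) with hC
  have hcard : C.card ≤ 2 * δ.card := by
    refine (Finset.card_union_le _ _).trans ?_
    rw [two_mul]
    exact add_le_add Finset.card_image_le Finset.card_image_le
  have hsub : (s.filter fun γ => (γ.image fun p => p / 2) = δ) ⊆ C.powerset := by
    intro γ hγ
    obtain ⟨-, rfl⟩ := Finset.mem_filter.1 hγ
    refine Finset.mem_powerset.2 fun p hp => ?_
    have hhalf := Finset.mem_image_of_mem (fun p => p / 2) hp
    rw [hC, Finset.mem_union, Finset.mem_image, Finset.mem_image]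
    obtain hmod | hmod := Int.emod_two_eq_zero_or_one p
    · exact Or.inl ⟨_, hhalf, by lia⟩
    · exact Or.inr ⟨_, hhalf, by lia⟩
  calc (s.filter fun γ => (γ.image fun p => p / 2) = δ).card ≤ C.powerset.card :=
        Finset.card_le_card hsub
    _ = 2 ^ C.card := Finset.card_powerset C
    _ ≤ 2 ^ (2 * δ.card) := Nat.pow_le_pow_right two_pos hcard
    _ = 4 ^ δ.card := by rw [pow_mul]; norm_num

lemma sum_quarter_pow_card_le_one (s : Finset (Finset ℤ)) (δ : Finset ℤ) :
    ∑ γ ∈ s with (γ.image fun p => p / 2) = δ, (1 / 4 : ℝ) ^ γ.card ≤ 1 := by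
  have hterm (γ) (hγ : γ ∈ s.filter fun γ => (γ.image fun p => p / 2) = δ) :
      (1 / 4 : ℝ) ^ γ.card ≤ (1 / 4) ^ δ.card := by
    obtain ⟨-, rfl⟩ := Finset.mem_filter.1 hγ
    exact pow_le_pow_of_le_one (by norm_num) (by norm_num) Finset.card_image_le
  calc _ ≤ (s.filter fun γ => (γ.image fun p => p / 2) = δ).card • (1 / 4 : ℝ) ^ δ.card :=
        Finset.sum_le_card_nsmul _ _ _ hterm
    _ ≤ ((4 ^ δ.card : ℕ) : ℝ) * (1 / 4) ^ δ.card := by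
        rw [nsmul_eq_mul]
        gcongr
        exact card_filter_image_half_eq_le s δ
    _ = 1 := by
        push_cast
        rw [← mul_pow]
        norm_num

lemma image_half_mem_powerset {γ : Finset ℤ} {K : ℕ}
    (hγ : γ ∈ (Finset.Ico (-2 ^ (K + 1) : ℤ) (2 ^ (K + 1))).powerset) :
    (γ.image fun p => p / 2) ∈ (Finset.Ico (-2 ^ K : ℤ) (2 ^ K)).powerset := by
  rw [Finset.mem_powerset] at hγ ⊢
  intro b hb
  obtain ⟨p, hp, rfl⟩ := Finset.mem_image.1 hb
  have hmem := Finset.mem_Ico.1 (hγ hp)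
  rw [pow_succ] at hmem
  rw [Finset.mem_Ico]
  lia

lemma sum_quarter_pow_blockCount_le (K : ℕ) :
    ∑ γ ∈ (Finset.Ico (-2 ^ K : ℤ) (2 ^ K)).powerset, (1 / 4 : ℝ) ^ blockCount γ K ≤ 4 := by
  induction K with
  | zero =>
    simp only [blockCount, Finset.range_zero, Finset.sum_empty, pow_zero, Finset.sum_const,
      Finset.card_powerset, Int.card_Ico]
    norm_num [show Int.toNat 2 = 2 from rfl]
  | succ K ih =>
    rw [← Finset.sum_fiberwise_of_maps_to fun γ hγ => image_half_mem_powerset hγ]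
    refine (Finset.sum_le_sum fun δ _ => ?_).trans ih
    calc _ = (∑ γ ∈ (Finset.Ico (-2 ^ (K + 1) : ℤ) (2 ^ (K + 1))).powerset with
            (γ.image fun p => p / 2) = δ, (1 / 4 : ℝ) ^ γ.card) * (1 / 4) ^ blockCount δ K := by
          rw [Finset.sum_mul]
          refine Finset.sum_congr rfl fun γ hγ => ?_
          rw [blockCount_succ, (Finset.mem_filter.1 hγ).2, pow_add]
      _ ≤ (1 / 4) ^ blockCount δ K :=
          mul_le_of_le_one_left (by positivity) (sum_quarter_pow_card_le_one _ δ)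

lemma sum_pow_blockCount_le_of_subset {G : Finset (Finset ℤ)} {k : ℕ}
    (hne : ∀ γ ∈ G, γ.Nonempty) (hsub : ∀ γ ∈ G, γ ⊆ Finset.Ico (-2 ^ k : ℤ) (2 ^ k)) :
    ∑ γ ∈ G, (1 / 68 : ℝ) ^ blockCount γ k ≤ 4 * (1 / 17) ^ k := by
  have hterm (γ) (hγ : γ ∈ G) :
      (1 / 68 : ℝ) ^ blockCount γ k ≤ (1 / 17) ^ k * (1 / 4) ^ blockCount γ k := by
    rw [show (1 / 68 : ℝ) = 1 / 17 * (1 / 4) by norm_num, mul_pow]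
    gcongr ?_ * _
    exact pow_le_pow_of_le_one (by norm_num) (by norm_num) (le_blockCount (hne γ hγ) k)
  calc ∑ γ ∈ G, (1 / 68 : ℝ) ^ blockCount γ k
      ≤ (1 / 17) ^ k * ∑ γ ∈ G, (1 / 4 : ℝ) ^ blockCount γ k := by
        rw [Finset.mul_sum]
        exact Finset.sum_le_sum hterm
    _ ≤ (1 / 17) ^ k *
          ∑ γ ∈ (Finset.Ico (-2 ^ k : ℤ) (2 ^ k)).powerset, (1 / 4 : ℝ) ^ blockCount γ k := by
        gcongr
        exact fun γ hγ => Finset.mem_powerset.2 (hsub γ hγ)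
    _ ≤ (1 / 17) ^ k * 4 := by
        gcongr
        exact sum_quarter_pow_blockCount_le k
    _ = _ := mul_comm _ _

lemma sum_pow_blockCount_le {G : Finset (Finset ℤ)} {κ : Finset ℤ → ℕ}
    (hne : ∀ γ ∈ G, γ.Nonempty) (hκ : ∀ γ ∈ G, 1 ≤ κ γ)
    (hsub : ∀ γ ∈ G, γ ⊆ Finset.Ico (-2 ^ κ γ : ℤ) (2 ^ κ γ)) :
    ∑ γ ∈ G, (1 / 68 : ℝ) ^ blockCount γ (κ γ) ≤ 1 / 4 := by
  have hfiber (k : ℕ) :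
      ∑ γ ∈ G with κ γ = k, (1 / 68 : ℝ) ^ blockCount γ (κ γ) ≤ 4 * (1 / 17) ^ k := by
    rw [Finset.sum_congr rfl fun γ hγ => by rw [(Finset.mem_filter.1 hγ).2]]
    refine sum_pow_blockCount_le_of_subset (fun γ hγ => hne γ (Finset.mem_filter.1 hγ).1)
      fun γ hγ => ?_
    obtain ⟨hG, rfl⟩ := Finset.mem_filter.1 hγ
    exact hsub γ hG
  have hmem (γ) (hγ : γ ∈ G) : κ γ ∈ Finset.Ico 1 (G.sup κ + 1) :=
    Finset.mem_Ico.2 ⟨hκ γ hγ, Nat.lt_succ_of_le (Finset.le_sup hγ)⟩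
  have hgeom : HasSum (fun n : ℕ => 4 / 17 * (1 / 17 : ℝ) ^ n) (1 / 4) := by
    have := (hasSum_geometric_of_lt_one (r := (1 / 17 : ℝ)) (by norm_num) (by norm_num)).mul_left
      (4 / 17)
    rwa [show 4 / 17 * (1 - 1 / 17 : ℝ)⁻¹ = 1 / 4 by norm_num] at this
  calc ∑ γ ∈ G, (1 / 68 : ℝ) ^ blockCount γ (κ γ)
      = ∑ k ∈ Finset.Ico 1 (G.sup κ + 1),
          ∑ γ ∈ G with κ γ = k, (1 / 68 : ℝ) ^ blockCount γ (κ γ) :=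
        (Finset.sum_fiberwise_of_maps_to hmem _).symm
    _ ≤ ∑ k ∈ Finset.Ico 1 (G.sup κ + 1), 4 * (1 / 17 : ℝ) ^ k :=
        Finset.sum_le_sum fun k _ => hfiber k
    _ = ∑ n ∈ Finset.range (G.sup κ), 4 / 17 * (1 / 17 : ℝ) ^ n := by
        rw [Finset.sum_Ico_eq_sum_range, Nat.add_sub_cancel]
        exact Finset.sum_congr rfl fun n _ => by rw [pow_add]; ring
    _ ≤ 1 / 4 := sum_le_hasSum _ (fun n _ => by positivity) hgeom

lemma subset_Ico_of_zero_mem_inside {m : ℕ} (hm : 16 ≤ m) {γ : Finset ℤ} (hγ : Even γ.card)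
    (h0 : 0 ∈ inside γ) :
    γ ⊆ Finset.Ico (-2 ^ (scaleExp m (scaleIndex m γ) + 3))
      (2 ^ (scaleExp m (scaleIndex m γ) + 3)) := by
  intro p hp
  have hdiam := (scaleIndex_le_iff hm).1 (le_refl (scaleIndex m γ))
  have hpos := scale_pos m (scaleIndex m γ)
  obtain ⟨q, hq, q', hq', hq0, h0q', -⟩ := exists_mem_le_lt_of_mem_inside hγ h0
  have hpq := natAbs_sub_le_diam hp hq
  have hpq' := natAbs_sub_le_diam hp hq'
  have hscale : (2 : ℤ) ^ (scaleExp m (scaleIndex m γ) + 3) = 8 * scale m (scaleIndex m γ) := by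
    rw [scale]
    push_cast
    ring
  rw [Finset.mem_Ico, hscale]
  lia

end Counting

/-! ### The isoperimetric inequality -/

lemma couplingMeasure_le_card_mul {α c : ℝ} {F : Finset (ℤ × ℤ)}
    (hF : ∀ p ∈ F, pairCoupling α p ≤ c) :
    couplingMeasure α F ≤ F.card * ENNReal.ofReal c := by
  rw [← sum_measure_singleton, ← nsmul_eq_mul]
  refine Finset.sum_le_card_nsmul _ _ _ fun p hp => ?_
  rw [couplingMeasure_singleton]
  exact ENNReal.ofReal_le_ofReal (hF p hp)

lemma couplingMeasure_eq_two_mul {α : ℝ} {S : Set (ℤ × ℤ)} (hS : Prod.swap ⁻¹' S = S) :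
    couplingMeasure α S = 2 * couplingMeasure α {p | p ∈ S ∧ p.1 < p.2} := by
  set U := {p | p ∈ S ∧ p.1 < p.2}
  have hswap (p : ℤ × ℤ) : p.swap ∈ S ↔ p ∈ S := by
    rw [← Set.mem_preimage, hS]
  have hsplit :
      couplingMeasure α S = couplingMeasure α U + couplingMeasure α (Prod.swap ⁻¹' U) := by
    simp only [couplingMeasure_apply, ← ENNReal.tsum_add]
    refine tsum_congr fun p => ?_
    by_cases hp : p ∈ S
    · obtain h | h | h := lt_trichotomy p.1 p.2
      · simp [U, hswap, hp, h, h.not_gt]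
      · simp [U, hp, h, pairCoupling, coupling]
      · simp [U, hswap, hp, h, h.not_gt]
    · simp [U, hswap, hp]
  rw [hsplit, couplingMeasure_preimage_swap, two_mul]

section Isoperimetry

variable {α : ℝ}

lemma rpow_sub_rpow_le_coupling (hα₂ : α ≤ 2) {r : ℕ} (hr : 0 < r) :
    (r : ℝ) ^ (1 - α) - ((r + 1 : ℕ) : ℝ) ^ (1 - α) ≤ coupling α r := by
  have hr' : (0 : ℝ) < r := by exact_mod_cast hr
  have hfactor : ((r + 1 : ℕ) : ℝ) ^ (1 - α) = (r : ℝ) ^ (1 - α) * (1 + 1 / r) ^ (1 - α) := by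
    rw [← Real.mul_rpow hr'.le (by positivity), mul_add, mul_one_div_cancel hr'.ne', mul_one]
    push_cast
    rfl
  have hcoupling : coupling α r = (r : ℝ) ^ (1 - α) * (1 / r) := by
    rw [coupling, if_neg hr.ne', sub_eq_neg_add, Real.rpow_add hr', Real.rpow_one, mul_assoc,
      mul_one_div_cancel hr'.ne', mul_one]
  have hratio : 1 - 1 / (r : ℝ) ≤ (1 + 1 / r) ^ (1 - α) :=
    calc 1 - 1 / (r : ℝ) ≤ (1 + 1 / (r : ℝ))⁻¹ := by
          rw [← one_div, le_div_iff₀ (by positivity)]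
          nlinarith [sq_nonneg (1 / (r : ℝ))]
      _ = (1 + 1 / (r : ℝ)) ^ (-1 : ℝ) := (Real.rpow_neg_one _).symm
      _ ≤ _ := Real.rpow_le_rpow_of_exponent_le (le_add_of_nonneg_right (by positivity))
          (by linarith)
  rw [hfactor, hcoupling]
  have := mul_le_mul_of_nonneg_left hratio (Real.rpow_nonneg hr'.le (1 - α))
  linarith

lemma ofReal_rpow_le_couplingMeasure_halfRow (hα : 1 < α) (hα₂ : α ≤ 2) (x : ℤ) {n : ℕ}
    (hn : 0 < n) : ENNReal.ofReal ((n : ℝ) ^ (1 - α)) ≤ couplingMeasure α (halfRow x n) := by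
  set f : ℕ → ℝ := fun k => ((n + k : ℕ) : ℝ) ^ (1 - α)
  have hlim : Tendsto (fun M => ENNReal.ofReal (f 0 - f M)) atTop
      (𝓝 (ENNReal.ofReal (f 0 - 0))) := by
    refine ENNReal.tendsto_ofReal (tendsto_const_nhds.sub ?_)
    have := (tendsto_rpow_neg_atTop (sub_pos.2 hα)).comp
      ((tendsto_natCast_atTop_atTop (R := ℝ)).comp (tendsto_add_atTop_nat n))
    simpa [Function.comp_def, f, add_comm] using this
  rw [sub_zero] at hlim
  refine le_of_tendsto' hlim fun M => ?_
  set g : ℕ → ℤ × ℤ := fun k => (x, x + (n + k : ℕ))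
  have hg : Function.Injective g := fun i j hij => by simpa [g] using hij
  calc ENNReal.ofReal (f 0 - f M)
      = ENNReal.ofReal (∑ k ∈ Finset.range M, (f k - f (k + 1))) := by
        rw [Finset.sum_range_sub']
    _ ≤ ENNReal.ofReal (∑ k ∈ Finset.range M, coupling α (n + k)) :=
        ENNReal.ofReal_le_ofReal (Finset.sum_le_sum fun k _ =>
          rpow_sub_rpow_le_coupling hα₂ (by lia))
    _ = ∑ k ∈ Finset.range M, couplingMeasure α {g k} := by
        rw [ENNReal.ofReal_sum_of_nonneg fun _ _ => coupling_nonneg _ _]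
        refine Finset.sum_congr rfl fun k _ => ?_
        rw [couplingMeasure_singleton, pairCoupling]
        congr 2
        simp only [g]
        lia
    _ ≤ couplingMeasure α (halfRow x n) := by
        refine sum_couplingMeasure_le α (fun i _ j _ hij =>
          Set.disjoint_singleton.2 (hg.ne hij)) fun k _ => ?_
        rw [Set.singleton_subset_iff]
        exact ⟨rfl, by simp only [g]; lia⟩

lemma card_filter_lt_le_card_Ioc_sdiff (B : Finset ℤ) (a : ℤ) :
    (B.filter (a + B.card < ·)).card ≤ (Finset.Ioc a (a + B.card) \ B).card := by
  have hdisj : Disjoint (B.filter (a + B.card < ·)) (Finset.Ioc a (a + B.card) ∩ B) := by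
    refine Finset.disjoint_left.2 fun x hx hx' => ?_
    have h₁ := (Finset.mem_filter.1 hx).2
    have h₂ := (Finset.mem_Ioc.1 (Finset.mem_inter.1 hx').1).2
    lia
  have hle := Finset.card_le_card (Finset.union_subset (Finset.filter_subset (a + B.card < ·) B)
    (Finset.inter_subset_right (s₁ := Finset.Ioc a (a + B.card))))
  rw [Finset.card_union_of_disjoint hdisj] at hle
  have hsplit := Finset.card_sdiff_add_card_inter (Finset.Ioc a (a + B.card)) B
  rw [Int.card_Ioc] at hsplit
  lia

/-- The sites of `B` beyond the first `B.card` sites to the right of `a` are at most as many as the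
sites outside `B` among those first ones, which are closer to `a`. -/
lemma couplingMeasure_filter_lt_le (hα : 0 ≤ α) (B : Finset ℤ) (a : ℤ) :
    couplingMeasure α ↑({a} ×ˢ B.filter (a + B.card < ·)) ≤
      couplingMeasure α ↑({a} ×ˢ (Finset.Ioc a (a + B.card) \ B)) := by
  set far := {a} ×ˢ B.filter (a + B.card < ·)
  set near := {a} ×ˢ (Finset.Ioc a (a + B.card) \ B)
  have hcard : far.card ≤ near.card := by
    rw [Finset.card_product, Finset.card_product]
    exact Nat.mul_le_mul_left _ (card_filter_lt_le_card_Ioc_sdiff B a)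
  calc couplingMeasure α far ≤ far.card * ENNReal.ofReal (coupling α (B.card + 1)) := by
        refine couplingMeasure_le_card_mul fun p hp => coupling_anti hα (Nat.succ_pos _) ?_
        simp only [far, Finset.mem_product, Finset.mem_singleton, Finset.mem_filter] at hp
        lia
    _ ≤ near.card * ENNReal.ofReal (coupling α (B.card + 1)) := by gcongr
    _ ≤ couplingMeasure α near := by
        refine card_mul_le_couplingMeasure fun p hp => coupling_anti hα ?_ ?_ <;>
        · simp only [near, Finset.mem_product, Finset.mem_singleton, Finset.mem_sdiff,
            Finset.mem_Ioc] at hp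
          lia

lemma couplingMeasure_halfRow_le (hα : 0 ≤ α) (B : Finset ℤ) (a : ℤ) :
    couplingMeasure α (halfRow a (B.card + 1)) ≤
      couplingMeasure α {p | p.1 = a ∧ p.2 ∉ B ∧ p.1 < p.2} := by
  set far := {a} ×ˢ B.filter (a + B.card < ·)
  set near := {a} ×ˢ (Finset.Ioc a (a + B.card) \ B)
  set free := {p | p ∈ halfRow a (B.card + 1) ∧ p.2 ∉ B}
  calc couplingMeasure α (halfRow a (B.card + 1))
      ≤ couplingMeasure α far + couplingMeasure α free := by
        refine (measure_mono fun p hp => ?_).trans (measure_union_le _ _)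
        by_cases hB : p.2 ∈ B
        · refine Or.inl (Finset.mem_product.2 ⟨Finset.mem_singleton.2 hp.1,
            Finset.mem_filter.2 ⟨hB, ?_⟩⟩)
          have := hp.2
          lia
        · exact Or.inr ⟨hp, hB⟩
    _ ≤ couplingMeasure α near + couplingMeasure α free :=
        add_le_add (couplingMeasure_filter_lt_le hα B a) le_rfl
    _ = couplingMeasure α (near ∪ free) := by
        refine (measure_union (Set.disjoint_left.2 fun p hp hp' => ?_)
          (Set.to_countable _).measurableSet).symm
        have h₁ := (Finset.mem_Ioc.1 (Finset.mem_sdiff.1 (Finset.mem_product.1 hp).2).1).2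
        have h₂ := hp'.1.2
        lia
    _ ≤ _ := by
        refine measure_mono (Set.union_subset (fun p hp => ?_) fun p hp => ?_)
        · obtain ⟨h₁, h₂⟩ := Finset.mem_product.1 hp
          obtain ⟨h₃, h₄⟩ := Finset.mem_sdiff.1 h₂
          have h₅ := Finset.mem_singleton.1 h₁
          exact ⟨h₅, h₄, h₅ ▸ (Finset.mem_Ioc.1 h₃).1⟩
        · have h₁ := hp.1.1
          have h₂ := hp.1.2
          exact ⟨h₁, hp.2, by lia⟩

/-- The pairs cut by `B` whose first site belongs to `B` and lies to the left of the second one. -/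
def rightCut (B : Finset ℤ) : Set (ℤ × ℤ) := {p | p.1 ∈ B ∧ p.2 ∉ B ∧ p.1 < p.2}

lemma sum_rpow_le_couplingMeasure_rightCut (hα : 1 < α) (hα₂ : α ≤ 2) (B : Finset ℤ) :
    ∑ n ∈ Finset.range B.card, ENNReal.ofReal (((n + 1 : ℕ) : ℝ) ^ (1 - α)) ≤
      couplingMeasure α (rightCut B) := by
  induction B using Finset.induction_on_min with
  | empty => simp
  | insert a B ha ih =>
    have haB : a ∉ B := fun h => lt_irrefl _ (ha a h)
    set row := {p : ℤ × ℤ | p.1 = a ∧ p.2 ∉ B ∧ p.1 < p.2}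
    have hdisj : Disjoint (rightCut B) row :=
      Set.disjoint_left.2 fun p hp hp' => haB (hp'.1 ▸ hp.1)
    rw [Finset.card_insert_of_notMem haB, Finset.sum_range_succ]
    calc _ ≤ couplingMeasure α (rightCut B) + couplingMeasure α row :=
          add_le_add ih ((ofReal_rpow_le_couplingMeasure_halfRow hα hα₂ a B.card.succ_pos).trans
            (couplingMeasure_halfRow_le (by linarith) B a))
      _ = couplingMeasure α (rightCut B ∪ row) :=
          (measure_union hdisj (Set.to_countable _).measurableSet).symm
      _ ≤ _ := by
          refine measure_mono (Set.union_subset (fun p hp => ?_) fun p hp => ?_)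
          · have := ha _ hp.1
            have := hp.2.2
            exact ⟨Finset.mem_insert_of_mem hp.1,
              mt (Finset.mem_of_mem_insert_of_ne · (by lia)) hp.2.1, hp.2.2⟩
          · have := hp.1
            have := hp.2.2
            exact ⟨hp.1 ▸ Finset.mem_insert_self _ _,
              mt (Finset.mem_of_mem_insert_of_ne · (by lia)) hp.2.1, hp.2.2⟩

lemma preimage_swap_cut (B : Set ℤ) : Prod.swap ⁻¹' cut B = cut B := by
  ext p
  exact not_congr iff_comm

open scoped Pointwise in
lemma four_mul_sum_rpow_le_couplingMeasure_cut (hα : 1 < α) (hα₂ : α ≤ 2) (B : Finset ℤ) :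
    4 * ∑ n ∈ Finset.range B.card, ENNReal.ofReal (((n + 1 : ℕ) : ℝ) ^ (1 - α)) ≤
      couplingMeasure α (cut (B : Set ℤ)) := by
  set s := ∑ n ∈ Finset.range B.card, ENNReal.ofReal (((n + 1 : ℕ) : ℝ) ^ (1 - α))
  set left := {p : ℤ × ℤ | p.1 ∉ B ∧ p.2 ∈ B ∧ p.1 < p.2}
  have hright : s ≤ couplingMeasure α (rightCut B) :=
    sum_rpow_le_couplingMeasure_rightCut hα hα₂ B
  have hleft : s ≤ couplingMeasure α left := by
    have hneg := sum_rpow_le_couplingMeasure_rightCut hα hα₂ (-B)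
    rw [Finset.card_neg] at hneg
    refine hneg.trans ((couplingMeasure_le_mul_of_injOn (f := fun p => (-p.2, -p.1)) zero_le_one
      ?_ ?_ fun p _ => ?_).trans_eq (by rw [ENNReal.ofReal_one, one_mul]))
    · rintro p ⟨h₁, h₂, h₃⟩
      rw [Finset.mem_neg'] at h₁ h₂
      exact ⟨h₂, h₁, neg_lt_neg h₃⟩
    · intro p _ q _ hpq
      simpa [Prod.ext_iff, and_comm] using hpq
    · rw [one_mul, pairCoupling, pairCoupling, sub_neg_eq_add, neg_add_eq_sub]
  have hdisj : Disjoint (rightCut B) left := Set.disjoint_left.2 fun p hp hp' => hp'.1 hp.1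
  calc 4 * s = 2 * (s + s) := by ring
    _ ≤ 2 * couplingMeasure α (rightCut B ∪ left) := by
        rw [measure_union hdisj (Set.to_countable _).measurableSet]
        gcongr
    _ ≤ 2 * couplingMeasure α {p | p ∈ cut (B : Set ℤ) ∧ p.1 < p.2} := by
        gcongr
        rintro p (⟨h₁, h₂, h₃⟩ | ⟨h₁, h₂, h₃⟩)
        · exact ⟨fun h => h₂ (h.1 h₁), h₃⟩
        · exact ⟨fun h => h₁ (h.2 h₂), h₃⟩
    _ = couplingMeasure α (cut (B : Set ℤ)) :=
        (couplingMeasure_eq_two_mul (preimage_swap_cut _)).symm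

end Isoperimetry

/-! ### The field inside a finite set -/

lemma sum_le_sum_range_card_of_antitone {M : Type*} [AddCommMonoid M] [PartialOrder M]
    [IsOrderedAddMonoid M] {f : ℕ → M} (hf : Antitone f) (S : Finset ℕ) :
    ∑ r ∈ S, f r ≤ ∑ n ∈ Finset.range S.card, f n := by
  induction S using Finset.induction_on_max with
  | empty => simp
  | insert a S ha ih =>
    have haS : a ∉ S := fun h => lt_irrefl _ (ha a h)
    have hcard : S.card ≤ a := by
      simpa using Finset.card_le_card fun r hr => Finset.mem_range.2 (ha r hr)
    rw [Finset.sum_insert haS, Finset.card_insert_of_notMem haS, Finset.sum_range_succ, add_comm]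
    exact add_le_add ih (hf hcard)

section Field

variable {α κ : ℝ} {h : ℤ → ℝ}

lemma sum_abs_rpow_le_of_injOn (hα : 1 < α) {B : Finset ℤ} (h0 : 0 ∉ B)
    (hinj : Set.InjOn Int.natAbs B) :
    ∑ x ∈ B, |(x : ℝ)| ^ (1 - α) ≤ ∑ n ∈ Finset.range B.card, ((n + 1 : ℕ) : ℝ) ^ (1 - α) := by
  set f : ℕ → ℝ := fun n => ((n + 1 : ℕ) : ℝ) ^ (1 - α)
  have hf : Antitone f := fun m n hmn =>
    Real.rpow_le_rpow_of_nonpos (by positivity) (by exact_mod_cast Nat.succ_le_succ hmn)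
      (by linarith)
  have hne (x) (hx : x ∈ B) : x ≠ 0 := ne_of_mem_of_not_mem hx h0
  have hpred : Set.InjOn (fun x : ℤ => x.natAbs - 1) B := fun x hx y hy hxy => by
    have := hne x hx
    have := hne y hy
    exact hinj hx hy (by simp only at hxy; lia)
  calc ∑ x ∈ B, |(x : ℝ)| ^ (1 - α) = ∑ x ∈ B, f (x.natAbs - 1) := by
        refine Finset.sum_congr rfl fun x hx => ?_
        rw [show |(x : ℝ)| = (x.natAbs - 1 + 1 : ℕ) by
          rw [Nat.sub_add_cancel (Int.natAbs_pos.2 (hne x hx)), Nat.cast_natAbs, Int.cast_abs]]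
    _ = ∑ r ∈ B.image fun x => x.natAbs - 1, f r := (Finset.sum_image hpred).symm
    _ ≤ ∑ n ∈ Finset.range B.card, f n := by
        rw [← Finset.card_image_of_injOn hpred]
        exact sum_le_sum_range_card_of_antitone hf _

lemma sum_abs_rpow_le (hα : 1 < α) (B : Finset ℤ) :
    ∑ x ∈ B, |(x : ℝ)| ^ (1 - α) ≤
      2 * ∑ n ∈ Finset.range B.card, ((n + 1 : ℕ) : ℝ) ^ (1 - α) := by
  have hside {C : Finset ℤ} (hC : C ⊆ B) (h0 : 0 ∉ C) (hinj : Set.InjOn Int.natAbs C) :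
      ∑ x ∈ C, |(x : ℝ)| ^ (1 - α) ≤ ∑ n ∈ Finset.range B.card, ((n + 1 : ℕ) : ℝ) ^ (1 - α) :=
    (sum_abs_rpow_le_of_injOn hα h0 hinj).trans (Finset.sum_le_sum_of_subset_of_nonneg
      (Finset.range_mono (Finset.card_le_card hC)) fun _ _ _ => by positivity)
  have h0 : |((0 : ℤ) : ℝ)| ^ (1 - α) = 0 := by simp [Real.zero_rpow (sub_neg.2 hα).ne]
  rw [← Finset.sum_erase B h0, ← Finset.sum_filter_add_sum_filter_not (B.erase 0) (0 < ·), two_mul]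
  refine add_le_add (hside ?_ (by simp) fun x hx y hy hxy => ?_)
    (hside ?_ (by simp) fun x hx y hy hxy => ?_)
  · exact (Finset.filter_subset _ _).trans (Finset.erase_subset _ _)
  · have := (Finset.mem_filter.1 hx).2
    have := (Finset.mem_filter.1 hy).2
    lia
  · exact (Finset.filter_subset _ _).trans (Finset.erase_subset _ _)
  · have := (Finset.mem_filter.1 hx).2
    have := (Finset.mem_filter.1 hy).2
    lia

lemma couplingMeasure_cut_ne_top (hα : 1 < α) (B : Finset ℤ) :
    couplingMeasure α (cut (B : Set ℤ)) ≠ ∞ :=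
  measure_ne_top_of_subset (fun _ hp => mem_or_mem_of_mem_cut hp)
    (couplingMeasure_touching_ne_top hα B)

lemma two_mul_sum_abs_field_le (hα : 1 < α) (hα₂ : α ≤ 2)
    (hh : ∀ x, |h x| ≤ κ * |(x : ℝ)| ^ (1 - α)) (B : Finset ℤ) :
    2 * ∑ x ∈ B, |h x| ≤ κ * (couplingMeasure α (cut (B : Set ℤ))).toReal := by
  have hκ : 0 ≤ κ := by simpa using (abs_nonneg _).trans (hh 1)
  have hcut : 4 * ∑ n ∈ Finset.range B.card, ((n + 1 : ℕ) : ℝ) ^ (1 - α) ≤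
      (couplingMeasure α (cut (B : Set ℤ))).toReal := by
    rw [← ENNReal.ofReal_le_iff_le_toReal (couplingMeasure_cut_ne_top hα B),
      ENNReal.ofReal_mul (by norm_num), ENNReal.ofReal_sum_of_nonneg fun _ _ => by positivity,
      ENNReal.ofReal_ofNat]
    exact four_mul_sum_rpow_le_couplingMeasure_cut hα hα₂ B
  calc 2 * ∑ x ∈ B, |h x| ≤ 2 * ∑ x ∈ B, κ * |(x : ℝ)| ^ (1 - α) := by
        gcongr with x
        exact hh x
    _ = κ * (2 * ∑ x ∈ B, |(x : ℝ)| ^ (1 - α)) := by rw [← Finset.mul_sum]; ring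
    _ ≤ κ * (2 * (2 * ∑ n ∈ Finset.range B.card, ((n + 1 : ℕ) : ℝ) ^ (1 - α))) := by
        gcongr
        exact sum_abs_rpow_le hα B
    _ ≤ _ := by
        gcongr
        linarith

end Field

/-! ### The Peierls argument -/

/-- The configuration with the spins in `S` reversed. -/
noncomputable def flipOn (S : Set ℤ) (σ : Config) : Config :=
  open Classical in fun x => if x ∈ S then !σ x else σ x

/-- The pairs cut by `S` whose spins agree: reversing `S` raises their energy. -/
def alignedCut (S : Set ℤ) (σ : Config) : Set (ℤ × ℤ) := {p | p ∈ cut S ∧ σ p.1 = σ p.2}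

section Reversal

variable {α : ℝ} {B Λ : Finset ℤ} {S : Set ℤ}

lemma preimage_swap_alignedCut (S : Set ℤ) (σ : Config) :
    Prod.swap ⁻¹' alignedCut S σ = alignedCut S σ := by
  ext p
  exact and_congr (not_congr iff_comm) eq_comm

lemma pairEnergy_sub_pairEnergy_flipOn (α : ℝ) (hS : S ⊆ Λ) (σ : Config) (p : ℤ × ℤ) :
    pairEnergy α Λ σ p - pairEnergy α Λ (flipOn S σ) p =
      2 * {p | p ∈ cut S ∧ p.1 < p.2}.indicator (pairCoupling α) p -
      4 * {p | p ∈ alignedCut S σ ∧ p.1 < p.2}.indicator (pairCoupling α) p := by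
  classical
  have hΛ (x) (hx : x ∈ S) : x ∈ Λ := hS hx
  simp only [Set.indicator_apply, Set.mem_ofPred_eq, alignedCut, mem_cut, pairEnergy, pairCoupling,
    flipOn]
  by_cases hlt : p.1 < p.2
  · by_cases h₁ : p.1 ∈ S <;> by_cases h₂ : p.2 ∈ S
    · simp [h₁, h₂, spin_not]
    · simp only [h₁, h₂, hlt, hΛ, if_true, if_false, spin_not, neg_mul, spin_mul_spin, true_and,
        and_true, true_or, iff_false, not_true_eq_false, not_false_eq_true]
      split_ifs <;> ring
    · simp only [h₁, h₂, hlt, hΛ, if_true, if_false, spin_not, mul_neg, spin_mul_spin, true_and,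
        and_true, or_true, iff_true, not_false_eq_true]
      split_ifs <;> ring
    · simp [h₁, h₂]
  · simp [hlt]

lemma toReal_couplingMeasure_eq_two_mul_tsum {T : Set (ℤ × ℤ)} (hT : Prod.swap ⁻¹' T = T) :
    (couplingMeasure α T).toReal =
      2 * ∑' p, {p | p ∈ T ∧ p.1 < p.2}.indicator (pairCoupling α) p := by
  rw [couplingMeasure_eq_two_mul hT, ENNReal.toReal_mul, ENNReal.toReal_ofNat,
    toReal_couplingMeasure]

lemma hamiltonian_sub_hamiltonian_flipOn (hα : 1 < α) (h : ℤ → ℝ) (hB : B ⊆ Λ) (σ : Config) :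
    hamiltonian α h Λ σ - hamiltonian α h Λ (flipOn B σ) =
      (couplingMeasure α (cut (B : Set ℤ))).toReal -
        2 * (couplingMeasure α (alignedCut B σ)).toReal - 2 * ∑ x ∈ B, h x * spin (σ x) := by
  have hsummable {T : Set (ℤ × ℤ)} (hT : T ⊆ cut (B : Set ℤ)) :
      Summable ({p | p ∈ T ∧ p.1 < p.2}.indicator (pairCoupling α)) :=
    summable_indicator_pairCoupling (measure_ne_top_of_subset (fun _ hp => hT hp.1)
      (couplingMeasure_cut_ne_top hα B))
  have hpair : (∑' p, pairEnergy α Λ σ p) - ∑' p, pairEnergy α Λ (flipOn B σ) p =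
      (couplingMeasure α (cut (B : Set ℤ))).toReal -
        2 * (couplingMeasure α (alignedCut B σ)).toReal := by
    rw [toReal_couplingMeasure_eq_two_mul_tsum (preimage_swap_cut _),
      toReal_couplingMeasure_eq_two_mul_tsum (preimage_swap_alignedCut _ _), ← mul_assoc,
      show (2 : ℝ) * 2 = 4 by norm_num, ← tsum_mul_left, ← tsum_mul_left,
      ← (summable_pairEnergy hα Λ σ).tsum_sub (summable_pairEnergy hα Λ _),
      ← ((hsummable subset_rfl).mul_left 2).tsum_sub ((hsummable fun _ hp => hp.1).mul_left 4)]
    exact tsum_congr (pairEnergy_sub_pairEnergy_flipOn α (Finset.coe_subset.2 hB) σ)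
  have hfield : ∑ x ∈ Λ, h x * (1 - spin (σ x)) - ∑ x ∈ Λ, h x * (1 - spin (flipOn B σ x)) =
      -(2 * ∑ x ∈ B, h x * spin (σ x)) := by
    rw [← Finset.sum_sub_distrib, ← Finset.sum_subset hB, Finset.mul_sum,
      ← Finset.sum_neg_distrib]
    · refine Finset.sum_congr rfl fun x hx => ?_
      rw [flipOn, if_pos (Finset.mem_coe.2 hx), spin_not]
      ring
    · intro x _ hx
      rw [flipOn, if_neg (mt Finset.mem_coe.1 hx), sub_self]
  rw [hamiltonian_eq, hamiltonian_eq]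
  linarith

lemma sum_weight_flipOn (α : ℝ) (h : ℤ → ℝ) (β : ℝ) (hS : S ⊆ Λ) (ω : Config) :
    ∑ τ : Λ → Bool, weight α h β Λ (flipOn S (glue Λ τ ω)) = partitionFunction α h β Λ ω := by
  classical
  have hinv : Function.Involutive fun (τ : Λ → Bool) x => if (x : ℤ) ∈ S then !τ x else τ x := by
    intro τ
    funext x
    by_cases hx : (x : ℤ) ∈ S <;> simp [hx]
  refine Fintype.sum_equiv hinv.toPerm _ _ fun τ => congrArg _ (funext fun x => ?_)
  by_cases hx : x ∈ Λ
  · simp only [flipOn, glue_apply_mem hx, Function.Involutive.coe_toPerm]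
  · simp only [flipOn, glue_apply_notMem hx, if_neg fun hxS => hx (hS hxS)]

end Reversal

/-- The weight of a contour in the Peierls bound, where the entropy of the contours is measured by
the number of blocks they meet on all scales up to their own. -/
noncomputable def peierlsWeight (m : ℕ) (γ : Finset ℤ) : ℝ :=
  (1 / 68) ^ blockCount γ (scaleExp m (scaleIndex m γ) + 3)

/-- The finite sets that can be contours around the origin of a configuration which is constant
outside `[-L, L]`. -/
noncomputable def contoursAroundZero (L : ℕ) : Finset (Finset ℤ) :=
  open Classical in
  (Finset.Icc (-L : ℤ) (L + 1)).powerset.filter fun γ => γ.Nonempty ∧ Even γ.card ∧ 0 ∈ inside γ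

lemma mem_contoursAroundZero {L : ℕ} {γ : Finset ℤ} : γ ∈ contoursAroundZero L ↔
    γ ⊆ Finset.Icc (-L : ℤ) (L + 1) ∧ γ.Nonempty ∧ Even γ.card ∧ 0 ∈ inside γ := by
  classical
  rw [contoursAroundZero, Finset.mem_filter, Finset.mem_powerset]

lemma sum_peierlsWeight_le {m : ℕ} (hm : 16 ≤ m) (L : ℕ) :
    ∑ γ ∈ contoursAroundZero L, peierlsWeight m γ ≤ 1 / 4 := by
  refine sum_pow_blockCount_le (fun γ hγ => (mem_contoursAroundZero.1 hγ).2.1)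
    (fun γ _ => by lia) fun γ hγ => ?_
  obtain ⟨-, -, heven, h0⟩ := mem_contoursAroundZero.1 hγ
  exact subset_Ico_of_zero_mem_inside hm heven h0

lemma boundary_subset_Icc {L : ℕ} {A : Finset ℤ} (hA : A ⊆ box L) :
    boundary A ⊆ Finset.Icc (-L : ℤ) (L + 1) := by
  intro p hp
  have hbox (x) (hx : x ∈ A) : -(L : ℤ) ≤ x ∧ x ≤ L := mem_box.1 (hA hx)
  rw [mem_boundary] at hp
  rw [Finset.mem_Icc]
  by_cases h : p ∈ A
  · have := hbox p h
    lia
  · have := hbox (p - 1) (by tauto)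
    lia

lemma inside_subset_box {L : ℕ} {γ : Finset ℤ} (hγ : γ ⊆ Finset.Icc (-L : ℤ) (L + 1))
    (heven : Even γ.card) : inside γ ⊆ box L := by
  intro x hx
  obtain ⟨p, hp, hpx⟩ := exists_le_of_mem_inside hx
  obtain ⟨q, hq, hxq⟩ := exists_lt_of_mem_inside heven hx
  have hp' := Finset.mem_Icc.1 (hγ hp)
  have hq' := Finset.mem_Icc.1 (hγ hq)
  rw [Finset.mem_coe, mem_box]
  lia

lemma exists_mem_contoursAroundZero {m L : ℕ} (hm : 16 ≤ m) {A : Finset ℤ} (hA : A ⊆ box L)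
    (h0 : 0 ∈ A) : ∃ P, IsContourFamily m (boundary A) P ∧
      ∃ γ ∈ P, Unsplittable m γ ∧ γ ∈ contoursAroundZero L := by
  have h0_inside : (0 : ℤ) ∈ inside (boundary A) := mem_inside_boundary.2 h0
  obtain ⟨p, hp, -⟩ := exists_le_of_mem_inside h0_inside
  obtain ⟨P, hP, hunsplittable⟩ := exists_isContourFamily hm ⟨p, hp⟩ (even_card_boundary A)
  obtain ⟨γ, hγ, h0γ⟩ := hP.exists_mem_inside h0_inside
  have hsub : γ ⊆ boundary A := hP.biUnion_eq ▸ Finset.subset_biUnion_of_mem id hγ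
  exact ⟨P, hP, γ, hγ, hunsplittable γ hγ, mem_contoursAroundZero.2
    ⟨hsub.trans (boundary_subset_Icc hA), hP.nonempty γ hγ, hP.even γ hγ, h0γ⟩⟩

section Peierls

variable {α κ β : ℝ} {h : ℤ → ℝ} {m : ℕ} {σ : Config} {b : Bool}
  {A γ Λ : Finset ℤ} {P : Finset (Finset ℤ)}
  (hα : 1 < α) (hα₂ : α ≤ 2) (hκ : κ < 1) (hh : ∀ x, |h x| ≤ κ * |(x : ℝ)| ^ (1 - α))
  (hm : 64 ≤ m) (hloss : nestingLoss α m ≤ ENNReal.ofReal ((1 - κ) / 4))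

include hα hα₂ hκ hm hloss in
lemma couplingMeasure_alignedCut_le (hA : ∀ x, x ∈ A ↔ σ x ≠ b)
    (hP : IsContourFamily m (boundary A) P) (hγ : γ ∈ P)
    (hfin : couplingMeasure α (cut (inside γ)) ≠ ∞) :
    (couplingMeasure α (alignedCut (inside γ) σ)).toReal ≤
      (1 - κ) / 4 * (couplingMeasure α (cut (inside γ))).toReal := by
  have hsub : alignedCut (inside γ) σ ⊆ sameSide (boundary A) γ := fun p hp => by
    refine ⟨hp.1, ?_⟩
    rw [mem_cut, mem_inside_boundary, mem_inside_boundary, hA, hA, hp.2]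
    exact not_not.2 Iff.rfl
  rw [← ENNReal.toReal_ofReal (by linarith : 0 ≤ (1 - κ) / 4), ← ENNReal.toReal_mul]
  refine ENNReal.toReal_mono (ENNReal.mul_ne_top ENNReal.ofReal_ne_top hfin) ?_
  exact (measure_mono hsub).trans ((couplingMeasure_sameSide_le (by linarith) hα₂ hm hP hγ).trans
    (mul_le_mul' hloss le_rfl))

include hα hα₂ hκ hh hm hloss

lemma hamiltonian_flipOn_add_le (hA : ∀ x, x ∈ A ↔ σ x ≠ b)
    (hP : IsContourFamily m (boundary A) P) (hγ : γ ∈ P) (hγΛ : inside γ ⊆ Λ) :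
    hamiltonian α h Λ (flipOn (inside γ) σ) +
        (1 - κ) / 2 * (couplingMeasure α (cut (inside γ))).toReal ≤ hamiltonian α h Λ σ := by
  obtain ⟨B, hB⟩ := (Λ.finite_toSet.subset hγΛ).exists_finset_coe
  have hfin := couplingMeasure_cut_ne_top hα B
  have henergy := hamiltonian_sub_hamiltonian_flipOn hα h (Finset.coe_subset.1 (hB ▸ hγΛ)) σ
  have hfield := two_mul_sum_abs_field_le hα hα₂ hh B
  rw [hB] at hfin henergy hfield
  have haligned := couplingMeasure_alignedCut_le hα hα₂ hκ hm hloss hA hP hγ hfin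
  have hspin : ∑ x ∈ B, h x * spin (σ x) ≤ ∑ x ∈ B, |h x| := by
    refine Finset.sum_le_sum fun x _ => (le_abs_self _).trans_eq ?_
    rw [abs_mul, abs_spin, mul_one]
  linarith

variable (hβ : (9 * m + 643 : ℕ) * Real.log 68 ≤ β * ((1 - κ) / 2))
include hβ

lemma weight_le_peierlsWeight_mul_weight_flipOn (hA : ∀ x, x ∈ A ↔ σ x ≠ b)
    (hP : IsContourFamily m (boundary A) P) (hγ : γ ∈ P) (hu : Unsplittable m γ)
    (hγΛ : inside γ ⊆ Λ) :
    weight α h β Λ σ ≤ peierlsWeight m γ * weight α h β Λ (flipOn (inside γ) σ) := by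
  set n := blockCount γ (scaleExp m (scaleIndex m γ) + 3)
  set cutEnergy := (couplingMeasure α (cut (inside γ))).toReal
  have hlog : 0 ≤ Real.log 68 := Real.log_nonneg (by norm_num)
  have hβ_nonneg : 0 ≤ β := nonneg_of_mul_nonneg_left
    ((mul_nonneg (Nat.cast_nonneg _) hlog).trans hβ) (by linarith)
  have hfin : couplingMeasure α (cut (inside γ)) ≠ ∞ := by
    obtain ⟨B, hB⟩ := (Λ.finite_toSet.subset hγΛ).exists_finset_coe
    exact hB ▸ couplingMeasure_cut_ne_top hα B
  have hblock : (n : ℝ) ≤ (9 * m + 643 : ℕ) * cutEnergy := by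
    have := ENNReal.toReal_mono (ENNReal.mul_ne_top (ENNReal.natCast_ne_top _) hfin)
      (blockCount_le_couplingMeasure_cut hα₂ hm hu)
    rwa [ENNReal.toReal_mul, ENNReal.toReal_natCast, ENNReal.toReal_natCast] at this
  have hgain : n * Real.log 68 ≤
      β * (hamiltonian α h Λ σ - hamiltonian α h Λ (flipOn (inside γ) σ)) :=
    calc n * Real.log 68 ≤ (9 * m + 643 : ℕ) * cutEnergy * Real.log 68 := by gcongr
      _ = (9 * m + 643 : ℕ) * Real.log 68 * cutEnergy := by ring
      _ ≤ β * ((1 - κ) / 2) * cutEnergy :=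
        mul_le_mul_of_nonneg_right hβ ENNReal.toReal_nonneg
      _ = β * ((1 - κ) / 2 * cutEnergy) := mul_assoc _ _ _
      _ ≤ _ := mul_le_mul_of_nonneg_left (le_sub_iff_add_le'.2
        (hamiltonian_flipOn_add_le hα hα₂ hκ hh hm hloss hA hP hγ hγΛ)) hβ_nonneg
  have hexp : peierlsWeight m γ = Real.exp (-(n * Real.log 68)) := by
    rw [peierlsWeight, Real.exp_neg, mul_comm, Real.exp_mul, Real.exp_log (by norm_num),
      Real.rpow_natCast, one_div, inv_pow]
  rw [hexp, weight, weight, ← Real.exp_add, Real.exp_le_exp]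
  linarith

lemma weight_le_sum_peierlsWeight_mul_weight_flipOn {L : ℕ} (hσ : ∀ x ∉ box L, σ x = b)
    (h0 : σ 0 ≠ b) :
    weight α h β (box L) σ ≤ ∑ γ ∈ contoursAroundZero L,
      peierlsWeight m γ * weight α h β (box L) (flipOn (inside γ) σ) := by
  set A := (box L).filter (σ · ≠ b)
  have hA (x) : x ∈ A ↔ σ x ≠ b := by
    rw [Finset.mem_filter, and_iff_right_iff_imp]
    exact fun hx => not_not.1 (mt (hσ x) hx)
  obtain ⟨P, hP, γ, hγ, hu, hγL⟩ := exists_mem_contoursAroundZero (by lia : 16 ≤ m)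
    (Finset.filter_subset _ _) ((hA 0).2 h0)
  obtain ⟨hsub, -, heven, -⟩ := mem_contoursAroundZero.1 hγL
  refine (weight_le_peierlsWeight_mul_weight_flipOn hα hα₂ hκ hh hm hloss hβ hA hP hγ hu
    (inside_subset_box hsub heven)).trans ?_
  exact Finset.single_le_sum
    (f := fun γ => peierlsWeight m γ * weight α h β (box L) (flipOn (inside γ) σ))
    (fun γ _ => mul_nonneg (by rw [peierlsWeight]; positivity) (weight_pos _).le) hγL

lemma sum_weight_ne_le (b : Bool) (L : ℕ) :
    ∑ τ : box L → Bool with glue (box L) τ (fun _ => b) 0 ≠ b,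
        weight α h β (box L) (glue (box L) τ fun _ => b) ≤
      1 / 4 * partitionFunction α h β (box L) fun _ => b := by
  set ω : Config := fun _ => b
  calc ∑ τ : box L → Bool with glue (box L) τ ω 0 ≠ b, weight α h β (box L) (glue (box L) τ ω)
      ≤ ∑ τ : box L → Bool with glue (box L) τ ω 0 ≠ b, ∑ γ ∈ contoursAroundZero L,
          peierlsWeight m γ * weight α h β (box L) (flipOn (inside γ) (glue (box L) τ ω)) :=
        Finset.sum_le_sum fun τ hτ => weight_le_sum_peierlsWeight_mul_weight_flipOn hα hα₂ hκ hh hm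
          hloss hβ (fun x hx => glue_apply_notMem hx) (Finset.mem_filter.1 hτ).2
    _ ≤ ∑ τ : box L → Bool, ∑ γ ∈ contoursAroundZero L,
          peierlsWeight m γ * weight α h β (box L) (flipOn (inside γ) (glue (box L) τ ω)) :=
        Finset.sum_le_sum_of_subset_of_nonneg (Finset.filter_subset _ _) fun τ _ _ =>
          Finset.sum_nonneg fun γ _ =>
            mul_nonneg (by rw [peierlsWeight]; positivity) (weight_pos _).le
    _ = (∑ γ ∈ contoursAroundZero L, peierlsWeight m γ) * partitionFunction α h β (box L) ω := by
        rw [Finset.sum_comm, Finset.sum_mul]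
        refine Finset.sum_congr rfl fun γ hγ => ?_
        obtain ⟨hsub, -, heven, -⟩ := mem_contoursAroundZero.1 hγ
        rw [← Finset.mul_sum, sum_weight_flipOn α h β (inside_subset_box hsub heven)]
    _ ≤ 1 / 4 * partitionFunction α h β (box L) ω :=
        mul_le_mul_of_nonneg_right (sum_peierlsWeight_le (by lia) L) (partitionFunction_pos ω).le

lemma half_le_spin_mul_magnetization (b : Bool) (L : ℕ) :
    1 / 2 ≤ spin b * magnetization α h β b L := by
  set ω : Config := fun _ => b
  set Z := partitionFunction α h β (box L) ω with hZ
  set E := ∑ τ : box L → Bool with glue (box L) τ ω 0 ≠ b,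
    weight α h β (box L) (glue (box L) τ ω) with hE
  have hbad : E ≤ 1 / 4 * Z := sum_weight_ne_le hα hα₂ hκ hh hm hloss hβ b L
  have hsum : ∑ τ : box L → Bool,
      spin b * spin (glue (box L) τ ω 0) * weight α h β (box L) (glue (box L) τ ω) =
        Z - 2 * E := by
    rw [hZ, hE, partitionFunction_eq, Finset.sum_filter, Finset.mul_sum, ← Finset.sum_sub_distrib]
    refine Finset.sum_congr rfl fun τ _ => ?_
    rw [spin_mul_spin]
    obtain hτ | hτ := eq_or_ne (glue (box L) τ ω 0) b
    · simp [hτ]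
    · rw [if_neg hτ.symm, if_pos hτ]
      ring
  rw [magnetization, ← gibbsExp_const_mul, gibbsExp_eq, le_div_iff₀ (partitionFunction_pos ω), hsum]
  linarith

end Peierls

/-! ### Decaying fields -/

section PhaseTransition

variable {α δ hs : ℝ}

/-- At `x = 0` the bound says `h 0 = 0`, because the power `0 ^ (1 - α)` is `0`; put `0` into `D` to
allow an arbitrary field at the origin. -/
theorem hasPhaseTransition_of_abs_field_le {κ : ℝ} (hα : 1 < α) (hα₂ : α ≤ 2) (hκ : 0 ≤ κ)
    (hκ₁ : κ < 1) {h : ℤ → ℝ} {D : Finset ℤ} (hh : ∀ x ∉ D, |h x| ≤ κ * |(x : ℝ)| ^ (1 - α)) :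
    HasPhaseTransition α h := by
  obtain ⟨m, hm, hloss⟩ := exists_nestingLoss_le hα (by linarith : 0 < (1 - κ) / 4)
  have hgain : 0 < (1 - κ) / 2 := by linarith
  have : 0 < Real.log 68 := Real.log_pos (by norm_num)
  refine hasPhaseTransition_of_separated hα
    (β₀ := (9 * m + 643 : ℕ) * Real.log 68 / ((1 - κ) / 2)) (by positivity) fun β hβ => ?_
  have hβ_pos : 0 < β := lt_of_lt_of_le (by positivity) hβ
  set h' : ℤ → ℝ := fun x => if x ∈ D then 0 else h x with hh'
  have hfield (x) : |h' x| ≤ κ * |(x : ℝ)| ^ (1 - α) := by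
    by_cases hx : x ∈ D
    · simp only [hh', hx, if_true, abs_zero]
      positivity
    · simpa only [hh', hx, if_false] using hh x hx
  have hmag := half_le_spin_mul_magnetization hα hα₂ hκ₁ hfield hm hloss ((div_le_iff₀ hgain).1 hβ)
  refine exists_separated_of_field_eq_off hα hβ_pos (h' := h') (D := D)
    (fun x hx => (if_neg hx).symm) one_half_pos (fun L => ?_) fun L => ?_
  · have := hmag false L
    rw [spin, if_neg Bool.false_ne_true] at this
    linarith
  · simpa [spin] using hmag true L

lemma hasPhaseTransition_decayingField_of_lt (hα : 1 < α) (hα₂ : α ≤ 2) (hδ : α - 1 < δ) :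
    HasPhaseTransition α (decayingField hs δ) := by
  have hlim : Tendsto (fun x : ℝ => |hs| * x ^ (-(δ - (α - 1)))) atTop (𝓝 0) := by
    simpa using (tendsto_rpow_neg_atTop (sub_pos.2 hδ)).const_mul |hs|
  obtain ⟨R, hR⟩ := eventually_atTop.1 (hlim.eventually_le_const one_half_pos)
  obtain ⟨N, hN⟩ := exists_nat_ge R
  refine hasPhaseTransition_of_abs_field_le hα hα₂ one_half_pos.le one_half_lt_one
    (D := Finset.Icc (-N : ℤ) N) fun x hx => ?_
  have hxN : (N : ℤ) < |x| := by rwa [Finset.mem_Icc, ← abs_le, not_le] at hx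
  have hx0 : x ≠ 0 := abs_pos.1 (N.cast_nonneg.trans_lt hxN)
  have hx_pos : 0 < |(x : ℝ)| := abs_pos.2 (Int.cast_ne_zero.2 hx0)
  have hRx : R ≤ |(x : ℝ)| := hN.trans (by exact_mod_cast hxN.le)
  calc |decayingField hs δ x| = |hs| * |(x : ℝ)| ^ (-(δ - (α - 1))) * |(x : ℝ)| ^ (1 - α) := by
        rw [decayingField, if_neg hx0, abs_mul,
          abs_of_nonneg (by positivity : 0 ≤ |(x : ℝ)| ^ (-δ)), mul_assoc, ← Real.rpow_add hx_pos]
        congr 2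
        ring
    _ ≤ 1 / 2 * |(x : ℝ)| ^ (1 - α) := by
        gcongr
        exact hR _ hRx

lemma hasPhaseTransition_decayingField_critical (hα : 1 < α) (hα₂ : α ≤ 2) (hhs : |hs| < 1) :
    HasPhaseTransition α (decayingField hs (α - 1)) := by
  refine hasPhaseTransition_of_abs_field_le hα hα₂ (abs_nonneg hs) hhs (D := {0}) fun x hx => ?_
  rw [decayingField, if_neg (mt Finset.mem_singleton.2 hx), neg_sub, abs_mul,
    abs_of_nonneg (by positivity : 0 ≤ |(x : ℝ)| ^ (1 - α))]

lemma critical_threshold_le_one (hα : 0 ≤ α) (hα₂ : α ≤ 2) :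
    (8 - 4 * α) / ((2 : ℝ) ^ (3 - α) + 6 - 3 * α) ≤ 1 := by
  have hpow : (2 : ℝ) ^ (1 : ℝ) ≤ 2 ^ (3 - α) :=
    Real.rpow_le_rpow_of_exponent_le one_le_two (by linarith)
  rw [Real.rpow_one] at hpow
  exact div_le_one_of_le₀ (by linarith) (by linarith)

lemma inverse_square_threshold_le_one : 4 / (3 + 2 * Real.log 2) ≤ 1 := by
  have hlog := Real.log_two_gt_d9
  exact div_le_one_of_le₀ (by linarith) (by linarith)

end PhaseTransition

end LongRangeIsing

theorem mainTheorem3_general {α δ hs : ℝ} (hα₁ : 1 < α) (hα₂ : α ≤ 2)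
    (h : α - 1 < δ ∨ δ = α - 1 ∧ |hs| < 1) :
    LongRangeIsing.HasPhaseTransition α (LongRangeIsing.decayingField hs δ) := by
  obtain hδ | ⟨rfl, hhs⟩ := h
  · exact LongRangeIsing.hasPhaseTransition_decayingField_of_lt hα₁ hα₂ hδ
  · exact LongRangeIsing.hasPhaseTransition_decayingField_critical hα₁ hα₂ hhs

theorem mainTheorem3 (α δ hs : ℝ) (hα₁ : 1 < α) (hα₂ : α ≤ 2) (hhs : 0 ≤ hs) :
    (α - 1 < δ →
      LongRangeIsing.HasPhaseTransition α (LongRangeIsing.decayingField hs δ)) ∧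
    (δ = α - 1 → α < 2 → hs < (8 - 4 * α) / ((2 : ℝ) ^ (3 - α) + 6 - 3 * α) →
      LongRangeIsing.HasPhaseTransition α (LongRangeIsing.decayingField hs δ)) ∧
    (δ = α - 1 → α = 2 → hs < 4 / (3 + 2 * Real.log 2) →
      LongRangeIsing.HasPhaseTransition α (LongRangeIsing.decayingField hs δ)) := by
  have critical (hδ : δ = α - 1) (hlt : hs < 1) :
      LongRangeIsing.HasPhaseTransition α (LongRangeIsing.decayingField hs δ) :=
    mainTheorem3_general hα₁ hα₂ (.inr ⟨hδ, (abs_of_nonneg hhs).trans_lt hlt⟩)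
  exact ⟨fun hδ => mainTheorem3_general hα₁ hα₂ (.inl hδ),
    fun hδ _ hlt => critical hδ
      (hlt.trans_le (LongRangeIsing.critical_threshold_le_one (by linarith) hα₂)),
    fun hδ _ hlt => critical hδ (hlt.trans_le LongRangeIsing.inverse_square_threshold_le_one)⟩
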